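/- **Setting.** Let $\pi:\mathbf V\to M$ be a smooth surjective submersion of smooth finite-dimensional manifolds (without boundary, Hausdorff, second countable), $v\mathbf V=\ker d\pi$, and let $\mathbf N:T\mathbf V\to v\mathbf V$ be an N-connection: a smooth bundle map with $\mathbf N|_{v\mathbf V}=\mathrm{id}$. Put $h\mathbf V=\ker\mathbf N$, so $T\mathbf V=h\mathbf V\oplus v\mathbf V$, and let $\mathbf g$ be a Riemannian d-metric, i.e. a smooth Riemannian metric on $\mathbf V$ with $h\mathbf V\perp v\mathbf V$. A d-connection is a smooth linear connection on $T\mathbf V$ preserving $h\mathbf V$ and $v\mathbf V$. The canonical d-connection $\widehat{\mathbf D}$ is the metric d-connection with torsion $T(X,Y)=D_XY-D_YX-[X,Y]$ satisfying $hT(X,Y)=0$ for $X,Y$ horizontal and $vT(X,Y)=0$ for $X,Y$ vertical, and $$2\mathbf g(\widehat{\mathbf D}_XY,Z)=X\,\mathbf g(Y,Z)+\mathbf g([X,Y],Z)-\mathbf g([X,Z],Y)$$ whenever $X$ is horizontal and $Y,Z$ are vertical, or $X$ is vertical and $Y,Z$ are horizontal (in an N-adapted frame $e_k=\partial_k-N_k^a\partial_a$,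 $e_a=\partial_a$ the latter read $\widehat L^a_{bk}=e_b(N^a_k)+\tfrac12h^{ac}(e_kh_{bc}-h_{dc}e_bN^d_k-h_{db}e_cN^d_k)$, $\widehat C^i_{jc}=\tfrac12g^{ik}e_cg_{jk}$). Let $Cl(\mathbf V)$ be the bundle of complexified Clifford algebras of $(T_x\mathbf V,\mathbf g_x)$ with $\xi^2=\mathbf g(\xi,\xi)$. A spin N-anholonomic manifold $(\mathbf V,\mathbf{Sp},J)$ consists of such a $\mathbf V$, a smooth complex vector bundle $\mathbf{Sp}\to\mathbf V$ of finite rank with a smooth fibrewise irreducible action $\mathbf c$ of $Cl(\mathbf V)$, a smooth Hermitian inner product $(\cdot|\cdot)$ on $\mathbf{Sp}$ for which $\mathbf c(\xi)$, $\xi\in T\mathbf V$, is self-adjoint, and a smooth fibrewise antilinear bijection $J:\mathbf{Sp}\to\mathbf{Sp}$ with $(J\phi|J\psi)=(\psi|\phi)$ and $J\mathbf c(\xi)=\varepsilon\,\mathbf c(\xi)J$ for all $\xi\in T\mathbf V$, for a fixed sign $\varepsilon\in\{1,-1\}$. It is a spin Lagrange space if $\mathbf V=TM\setminus\{0\}$,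 $\pi$ is the bundle projection and, for a continuous $L:TM\to\mathbb R$ which is smooth on $\mathbf V$ with nondegenerate $g_{ij}=\tfrac12\partial^2L/\partial y^i\partial y^j$, one has $\mathbf N=(dy^i+N^i_jdx^j)\otimes\partial/\partial y^i$ with $N^i_j=\partial G^i/\partial y^j$, $2G^i=\tfrac12g^{ij}\big(\tfrac{\partial^2L}{\partial y^j\partial x^k}y^k-\tfrac{\partial L}{\partial x^j}\big)$, and $\mathbf g=g_{ij}\,dx^i\otimes dx^j+g_{ij}\,(dy^i+N^i_kdx^k)\otimes(dy^j+N^j_ldx^l)$ (so $g_{ij}$ is positive definite). **Theorem.** Let $(\mathbf V,\mathbf{Sp},J)$ be a spin N-anholonomic manifold, for example a spin Lagrange space. The canonical d-connection $\widehat{\mathbf D}$ exists and is unique, and it extends in a unique way to a connection on $Cl(\mathbf V)$, again denoted $\widehat{\mathbf D}$, which acts by derivations. There is exactly one smooth complex linear connection $$\widehat\nabla^{\mathbf S}:\Gamma^\infty(\mathbf{Sp})\to\Gamma^\infty(\mathbf{Sp})\otimes\Omega^1(\mathbf V)$$ which commutes with $J$ and satisfies $$(\widehat\nabla^{\mathbf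 S}\psi|\phi)+(\psi|\widehat\nabla^{\mathbf S}\phi)=d(\psi|\phi),\qquad \widehat\nabla^{\mathbf S}(\mathbf c(a)\psi)=\mathbf c(\widehat{\mathbf D}a)\psi+\mathbf c(a)\widehat\nabla^{\mathbf S}\psi$$ for all $\psi,\phi\in\Gamma^\infty(\mathbf{Sp})$ and all smooth sections $a$ of $Cl(\mathbf V)$. In every local N-adapted orthonormal frame $(e_\alpha)$ and every local frame of $\mathbf{Sp}$ in which the $\gamma_\alpha=\mathbf c(e_\alpha)$, $J$ and $(\cdot|\cdot)$ have constant coefficients it is given on the elements $s$ of the spinor frame by $\widehat\nabla^{\mathbf S}s=-\tfrac14\sum_{\alpha,\beta}\mathbf g(\widehat{\mathbf D}e_\beta,e_\alpha)\,\gamma_\beta\gamma_\alpha s$. It defines the canonical Dirac d-operator $\widehat{\mathcal D}=-i\,\widehat{\mathbf c}\circ\widehat\nabla^{\mathbf S}:\Gamma^\infty(\mathbf{Sp})\to\Gamma^\infty(\mathbf{Sp})$, where $\widehat{\mathbf c}(\psi\otimes\alpha)=\mathbf c(\alpha^\sharp)\psi$ for one-forms $\alpha$, and $\widehat{\mathcal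 D}$ is the sum of its horizontal and vertical parts, obtained by contracting only the derivatives along $h\mathbf V$ and along $v\mathbf V$, each of which maps $\Gamma^\infty(\mathbf{Sp})$ to itself. -/

import Mathlib

open Bundle Manifold Set Filter Function
open scoped Manifold ContDiff Topology TensorProduct ComplexConjugate

set_option linter.unusedSectionVars false

noncomputable section

namespace NSpin

section NManifold

variable {E : Type*} [NormedAddCommGroup E] [NormedSpace ℝ E] [FiniteDimensional ℝ E]
  {H : Type*} [TopologicalSpace H] (I : ModelWithCorners ℝ E H)
  (V : Type*) [TopologicalSpace V] [ChartedSpace H V] [IsManifold I ∞ V]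
  {E' : Type*} [NormedAddCommGroup E'] [NormedSpace ℝ E']
  {H' : Type*} [TopologicalSpace H'] (I' : ModelWithCorners ℝ E' H')
  (M : Type*) [TopologicalSpace M] [ChartedSpace H' M]

/-- An N-anholonomic manifold with d-metric: a smooth surjective submersion `π : V → M`, a
nonlinear connection, that is a smooth bundle map `N : TV → vV = ker dπ` which is the identity
on `vV`, and a Riemannian metric `g` on `V` for which `hV = ker N` and `vV` are orthogonal. -/
structure NAnholonomicManifold where
  proj : V → M
  proj_smooth : ContMDiff I I' ∞ proj
  proj_surjective : Surjective proj
  proj_submersion : ∀ x, Surjective (mfderiv I I' proj x)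
  N : ∀ x : V, TangentSpace I x →L[ℝ] TangentSpace I x
  N_smooth : ContMDiff I (I.prod 𝓘(ℝ, E →L[ℝ] E)) ∞
    (fun x ↦ TotalSpace.mk' (E →L[ℝ] E) (E := fun x : V ↦ TangentSpace I x →L[ℝ] TangentSpace I x)
      x (N x))
  N_vertical : ∀ x ξ, mfderiv I I' proj x (N x ξ) = 0
  N_splits : ∀ x ξ, mfderiv I I' proj x ξ = 0 → N x ξ = ξ
  g : ContMDiffRiemannianMetric I ∞ E (fun x : V ↦ TangentSpace I x)
  orthogonal : ∀ x (ξ η : TangentSpace I x), N x ξ = 0 → N x η = η → g.inner x ξ η = 0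

variable {I V I' M}

/-- `X` is a smooth vector field on `V`. -/
def SmoothVF (X : ∀ x : V, TangentSpace I x) : Prop :=
  ContMDiff I (I.prod 𝓘(ℝ, E)) ∞ (fun x ↦ TotalSpace.mk' E x (X x))

namespace NAnholonomicManifold

variable (𝒱 : NAnholonomicManifold I V I' M)

/-- `X` is horizontal: a section of `hV = ker N`. -/
def IsHorizontal (X : ∀ x : V, TangentSpace I x) : Prop := ∀ x, 𝒱.N x (X x) = 0

/-- `X` is vertical: a section of `vV`. -/
def IsVertical (X : ∀ x : V, TangentSpace I x) : Prop := ∀ x, 𝒱.N x (X x) = X x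

/-- The projection of `TV = hV ⊕ vV` onto `hV`. -/
def hProj (x : V) : TangentSpace I x →L[ℝ] TangentSpace I x :=
  ContinuousLinearMap.id ℝ (TangentSpace I x) - 𝒱.N x

/-- The function `u ↦ g(X, Y)(u)`. -/
def gFun (X Y : ∀ x : V, TangentSpace I x) (x : V) : ℝ := 𝒱.g.inner x (X x) (Y x)

/-- The torsion `T(X, Y) = D_X Y - D_Y X - [X, Y]`. -/
def torsionField (D : CovariantDerivative I E (fun x : V ↦ TangentSpace I x))
    (X Y : ∀ x : V, TangentSpace I x) (x : V) : TangentSpace I x :=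
  D Y x (X x) - D X x (Y x) - VectorField.mlieBracket I X Y x

/-- `D` is a d-connection: a smooth linear connection on `TV` which preserves the
splitting `TV = hV ⊕ vV`. -/
structure IsDConnection (D : CovariantDerivative I E (fun x : V ↦ TangentSpace I x)) : Prop where
  smooth : CovariantDerivative.ContMDiffCovariantDerivative D ∞
  horizontal : ∀ Y, SmoothVF Y → 𝒱.IsHorizontal Y → ∀ x ξ, 𝒱.N x (D Y x ξ) = 0
  vertical : ∀ Y, SmoothVF Y → 𝒱.IsVertical Y → ∀ x ξ, 𝒱.N x (D Y x ξ) = D Y x ξ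

/-- `D` is the canonical d-connection of `(V, N, g)`: the metric d-connection with vanishing
`hh`-torsion in `hV` and vanishing `vv`-torsion in `vV`, whose mixed components are

`L^a_{bk} = e_b(N_k^a) + 1/2 h^{ac}(e_k h_{bc} - h_{dc} e_b N_k^d - h_{db} e_c N_k^d)` and
`C^i_{jc} = 1/2 g^{ik} e_c g_{jk}`

in an N-adapted frame `e_k = ∂_k - N_k^a ∂_a`, `e_a = ∂_a`. As `[e_k, e_b] = e_b(N_k^a) e_a` is
vertical, these are the last two conditions for the triples `(e_k, e_b, e_c)`, `(e_c, e_j, e_k)`;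
in this form the conditions do not depend on the frame. -/
structure IsCanonicalDConnection
    (D : CovariantDerivative I E (fun x : V ↦ TangentSpace I x)) : Prop
    extends 𝒱.IsDConnection D where
  metric : ∀ Y Z, SmoothVF Y → SmoothVF Z → ∀ x (ξ : TangentSpace I x),
    mvfderiv I (𝒱.gFun Y Z) x ξ = 𝒱.g.inner x (D Y x ξ) (Z x) + 𝒱.g.inner x (Y x) (D Z x ξ)
  torsion_hh : ∀ X Y, SmoothVF X → SmoothVF Y → 𝒱.IsHorizontal X → 𝒱.IsHorizontal Y →
    ∀ x, 𝒱.hProj x (torsionField D X Y x) = 0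
  torsion_vv : ∀ X Y, SmoothVF X → SmoothVF Y → 𝒱.IsVertical X → 𝒱.IsVertical Y →
    ∀ x, 𝒱.N x (torsionField D X Y x) = 0
  mixed_hv : ∀ X Y Z, SmoothVF X → SmoothVF Y → SmoothVF Z →
    𝒱.IsHorizontal X → 𝒱.IsVertical Y → 𝒱.IsVertical Z → ∀ x,
    2 * 𝒱.g.inner x (D Y x (X x)) (Z x) = mvfderiv I (𝒱.gFun Y Z) x (X x)
      + 𝒱.g.inner x (VectorField.mlieBracket I X Y x) (Z x)
      - 𝒱.g.inner x (VectorField.mlieBracket I X Z x) (Y x)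
  mixed_vh : ∀ X Y Z, SmoothVF X → SmoothVF Y → SmoothVF Z →
    𝒱.IsVertical X → 𝒱.IsHorizontal Y → 𝒱.IsHorizontal Z → ∀ x,
    2 * 𝒱.g.inner x (D Y x (X x)) (Z x) = mvfderiv I (𝒱.gFun Y Z) x (X x)
      + 𝒱.g.inner x (VectorField.mlieBracket I X Y x) (Z x)
      - 𝒱.g.inner x (VectorField.mlieBracket I X Z x) (Y x)

/-- The bilinear form `g_x` on `T_xV`. -/
def gForm (x : V) : LinearMap.BilinForm ℝ (TangentSpace I x) :=
  LinearMap.mk₂ ℝ (fun ξ η ↦ 𝒱.g.inner x ξ η) (by simp) (by simp) (by simp) (by simp)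

/-- The quadratic form `ξ ↦ g_x(ξ, ξ)` on `T_xV`. -/
def quad (x : V) : QuadraticForm ℝ (TangentSpace I x) := (𝒱.gForm x).toQuadraticMap

theorem gForm_nondegenerate (x : V) : (𝒱.gForm x).Nondegenerate := by
  constructor
  · intro ξ h
    by_contra hne
    exact absurd (h ξ) (𝒱.g.pos x ξ hne).ne'
  · intro ξ h
    by_contra hne
    exact absurd (h ξ) (𝒱.g.pos x ξ hne).ne'

/-- The fibre at `x` of the (complexified) Clifford bundle `Cl(V)`, with `ξ² = g(ξ, ξ)`. -/
abbrev Cl (x : V) : Type _ := ℂ ⊗[ℝ] CliffordAlgebra (𝒱.quad x)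

/-- The inclusion `T_xV → Cl_x(V)`. -/
def clVec (x : V) : TangentSpace I x →ₗ[ℝ] 𝒱.Cl x :=
  (Algebra.TensorProduct.includeRight (R := ℝ) (A := ℂ)
    (B := CliffordAlgebra (𝒱.quad x))).toLinearMap ∘ₗ CliffordAlgebra.ι (𝒱.quad x)

/-- The algebra of sections of `Cl(V)` generated by the smooth functions and the smooth
vector fields. -/
def clGen : Subalgebra ℂ (∀ x : V, 𝒱.Cl x) :=
  Algebra.adjoin ℂ
    ({a | ∃ f : V → ℝ, ContMDiff I 𝓘(ℝ, ℝ) ∞ f ∧ a = fun x ↦ algebraMap ℝ (𝒱.Cl x) (f x)} ∪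
     {a | ∃ X : ∀ x : V, TangentSpace I x, SmoothVF X ∧ a = fun x ↦ 𝒱.clVec x (X x)})

/-- `a` is a smooth section of `Cl(V)`: near every point it is a polynomial in smooth vector
fields with smooth complex coefficients. -/
def SmoothCl (a : ∀ x : V, 𝒱.Cl x) : Prop :=
  ∀ x₀, ∃ b ∈ 𝒱.clGen, ∀ᶠ x in 𝓝 x₀, a x = b x

/-- `𝒟` is the extension of the connection `D` on `TV` to a connection on `Cl(V)` acting by
derivations. Here `𝒟 a x ξ` is `(𝒟_ξ a)(x)`; only its values on smooth sections `a` matter. -/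
structure IsCliffordExtension (D : CovariantDerivative I E (fun x : V ↦ TangentSpace I x))
    (𝒟 : (∀ x : V, 𝒱.Cl x) → ∀ x : V, TangentSpace I x →ₗ[ℝ] 𝒱.Cl x) : Prop where
  smooth : ∀ a X, 𝒱.SmoothCl a → SmoothVF X → 𝒱.SmoothCl (fun x ↦ 𝒟 a x (X x))
  add : ∀ a b, 𝒱.SmoothCl a → 𝒱.SmoothCl b → 𝒟 (a + b) = 𝒟 a + 𝒟 b
  smul : ∀ (z : ℂ) a, 𝒱.SmoothCl a → ∀ x ξ, 𝒟 (z • a) x ξ = z • 𝒟 a x ξ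
  mul : ∀ a b, 𝒱.SmoothCl a → 𝒱.SmoothCl b → ∀ x ξ,
    𝒟 (a * b) x ξ = 𝒟 a x ξ * b x + a x * 𝒟 b x ξ
  func : ∀ f : V → ℝ, ContMDiff I 𝓘(ℝ, ℝ) ∞ f → ∀ x ξ,
    𝒟 (fun y ↦ algebraMap ℝ (𝒱.Cl y) (f y)) x ξ = algebraMap ℝ (𝒱.Cl x) (mvfderiv I f x ξ)
  vec : ∀ X, SmoothVF X → ∀ x ξ, 𝒟 (fun y ↦ 𝒱.clVec y (X y)) x ξ = 𝒱.clVec x (D X x ξ)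

end NAnholonomicManifold

end NManifold

section Spin

variable {E : Type*} [NormedAddCommGroup E] [NormedSpace ℝ E] [FiniteDimensional ℝ E]
  {H : Type*} [TopologicalSpace H] {I : ModelWithCorners ℝ E H}
  {V : Type*} [TopologicalSpace V] [ChartedSpace H V] [IsManifold I ∞ V]
  {E' : Type*} [NormedAddCommGroup E'] [NormedSpace ℝ E']
  {H' : Type*} [TopologicalSpace H'] {I' : ModelWithCorners ℝ E' H'}
  {M : Type*} [TopologicalSpace M] [ChartedSpace H' M]
  (𝒱 : NAnholonomicManifold I V I' M)
  (F : Type*) [NormedAddCommGroup F] [NormedSpace ℝ F]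
  (Sp : V → Type*) [TopologicalSpace (TotalSpace F Sp)]
  [∀ x, AddCommGroup (Sp x)] [∀ x, Module ℂ (Sp x)] [∀ x, TopologicalSpace (Sp x)]
  [∀ x, IsTopologicalAddGroup (Sp x)] [∀ x, ContinuousSMul ℝ (Sp x)]
  [FiberBundle F Sp] [VectorBundle ℝ F Sp]

/-- The data `(Sp, J)` making `V` a spin N-anholonomic manifold `(V, Sp, J)`: on the smooth
vector bundle `Sp` with complex fibres, a smooth complex structure, an irreducible Clifford action
`γ` with `γ(ξ)γ(η) + γ(η)γ(ξ) = 2 g(ξ, η)`, a Hermitian inner product for which the `γ(ξ)` are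
self-adjoint, and an antiunitary charge conjugation `J` which commutes, up to a sign fixed by
convention and dimension, with the Clifford action of vectors. -/
structure SpinStructure where
  cplx : ∀ x, Sp x →L[ℝ] Sp x
  cplx_apply : ∀ x ψ, cplx x ψ = Complex.I • ψ
  cplx_smooth : ContMDiff I (I.prod 𝓘(ℝ, F →L[ℝ] F)) ∞
    (fun x ↦ TotalSpace.mk' (F →L[ℝ] F) (E := fun x : V ↦ Sp x →L[ℝ] Sp x) x (cplx x))
  γ : ∀ x, TangentSpace I x →L[ℝ] Sp x →L[ℝ] Sp x
  γ_smooth : ContMDiff I (I.prod 𝓘(ℝ, E →L[ℝ] F →L[ℝ] F)) ∞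
    (fun x ↦ TotalSpace.mk' (E →L[ℝ] F →L[ℝ] F)
      (E := fun x : V ↦ TangentSpace I x →L[ℝ] Sp x →L[ℝ] Sp x) x (γ x))
  γ_complex : ∀ x ξ (z : ℂ) ψ, γ x ξ (z • ψ) = z • γ x ξ ψ
  γ_anticomm : ∀ x ξ η ψ,
    γ x ξ (γ x η ψ) + γ x η (γ x ξ ψ) = (2 * 𝒱.g.inner x ξ η : ℝ) • ψ
  nontrivial : ∀ x, Nontrivial (Sp x)
  irreducible : ∀ x (W : Submodule ℂ (Sp x)), (∀ ξ, ∀ ψ ∈ W, γ x ξ ψ ∈ W) → W = ⊥ ∨ W = ⊤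
  /-- The spinor inner product, antilinear in the first and linear in the second variable. -/
  herm : ∀ x, Sp x →L[ℝ] Sp x →L[ℝ] ℂ
  herm_smooth : ContMDiff I (I.prod 𝓘(ℝ, F →L[ℝ] F →L[ℝ] ℂ)) ∞
    (fun x ↦ TotalSpace.mk' (F →L[ℝ] F →L[ℝ] ℂ)
      (E := fun x : V ↦ Sp x →L[ℝ] Sp x →L[ℝ] ℂ) x (herm x))
  herm_smul : ∀ x (z : ℂ) φ ψ, herm x φ (z • ψ) = z * herm x φ ψ
  herm_symm : ∀ x φ ψ, herm x ψ φ = conj (herm x φ ψ)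
  herm_pos : ∀ x ψ, ψ ≠ 0 → 0 < (herm x ψ ψ).re
  herm_γ : ∀ x ξ φ ψ, herm x (γ x ξ φ) ψ = herm x φ (γ x ξ ψ)
  J : ∀ x, Sp x →L[ℝ] Sp x
  J_smooth : ContMDiff I (I.prod 𝓘(ℝ, F →L[ℝ] F)) ∞
    (fun x ↦ TotalSpace.mk' (F →L[ℝ] F) (E := fun x : V ↦ Sp x →L[ℝ] Sp x) x (J x))
  J_antilinear : ∀ x (z : ℂ) ψ, J x (z • ψ) = conj z • J x ψ
  J_bijective : ∀ x, Bijective (J x)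
  J_herm : ∀ x φ ψ, herm x (J x φ) (J x ψ) = herm x ψ φ
  ε : ℝ
  ε_sign : ε = 1 ∨ ε = -1
  J_γ : ∀ x ξ ψ, J x (γ x ξ ψ) = ε • γ x ξ (J x ψ)

variable {F Sp}

/-- `ψ` is a smooth section of `Sp`, that is `ψ ∈ Γ^∞(Sp)`. -/
def SmoothSpinor (ψ : ∀ x, Sp x) : Prop :=
  ContMDiff I (I.prod 𝓘(ℝ, F)) ∞ (fun x ↦ TotalSpace.mk' F x (ψ x))

namespace SpinStructure

variable {𝒱} (𝒮 : SpinStructure 𝒱 F Sp)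

/-- Clifford multiplication by a tangent vector, as a complex linear map. -/
def γEnd (x : V) : TangentSpace I x →ₗ[ℝ] Module.End ℂ (Sp x) where
  toFun ξ :=
    { toFun := fun ψ ↦ 𝒮.γ x ξ ψ
      map_add' := by simp
      map_smul' := fun z ψ ↦ 𝒮.γ_complex x ξ z ψ }
  map_add' ξ η := by ext; simp
  map_smul' t ξ := by ext; simp

theorem γEnd_sq (x : V) (ξ : TangentSpace I x) :
    𝒮.γEnd x ξ * 𝒮.γEnd x ξ = algebraMap ℝ (Module.End ℂ (Sp x)) (𝒱.quad x ξ) := by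
  ext ψ
  have h := 𝒮.γ_anticomm x ξ ξ ψ
  rw [← two_smul ℝ, mul_smul] at h
  exact smul_right_injective (Sp x) (two_ne_zero (α := ℝ)) h

/-- The Clifford action `c : Cl_x(V) → End(Sp_x)`. -/
def c (x : V) : 𝒱.Cl x →ₐ[ℂ] Module.End ℂ (Sp x) :=
  Algebra.TensorProduct.lift (Algebra.ofId ℂ (Module.End ℂ (Sp x)))
    (CliffordAlgebra.lift (𝒱.quad x) ⟨𝒮.γEnd x, 𝒮.γEnd_sq x⟩)
    (fun z _ ↦ Algebra.commutes z _)

/-- `∇` is an (almost) Hermitian spin d-connection for the connection `𝒟` on `Cl(V)`: a smooth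
complex linear connection on `Sp` which commutes with `J`, is compatible with the spinor inner
product and satisfies the Leibniz rule for the Clifford action. -/
structure IsSpinDConnection
    (𝒟 : (∀ x : V, 𝒱.Cl x) → ∀ x : V, TangentSpace I x →ₗ[ℝ] 𝒱.Cl x)
    (nab : CovariantDerivative I F Sp) : Prop where
  smooth : CovariantDerivative.ContMDiffCovariantDerivative nab ∞
  complex_linear : ∀ (z : ℂ) (ψ : ∀ x, Sp x), SmoothSpinor (I := I) (F := F) ψ →
    ∀ x ξ, nab (fun y ↦ z • ψ y) x ξ = z • nab ψ x ξ
  commutes_J : ∀ ψ : ∀ x, Sp x, SmoothSpinor (I := I) (F := F) ψ →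
    ∀ x ξ, nab (fun y ↦ 𝒮.J y (ψ y)) x ξ = 𝒮.J x (nab ψ x ξ)
  hermitian : ∀ ψ φ : ∀ x, Sp x, SmoothSpinor (I := I) (F := F) ψ →
    SmoothSpinor (I := I) (F := F) φ → ∀ x ξ,
    𝒮.herm x (nab ψ x ξ) (φ x) + 𝒮.herm x (ψ x) (nab φ x ξ) =
      mvfderiv I (fun y ↦ 𝒮.herm y (ψ y) (φ y)) x ξ
  leibniz : ∀ (a : ∀ x, 𝒱.Cl x) (ψ : ∀ x, Sp x), 𝒱.SmoothCl a →
    SmoothSpinor (I := I) (F := F) ψ → ∀ x ξ,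
    nab (fun y ↦ 𝒮.c y (a y) (ψ y)) x ξ = 𝒮.c x (𝒟 a x ξ) (ψ x) + 𝒮.c x (a x) (nab ψ x ξ)

/-- Near `x₀`, `e` is an N-adapted orthonormal frame of `TV` and `s` a smooth frame of `Sp` in
which the Clifford action of the `e α`, the charge conjugation and the inner product have
constant coefficients. -/
structure IsAdaptedFrameAt (x₀ : V) {ι κ : Type} [Fintype ι] [Fintype κ]
    (e : ι → ∀ x : V, TangentSpace I x) (s : κ → ∀ x : V, Sp x) : Prop where
  e_smooth : ∀ α, ContMDiffAt I (I.prod 𝓘(ℝ, E)) ∞ (fun x ↦ TotalSpace.mk' E x (e α x)) x₀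
  e_adapted : ∀ α, (∀ᶠ x in 𝓝 x₀, 𝒱.N x (e α x) = 0) ∨ (∀ᶠ x in 𝓝 x₀, 𝒱.N x (e α x) = e α x)
  e_unit : ∀ᶠ x in 𝓝 x₀, ∀ α, 𝒱.g.inner x (e α x) (e α x) = 1
  e_orthogonal : ∀ᶠ x in 𝓝 x₀, ∀ α β, α ≠ β → 𝒱.g.inner x (e α x) (e β x) = 0
  e_span : ∀ᶠ x in 𝓝 x₀, Submodule.span ℝ (range fun α ↦ e α x) = ⊤
  s_smooth : ∀ A, ContMDiffAt I (I.prod 𝓘(ℝ, F)) ∞ (fun x ↦ TotalSpace.mk' F x (s A x)) x₀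
  s_indep : ∀ᶠ x in 𝓝 x₀, LinearIndependent ℂ (fun A ↦ s A x)
  s_span : ∀ᶠ x in 𝓝 x₀, Submodule.span ℂ (range fun A ↦ s A x) = ⊤
  γ_const : ∃ G : ι → Matrix κ κ ℂ, ∀ᶠ x in 𝓝 x₀, ∀ α A,
    𝒮.γ x (e α x) (s A x) = ∑ B, G α B A • s B x
  J_const : ∃ C : Matrix κ κ ℂ, ∀ᶠ x in 𝓝 x₀, ∀ A, 𝒮.J x (s A x) = ∑ B, C B A • s B x
  herm_const : ∃ P : Matrix κ κ ℂ, ∀ᶠ x in 𝓝 x₀, ∀ A B, 𝒮.herm x (s A x) (s B x) = P A B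

/-- The local expression `∇ = δ - 1/4 Γ^α_{βμ} γ^β γ_α δu^μ` of a spin d-connection through the
coefficients `Γ^α_β(ξ) = g(D_ξ e_β, e_α)` of the d-connection `D` in adapted frames. -/
def HasLocalForm (D : CovariantDerivative I E (fun x : V ↦ TangentSpace I x))
    (nab : CovariantDerivative I F Sp) : Prop :=
  ∀ (x₀ : V) (ι κ : Type) (_ : Fintype ι) (_ : Fintype κ)
    (e : ι → ∀ x : V, TangentSpace I x) (s : κ → ∀ x : V, Sp x),
    𝒮.IsAdaptedFrameAt x₀ e s → ∀ (A : κ) (ξ : TangentSpace I x₀),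
    nab (s A) x₀ ξ = -((1 / 4 : ℝ) • ∑ α, ∑ β,
      𝒱.g.inner x₀ (D (e β) x₀ ξ) (e α x₀) • 𝒮.γ x₀ (e β x₀) (𝒮.γ x₀ (e α x₀) (s A x₀)))

/-- The contraction `ĉ : Sp_x ⊗ T*_xV → Sp_x`, `ψ ⊗ α ↦ c(α)ψ`, where a covector acts through
the vector which `g` assigns to it. For a basis `b`, the `g`-dual basis consists of the vectors
assigned to the covectors of the dual basis. -/
def contract (x : V) (T : TangentSpace I x →L[ℝ] Sp x) : Sp x :=
  haveI : FiniteDimensional ℝ (TangentSpace I x) := inferInstanceAs (FiniteDimensional ℝ E)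
  let b := Module.finBasis ℝ (TangentSpace I x)
  ∑ k, 𝒮.γ x ((𝒱.gForm x).dualBasis (𝒱.gForm_nondegenerate x) b k) (T (b k))

/-- The Dirac d-operator `-i (ĉ ∘ ∇)`. -/
def dirac (nab : CovariantDerivative I F Sp) (ψ : ∀ x, Sp x) (x : V) : Sp x :=
  -(Complex.I • 𝒮.contract x (nab ψ x))

/-- The horizontal part of the Dirac d-operator: the contraction of the derivatives along `hV`. -/
def hDirac (nab : CovariantDerivative I F Sp) (ψ : ∀ x, Sp x) (x : V) : Sp x :=
  -(Complex.I • 𝒮.contract x ((nab ψ x).comp (𝒱.hProj x)))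

/-- The vertical part of the Dirac d-operator: the contraction of the derivatives along `vV`. -/
def vDirac (nab : CovariantDerivative I F Sp) (ψ : ∀ x, Sp x) (x : V) : Sp x :=
  -(Complex.I • 𝒮.contract x ((nab ψ x).comp (𝒱.N x)))

/-- The canonical spin d-connection and the canonical Dirac d-operator of `(V, Sp, J)` exist and
are unique on smooth sections, with all the properties listed in the definitions above. -/
def HasCanonicalDirac : Prop :=
  ∃ D : CovariantDerivative I E (fun x : V ↦ TangentSpace I x),
    𝒱.IsCanonicalDConnection D ∧
    (∀ D', 𝒱.IsCanonicalDConnection D' → ∀ X, SmoothVF X → D' X = D X) ∧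
    ∃ 𝒟 : (∀ x : V, 𝒱.Cl x) → ∀ x : V, TangentSpace I x →ₗ[ℝ] 𝒱.Cl x,
      𝒱.IsCliffordExtension D 𝒟 ∧
      (∀ 𝒟', 𝒱.IsCliffordExtension D 𝒟' → ∀ a, 𝒱.SmoothCl a → 𝒟' a = 𝒟 a) ∧
      ∃ nab : CovariantDerivative I F Sp,
        𝒮.IsSpinDConnection 𝒟 nab ∧
        (∀ nab', 𝒮.IsSpinDConnection 𝒟 nab' →
          ∀ ψ : ∀ x, Sp x, SmoothSpinor (I := I) (F := F) ψ → nab' ψ = nab ψ) ∧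
        𝒮.HasLocalForm D nab ∧
        ∀ ψ : ∀ x, Sp x, SmoothSpinor (I := I) (F := F) ψ →
          SmoothSpinor (I := I) (F := F) (𝒮.dirac nab ψ) ∧
          SmoothSpinor (I := I) (F := F) (𝒮.hDirac nab ψ) ∧
          SmoothSpinor (I := I) (F := F) (𝒮.vDirac nab ψ) ∧
          𝒮.dirac nab ψ = 𝒮.hDirac nab ψ + 𝒮.vDirac nab ψ

end SpinStructure

end Spin

section Lagrange

variable {E' : Type*} [NormedAddCommGroup E'] [NormedSpace ℝ E'] [FiniteDimensional ℝ E']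
  {H' : Type*} [TopologicalSpace H'] (I' : ModelWithCorners ℝ E' H')
  (M : Type*) [TopologicalSpace M] [ChartedSpace H' M] [IsManifold I' ∞ M]

/-- The tangent bundle with the null section removed. -/
def slitTangent : TopologicalSpace.Opens (TangentBundle I' M) :=
  ⟨{p | p.2 ≠ 0}, by
    rw [isOpen_iff_mem_nhds]
    intro p hp
    let e := trivializationAt E' (TangentSpace I' : M → Type _) p.proj
    have hpe : p ∈ e.source := by
      rw [e.mem_source]
      exact FiberBundle.mem_baseSet_trivializationAt' p.proj
    have key : ∀ q ∈ e.source, (e q).2 = 0 ↔ q.2 = 0 := by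
      intro q hq
      rw [e.mem_source] at hq
      have h := (e.continuousLinearEquivAt ℝ q.proj hq).map_eq_zero_iff (x := q.2)
      exact h
    have ho : IsOpen (e.source ∩ e ⁻¹' (univ ×ˢ {0}ᶜ)) :=
      e.continuousOn.isOpen_inter_preimage e.open_source
        (isOpen_univ.prod isOpen_compl_singleton)
    refine mem_of_superset (ho.mem_nhds ⟨hpe, mem_univ _, ?_⟩) ?_
    · exact fun h ↦ hp ((key p hpe).1 h)
    · rintro q ⟨hq, -, hq'⟩ h
      exact hq' ((key q hq).2 h)⟩

/-- `1/2 ∂²ℓ/∂y^i∂y^j` at `z = (x, y)`, as a bilinear form. -/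
def lagrangeHessian (l : E' × E' → ℝ) (z : E' × E') (u w : E') : ℝ :=
  1 / 2 * fderiv ℝ (fun y ↦ fderiv ℝ (fun y' ↦ l (z.1, y')) y w) z.2 u

/-- `G` is the semispray coefficient of `ℓ` on `s`:
`g_{ij} 2G^j = 1/2 (∂²ℓ/∂y^i∂x^k y^k - ∂ℓ/∂x^i)`. -/
def IsSemispray (l : E' × E' → ℝ) (G : E' × E' → E') (s : Set (E' × E')) : Prop :=
  ∀ z ∈ s, ∀ w : E', lagrangeHessian l z ((2 : ℝ) • G z) w =
    1 / 2 * (fderiv ℝ (fun x ↦ fderiv ℝ (fun y ↦ l (x, y)) z.2 w) z.1 z.2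
      - fderiv ℝ (fun x ↦ l (x, z.2)) z.1 w)

variable {I' M}

/-- The N-anholonomic manifold `𝒱` on `TM ∖ {0}` is the Lagrange space `(M, L)`: its projection
is that of the tangent bundle, its N-connection is the canonical one `N_j^i = ∂G^i/∂y^j` of the
regular Lagrangian `L`, that is `N = (dy^i + N_j^i dx^j) ⊗ ∂/∂y^i`, and its metric is the Sasaki
type metric `g_{ij} e^i ⊗ e^j + g_{ij} ⁻e^i ⊗ ⁻e^j` with `e^i = dx^i`, `⁻e^i = dy^i + N_j^i dx^j`.
Formulas refer to the coordinates `(x, y)` induced by the charts of `M`. -/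
structure IsLagrangeSpace (L : TangentBundle I' M → ℝ)
    (𝒱 : NAnholonomicManifold I'.tangent (slitTangent I' M) I' M) : Prop where
  continuous : Continuous L
  smooth : ContMDiffOn I'.tangent 𝓘(ℝ, ℝ) ∞ L (slitTangent I' M)
  proj_eq : ∀ p : slitTangent I' M, 𝒱.proj p = p.1.proj
  regular : ∀ p : slitTangent I' M,
    let φ := extChartAt I'.tangent p.1
    ∀ u : E', (∀ w : E', lagrangeHessian (L ∘ φ.symm) (φ p.1) u w = 0) → u = 0
  N_eq : ∀ p : slitTangent I' M,
    let φ := extChartAt I'.tangent p.1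
    let dφ := mvfderiv I'.tangent (fun q : slitTangent I' M ↦ φ q.1) p
    ∃ G : E' × E' → E', IsSemispray (L ∘ φ.symm) G (φ.target ∩ {z | z.2 ≠ 0}) ∧
      ∀ ξ, dφ (𝒱.N p ξ) =
        (0, (dφ ξ).2 + fderiv ℝ (fun y ↦ G ((φ p.1).1, y)) (φ p.1).2 (dφ ξ).1)
  g_eq : ∀ p : slitTangent I' M,
    let φ := extChartAt I'.tangent p.1
    let dφ := mvfderiv I'.tangent (fun q : slitTangent I' M ↦ φ q.1) p
    ∀ ξ η, 𝒱.g.inner p ξ η =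
      lagrangeHessian (L ∘ φ.symm) (φ p.1) (dφ ξ).1 (dφ η).1 +
      lagrangeHessian (L ∘ φ.symm) (φ p.1) (dφ (𝒱.N p ξ)).2 (dφ (𝒱.N p η)).2

end Lagrange

end NSpin

end

noncomputable section

namespace NSpin

section Bundles

variable {E : Type*} [NormedAddCommGroup E] [NormedSpace ℝ E] [FiniteDimensional ℝ E]
  {H : Type*} [TopologicalSpace H] {I : ModelWithCorners ℝ E H}
  {V : Type*} [TopologicalSpace V] [ChartedSpace H V]
  {F : Type*} [NormedAddCommGroup F] [NormedSpace ℝ F]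
  {W : V → Type*} [TopologicalSpace (TotalSpace F W)]
  [∀ x, AddCommGroup (W x)] [∀ x, Module ℝ (W x)] [∀ x, TopologicalSpace (W x)]
  [FiberBundle F W]

variable (I F) in
/-- The section `σ` is smooth at `x`. -/
abbrev SmoothAt (σ : ∀ x, W x) (x : V) : Prop :=
  ContMDiffAt I (I.prod 𝓘(ℝ, F)) ∞ (fun y ↦ TotalSpace.mk' F y (σ y)) x

variable (I F) in
/-- The section `σ` is differentiable at `x`. -/
abbrev DiffAt (σ : ∀ x, W x) (x : V) : Prop :=
  MDifferentiableAt I (I.prod 𝓘(ℝ, F)) (fun y ↦ TotalSpace.mk' F y (σ y)) x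

theorem SmoothAt.diffAt {σ : ∀ x, W x} {x : V} (h : SmoothAt I F σ x) : DiffAt I F σ x :=
  h.mdifferentiableAt (by simp)

variable (I) in
theorem exists_smooth_bump [T2Space V] [IsManifold I ∞ V] {x : V} {U : Set V} (hU : U ∈ 𝓝 x) :
    ∃ f : V → ℝ, ContMDiff I 𝓘(ℝ, ℝ) ∞ f ∧ f =ᶠ[𝓝 x] 1 ∧ tsupport f ⊆ U := by
  obtain ⟨f, -, hf⟩ := (SmoothBumpFunction.nhds_basis_tsupport (I := I) x).mem_iff.1 hU
  exact ⟨f, f.contMDiff, f.eventuallyEq_one, hf⟩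

/-- A section which is smooth near `x` agrees near `x` with a globally smooth section. -/
theorem exists_smooth_section_eventuallyEq [T2Space V] [IsManifold I ∞ V] [VectorBundle ℝ F W]
    [ContMDiffVectorBundle ∞ F W I] {σ : ∀ x, W x} {x : V} {U : Set V} (hU : IsOpen U)
    (hx : x ∈ U) (hσ : ∀ y ∈ U, SmoothAt I F σ y) :
    ∃ τ : ∀ x, W x, (∀ y, SmoothAt I F τ y) ∧ ∀ᶠ y in 𝓝 x, τ y = σ y := by
  obtain ⟨f, hf, hf1, hfU⟩ := exists_smooth_bump I (hU.mem_nhds hx)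
  refine ⟨f • σ, ?_, ?_⟩
  · exact ContMDiffOn.smul_section_of_tsupport hf.contMDiffOn hU hfU
      fun y hy ↦ (hσ y hy).contMDiffWithinAt
  · filter_upwards [hf1] with y hy
    simp [hy]

/-- A section which is smooth near `x` agrees near `x` with a globally smooth section. -/
theorem exists_smooth_fun_eventuallyEq [T2Space V] [IsManifold I ∞ V] {G : Type*}
    [NormedAddCommGroup G] [NormedSpace ℝ G] {h : V → G} {x : V} {U : Set V} (hU : IsOpen U)
    (hx : x ∈ U) (hh : ∀ y ∈ U, ContMDiffAt I 𝓘(ℝ, G) ∞ h y) :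
    ∃ k : V → G, ContMDiff I 𝓘(ℝ, G) ∞ k ∧ k =ᶠ[𝓝 x] h := by
  obtain ⟨f, hf, hf1, hfU⟩ := exists_smooth_bump I (hU.mem_nhds hx)
  refine ⟨fun y ↦ f y • h y, ?_, ?_⟩
  · refine contMDiff_of_tsupport fun y hy ↦ ?_
    exact hf.contMDiffAt.smul (hh y (hfU (tsupport_smul_subset_left f h hy)))
  · filter_upwards [hf1] with y hy
    simp [hy]

theorem exists_smooth_section_apply_eq [T2Space V] [IsManifold I ∞ V] [VectorBundle ℝ F W]
    [ContMDiffVectorBundle ∞ F W I] {x : V} (v : W x) :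
    ∃ τ : ∀ x, W x, (∀ y, SmoothAt I F τ y) ∧ τ x = v := by
  obtain ⟨s, hs, h⟩ := FiberBundle.exists_contMDiffOn_extend (k := ∞) I F v
  obtain ⟨U, hUs, hU, hxU⟩ := mem_nhds_iff.1 hs
  obtain ⟨τ, hτ, hτx⟩ := exists_smooth_section_eventuallyEq hU hxU
    fun y hy ↦ (h y (hUs hy)).contMDiffAt (mem_of_superset (hU.mem_nhds hy) hUs)
  exact ⟨τ, hτ, by simp [hτx.self_of_nhds]⟩

theorem contMDiffAt_clm_of_apply {G : Type*} [NormedAddCommGroup G] [NormedSpace ℝ G]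
    [FiniteDimensional ℝ F] {A : V → F →L[ℝ] G} {x : V}
    (h : ∀ v, ContMDiffAt I 𝓘(ℝ, G) ∞ (fun y ↦ A y v) x) :
    ContMDiffAt I 𝓘(ℝ, F →L[ℝ] G) ∞ A x := by
  let b := Module.finBasis ℝ F
  let c (i) : F →L[ℝ] ℝ := LinearMap.toContinuousLinearMap (b.coord i)
  have hA : A = fun y ↦ ∑ i, (c i).smulRight (A y (b i)) := by
    ext y v
    conv_lhs => rw [← b.sum_repr v]
    simp [c, -Module.Basis.sum_repr]
  rw [hA]
  refine contMDiffAt_finsetSum fun i _ ↦ ?_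
  exact ((ContinuousLinearMap.smulRightL ℝ F G (c i)).contMDiff.contMDiffAt (n := ∞)).comp x
    (h (b i))

/-- A section of a bundle of homomorphisms is smooth if it maps smooth sections to smooth
sections. -/
theorem contMDiffAt_hom_of_apply [FiniteDimensional ℝ F] [VectorBundle ℝ F W]
    [ContMDiffVectorBundle ∞ F W I] {G : Type*} [NormedAddCommGroup G] [NormedSpace ℝ G]
    {Z : V → Type*} [TopologicalSpace (TotalSpace G Z)]
    [∀ x, AddCommGroup (Z x)] [∀ x, Module ℝ (Z x)] [∀ x, TopologicalSpace (Z x)]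
    [∀ x, IsTopologicalAddGroup (Z x)] [∀ x, ContinuousSMul ℝ (Z x)]
    [FiberBundle G Z] [VectorBundle ℝ G Z] [ContMDiffVectorBundle ∞ G Z I]
    {A : ∀ x, W x →L[ℝ] Z x} {x : V}
    (h : ∀ σ, SmoothAt I F σ x → SmoothAt I G (fun y ↦ A y (σ y)) x) :
    ContMDiffAt I (I.prod 𝓘(ℝ, F →L[ℝ] G)) ∞ (fun y ↦ TotalSpace.mk' (F →L[ℝ] G)
      (E := fun x ↦ W x →L[ℝ] Z x) y (A y)) x := by
  rw [contMDiffAt_hom_bundle]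
  refine ⟨contMDiffAt_id, contMDiffAt_clm_of_apply fun v ↦ ?_⟩
  let t := trivializationAt F W x
  let u := trivializationAt G Z x
  have ht : x ∈ t.baseSet := FiberBundle.mem_baseSet_trivializationAt' x
  have hu : x ∈ u.baseSet := FiberBundle.mem_baseSet_trivializationAt' x
  have h1 := h _ (FiberBundle.contMDiffAt_extend I F (t.symm x v))
  rw [SmoothAt, contMDiffAt_section] at h1
  refine h1.congr_of_eventuallyEq ?_
  filter_upwards [t.open_baseSet.mem_nhds ht, u.open_baseSet.mem_nhds hu] with y hy hy'
  rw [ContinuousLinearMap.inCoordinates_eq hy hy']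
  have : t.symm y v = FiberBundle.extend F (t.symm x v) y := by
    simp [FiberBundle.extend, t, ht]
  simp [u, t, this]

theorem SmoothAt.mvfderiv_apply [IsManifold I ∞ V] {G : Type*} [NormedAddCommGroup G]
    [NormedSpace ℝ G] {f : V → G} {x : V} (hf : ContMDiffAt I 𝓘(ℝ, G) ∞ f x)
    {X : ∀ x : V, TangentSpace I x} (hX : SmoothAt I E X x) :
    ContMDiffAt I 𝓘(ℝ, G) ∞ (fun y ↦ mvfderiv I f y (X y)) x := by
  have h1 := hf.mfderiv_const (m := ∞) (by simp)
  have h2 := ContMDiffAt.clm_apply_of_inCoordinates (b₁ := fun y : V ↦ y) (b₂ := f) (v := X)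
    h1 hX hf
  rw [contMDiffAt_totalSpace] at h2
  simpa [mvfderiv] using! h2.2

/-- A symmetric positive definite form on the fibres of `W` which depends smoothly on the
base point. -/
structure IsSmoothMetric (I : ModelWithCorners ℝ E H) (F : Type*) [NormedAddCommGroup F]
    [NormedSpace ℝ F] {W : V → Type*} [TopologicalSpace (TotalSpace F W)]
    [∀ x, AddCommGroup (W x)] [∀ x, Module ℝ (W x)] [∀ x, TopologicalSpace (W x)]
    [FiberBundle F W] (g : ∀ x, LinearMap.BilinForm ℝ (W x)) : Prop where
  smooth : ∀ {x σ τ}, SmoothAt I F σ x → SmoothAt I F τ x →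
    ContMDiffAt I 𝓘(ℝ, ℝ) ∞ (fun y ↦ g y (σ y) (τ y)) x
  diff : ∀ {x σ τ}, DiffAt I F σ x → DiffAt I F τ x →
    MDifferentiableAt I 𝓘(ℝ, ℝ) (fun y ↦ g y (σ y) (τ y)) x
  symm : ∀ x v w, g x v w = g x w v
  pos : ∀ x v, v ≠ 0 → 0 < g x v v

variable (I F) in
/-- `e` is a smooth orthonormal frame of `W` on the open set `U`. -/
structure IsOrthonormalFrameOn (g : ∀ x, LinearMap.BilinForm ℝ (W x)) {ι : Type*} [Fintype ι]
    [DecidableEq ι] (e : ι → ∀ x, W x) (U : Set V) : Prop where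
  isOpen : IsOpen U
  smooth : ∀ x ∈ U, ∀ i, SmoothAt I F (e i) x
  orthonormal : ∀ x ∈ U, ∀ i j, g x (e i x) (e j x) = if i = j then 1 else 0
  sum_eq : ∀ x ∈ U, ∀ v, ∑ i, g x (e i x) v • e i x = v

theorem IsOrthonormalFrameOn.mono {g : ∀ x, LinearMap.BilinForm ℝ (W x)} {ι : Type*} [Fintype ι]
    [DecidableEq ι] {e : ι → ∀ x, W x} {U U' : Set V} (h : IsOrthonormalFrameOn I F g e U)
    (hU' : IsOpen U') (hU : U' ⊆ U) : IsOrthonormalFrameOn I F g e U' :=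
  ⟨hU', fun x hx ↦ h.smooth x (hU hx), fun x hx ↦ h.orthonormal x (hU hx),
    fun x hx ↦ h.sum_eq x (hU hx)⟩

theorem sum_smul_eq_of_orthonormal {L : Type*} [AddCommGroup L] [Module ℝ L]
    (g : LinearMap.BilinForm ℝ L) {ι : Type*} [Fintype ι] [DecidableEq ι] {e : ι → L}
    (he : ∀ i j, g (e i) (e j) = if i = j then 1 else 0)
    (hspan : Submodule.span ℝ (range e) = ⊤) (v : L) : ∑ i, g (e i) v • e i = v := by
  have hv : v ∈ Submodule.span ℝ (range e) := by simp [hspan]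
  induction hv using Submodule.span_induction with
  | mem _ h => obtain ⟨j, rfl⟩ := h; simp [he]
  | zero => simp
  | add v w _ _ hv hw => simp [add_smul, Finset.sum_add_distrib, hv, hw]
  | smul c v _ hv => simp [mul_smul, ← Finset.smul_sum, hv]

theorem linearIndependent_of_orthonormal {L : Type*} [AddCommGroup L] [Module ℝ L]
    (g : LinearMap.BilinForm ℝ L) {ι : Type*} [Fintype ι] [DecidableEq ι] {e : ι → L}
    (he : ∀ i j, g (e i) (e j) = if i = j then 1 else 0) : LinearIndependent ℝ e := by
  rw [Fintype.linearIndependent_iff]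
  intro c hc j
  simpa [he] using congrArg (g (e j)) hc

theorem IsSmoothMetric.exists_orthonormalFrame [FiniteDimensional ℝ F] [VectorBundle ℝ F W]
    [ContMDiffVectorBundle ∞ F W I] {g : ∀ x, LinearMap.BilinForm ℝ (W x)}
    (hg : IsSmoothMetric I F g) (x : V) :
    ∃ (U : Set V) (e : Fin (Module.finrank ℝ F) → ∀ x, W x), x ∈ U ∧
      IsOrthonormalFrameOn I F g e U := by
  let t := trivializationAt F W x
  let b := Module.finBasis ℝ F
  let v := t.localFrame b
  have hfr := t.isLocalFrameOn_localFrame_baseSet I ∞ b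
  have hv : ∀ y ∈ t.baseSet, ∀ i, SmoothAt I F (v i) y := fun y hy i ↦
    hfr.contMDiffAt t.open_baseSet hy i
  have main : ∀ k ≤ Module.finrank ℝ F, ∃ e : ℕ → ∀ x, W x, ∀ y ∈ t.baseSet,
      (∀ i < k, SmoothAt I F (e i) y) ∧
      (∀ i < k, ∀ j < k, g y (e i y) (e j y) = if i = j then 1 else 0) ∧
      (∀ i < k, e i y ∈ Submodule.span ℝ ((fun j ↦ v j y) '' {j | j.1 < k})) := by
    intro k
    induction k with
    | zero => intro _; exact ⟨fun _ _ ↦ 0, by simp⟩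
    | succ k ih =>
      intro hk
      obtain ⟨e, he⟩ := ih (by omega)
      let vk := v ⟨k, hk⟩
      let w : ∀ y, W y := fun y ↦ vk y - ∑ i ∈ Finset.range k, g y (e i y) (vk y) • e i y
      let r : V → ℝ := fun y ↦ (√(g y (w y) (w y)))⁻¹
      refine ⟨Function.update e k (fun y ↦ r y • w y), fun y hy ↦ ?_⟩
      obtain ⟨h1, h2, h3⟩ := he y hy
      have hmem : ∑ i ∈ Finset.range k, g y (e i y) (vk y) • e i y ∈
          Submodule.span ℝ ((fun j ↦ v j y) '' {j | j.1 < k}) :=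
        Submodule.sum_mem _ fun i hi ↦ Submodule.smul_mem _ _ (h3 i (Finset.mem_range.1 hi))
      have hw0 : w y ≠ 0 := by
        intro h0
        have := (hfr.linearIndependent hy).notMem_span_image (s := {j | j.1 < k})
          (x := ⟨k, hk⟩) (by simp)
        rw [← sub_eq_zero.1 h0] at hmem
        exact this hmem
      have hpos := hg.pos y _ hw0
      have hwe : ∀ i < k, g y (e i y) (w y) = 0 := by
        intro i hi
        have : ∀ j ∈ Finset.range k, g y (e j y) (vk y) * g y (e i y) (e j y) =
            if i = j then g y (e j y) (vk y) else 0 := by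
          intro j hj
          rw [h2 i hi j (Finset.mem_range.1 hj)]
          simp
        simp only [w, map_sub, map_sum, map_smul, smul_eq_mul]
        rw [Finset.sum_congr rfl this]
        simp [hi]
      have hsw : SmoothAt I F w y := by
        refine (hv y hy ⟨k, hk⟩).sub_section (ContMDiffAt.sum_section fun i hi ↦ ?_)
        have hi' := h1 i (Finset.mem_range.1 hi)
        exact (hg.smooth hi' (hv y hy ⟨k, hk⟩)).smul_section hi'
      have hr : ContMDiffAt I 𝓘(ℝ, ℝ) ∞ r y := by
        have h4 : ContDiffAt ℝ ∞ (fun s : ℝ ↦ (√s)⁻¹) (g y (w y) (w y)) :=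
          (contDiffAt_id.sqrt hpos.ne').inv (Real.sqrt_pos.2 hpos).ne'
        exact ContMDiffAt.comp (g := fun s : ℝ ↦ (√s)⁻¹) y h4.contMDiffAt (hg.smooth hsw hsw)
      have hr2 : r y * r y * g y (w y) (w y) = 1 := by
        simp only [r]
        rw [← mul_inv, Real.mul_self_sqrt hpos.le, inv_mul_cancel₀ hpos.ne']
      refine ⟨fun i hi ↦ ?_, fun i hi j hj ↦ ?_, fun i hi ↦ ?_⟩
      · rcases Nat.lt_succ_iff_lt_or_eq.1 hi with hi' | rfl
        · rw [Function.update_of_ne hi'.ne]; exact h1 i hi'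
        · rw [Function.update_self]; exact hr.smul_section hsw
      · rcases Nat.lt_succ_iff_lt_or_eq.1 hi with hi' | rfl <;>
        rcases Nat.lt_succ_iff_lt_or_eq.1 hj with hj' | rfl
        · rw [Function.update_of_ne hi'.ne, Function.update_of_ne hj'.ne]; exact h2 i hi' j hj'
        · rw [Function.update_of_ne hi'.ne, Function.update_self, if_neg hi'.ne]
          simp [hwe i hi']
        · rw [Function.update_of_ne hj'.ne, Function.update_self, if_neg hj'.ne', hg.symm]
          simp [hwe j hj']
        · simp [← mul_assoc, hr2]
      · have hle : Submodule.span ℝ ((fun j ↦ v j y) '' {j | j.1 < k}) ≤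
            Submodule.span ℝ ((fun j ↦ v j y) '' {j | j.1 < k + 1}) :=
          Submodule.span_mono (image_mono fun j hj ↦ Nat.lt_succ_of_lt hj)
        rcases Nat.lt_succ_iff_lt_or_eq.1 hi with hi' | rfl
        · rw [Function.update_of_ne hi'.ne]; exact hle (h3 i hi')
        · rw [Function.update_self]
          refine Submodule.smul_mem _ _ (Submodule.sub_mem _ ?_ (hle hmem))
          exact Submodule.subset_span ⟨⟨i, hk⟩, by simp, rfl⟩
  obtain ⟨e, he⟩ := main _ le_rfl
  refine ⟨t.baseSet, fun i ↦ e i, FiberBundle.mem_baseSet_trivializationAt' x, t.open_baseSet,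
    fun y hy i ↦ (he y hy).1 i i.2, fun y hy i j ↦ ?_, fun y hy v ↦ ?_⟩
  · simpa [Fin.ext_iff] using (he y hy).2.1 i i.2 j j.2
  · have := VectorBundle.finiteDimensional ℝ F W y
    have ho : ∀ i j : Fin (Module.finrank ℝ F), g y (e i y) (e j y) = if i = j then 1 else 0 :=
      fun i j ↦ by simpa [Fin.ext_iff] using (he y hy).2.1 i i.2 j j.2
    refine sum_smul_eq_of_orthonormal (g y) ho ?_ v
    refine (linearIndependent_of_orthonormal (g y) ho).span_eq_top_of_card_eq_finrank' ?_
    simpa using (t.linearEquivAt ℝ y hy).finrank_eq.symm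

end Bundles

section Forms

variable {E : Type*} [NormedAddCommGroup E] [NormedSpace ℝ E] [FiniteDimensional ℝ E]
  {H : Type*} [TopologicalSpace H] {I : ModelWithCorners ℝ E H}
  {V : Type*} [TopologicalSpace V] [ChartedSpace H V]
  {F : Type*} [NormedAddCommGroup F] [NormedSpace ℝ F]
  {W : V → Type*} [TopologicalSpace (TotalSpace F W)]
  [∀ x, AddCommGroup (W x)] [∀ x, Module ℝ (W x)] [∀ x, TopologicalSpace (W x)]
  [FiberBundle F W] [VectorBundle ℝ F W]
  {G : Type*} [NormedAddCommGroup G] [NormedSpace ℝ G]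

theorem mvfderiv_congr {f f' : V → G} {x : V} (h : f =ᶠ[𝓝 x] f') :
    mvfderiv I f x = mvfderiv I f' x := by
  ext ξ
  simp only [mvfderiv]
  exact congrArg (fun l : E →L[ℝ] G ↦ l ξ) h.mfderiv_eq

theorem SmoothAt.bilin {B : ∀ x, W x →L[ℝ] W x →L[ℝ] G} {x : V}
    (hB : ContMDiffAt I (I.prod 𝓘(ℝ, F →L[ℝ] F →L[ℝ] G)) ∞
      (fun x ↦ TotalSpace.mk' (F →L[ℝ] F →L[ℝ] G)
        (E := fun x : V ↦ W x →L[ℝ] W x →L[ℝ] G) x (B x)) x)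
    {σ τ : ∀ x, W x} (hσ : SmoothAt I F σ x) (hτ : SmoothAt I F τ x) :
    ContMDiffAt I 𝓘(ℝ, G) ∞ (fun y ↦ B y (σ y) (τ y)) x := by
  have : ContMDiffAt I (I.prod 𝓘(ℝ, G)) ∞
      (fun y ↦ TotalSpace.mk' G (E := Bundle.Trivial V G) y (B y (σ y) (τ y))) x :=
    ContMDiffAt.clm_bundle_apply₂ (F₁ := F) (F₂ := F) hB hσ hτ
  simp only [contMDiffAt_totalSpace] at this
  exact this.2

theorem DiffAt.bilin {B : ∀ x, W x →L[ℝ] W x →L[ℝ] G} {x : V}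
    (hB : ContMDiffAt I (I.prod 𝓘(ℝ, F →L[ℝ] F →L[ℝ] G)) ∞
      (fun x ↦ TotalSpace.mk' (F →L[ℝ] F →L[ℝ] G)
        (E := fun x : V ↦ W x →L[ℝ] W x →L[ℝ] G) x (B x)) x)
    {σ τ : ∀ x, W x} (hσ : DiffAt I F σ x) (hτ : DiffAt I F τ x) :
    MDifferentiableAt I 𝓘(ℝ, G) (fun y ↦ B y (σ y) (τ y)) x := by
  have : MDifferentiableAt I (I.prod 𝓘(ℝ, G))
      (fun y ↦ TotalSpace.mk' G (E := Bundle.Trivial V G) y (B y (σ y) (τ y))) x :=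
    MDifferentiableAt.clm_bundle_apply₂ (F₁ := F) (F₂ := F)
      (hB.mdifferentiableAt (by simp)) hσ hτ
  simp only [mdifferentiableAt_totalSpace] at this
  exact this.2

end Forms

namespace NAnholonomicManifold

variable {E : Type*} [NormedAddCommGroup E] [NormedSpace ℝ E] [FiniteDimensional ℝ E]
  {H : Type*} [TopologicalSpace H] {I : ModelWithCorners ℝ E H}
  {V : Type*} [TopologicalSpace V] [ChartedSpace H V] [IsManifold I ∞ V]
  {E' : Type*} [NormedAddCommGroup E'] [NormedSpace ℝ E']
  {H' : Type*} [TopologicalSpace H'] {I' : ModelWithCorners ℝ E' H'}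
  {M : Type*} [TopologicalSpace M] [ChartedSpace H' M]
  (𝒱 : NAnholonomicManifold I V I' M)

instance (x : V) : FiniteDimensional ℝ (TangentSpace I x) :=
  inferInstanceAs (FiniteDimensional ℝ E)

instance (x : V) : T2Space (TangentSpace I x) := inferInstanceAs (T2Space E)

@[simp] theorem gForm_apply (x : V) (ξ η : TangentSpace I x) :
    𝒱.gForm x ξ η = 𝒱.g.inner x ξ η := rfl

theorem g_smooth (x : V) : ContMDiffAt I (I.prod 𝓘(ℝ, E →L[ℝ] E →L[ℝ] ℝ)) ∞
    (fun x ↦ TotalSpace.mk' (E →L[ℝ] E →L[ℝ] ℝ)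
      (E := fun x : V ↦ TangentSpace I x →L[ℝ] TangentSpace I x →L[ℝ] ℝ) x (𝒱.g.inner x)) x :=
  𝒱.g.contMDiff x

theorem isSmoothMetric_gForm : IsSmoothMetric I E 𝒱.gForm where
  smooth hσ hτ := SmoothAt.bilin (𝒱.g_smooth _) hσ hτ
  diff hσ hτ := DiffAt.bilin (𝒱.g_smooth _) hσ hτ
  symm x v w := 𝒱.g.symm x v w
  pos x v hv := 𝒱.g.pos x v hv

theorem mdifferentiableAt_gFun {X Y : ∀ x : V, TangentSpace I x} {x : V} (hX : DiffAt I E X x)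
    (hY : DiffAt I E Y x) : MDifferentiableAt I 𝓘(ℝ, ℝ) (𝒱.gFun X Y) x :=
  DiffAt.bilin (𝒱.g_smooth x) hX hY

theorem contMDiffAt_gFun {X Y : ∀ x : V, TangentSpace I x} {x : V} (hX : SmoothAt I E X x)
    (hY : SmoothAt I E Y x) : ContMDiffAt I 𝓘(ℝ, ℝ) ∞ (𝒱.gFun X Y) x :=
  SmoothAt.bilin (𝒱.g_smooth x) hX hY

theorem eq_of_inner_eq {x : V} {ξ ξ' : TangentSpace I x}
    (h : ∀ η, 𝒱.g.inner x ξ η = 𝒱.g.inner x ξ' η) : ξ = ξ' := by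
  have := (𝒱.gForm_nondegenerate x).1 (ξ - ξ') fun η ↦ by simp [h]
  exact sub_eq_zero.1 this

/-- `P` is a smooth field of orthogonal projections of the tangent spaces. -/
structure IsOrthogonalProjection (P : ∀ x : V, TangentSpace I x →L[ℝ] TangentSpace I x) :
    Prop where
  smooth : ContMDiff I (I.prod 𝓘(ℝ, E →L[ℝ] E)) ∞
    (fun x ↦ TotalSpace.mk' (E →L[ℝ] E) (E := fun x : V ↦ TangentSpace I x →L[ℝ] TangentSpace I x)
      x (P x))
  idem : ∀ x ξ, P x (P x ξ) = P x ξ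
  symm : ∀ x ξ η, 𝒱.g.inner x (P x ξ) η = 𝒱.g.inner x ξ (P x η)

theorem N_idem (x : V) (ξ : TangentSpace I x) : 𝒱.N x (𝒱.N x ξ) = 𝒱.N x ξ :=
  𝒱.N_splits x _ (𝒱.N_vertical x ξ)

theorem isOrthogonalProjection_N : 𝒱.IsOrthogonalProjection 𝒱.N where
  smooth := 𝒱.N_smooth
  idem := 𝒱.N_idem
  symm x ξ η := by
    have h1 := 𝒱.orthogonal x (ξ - 𝒱.N x ξ) (𝒱.N x η) (by simp [N_idem]) (𝒱.N_idem x η)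
    have h2 := 𝒱.orthogonal x (η - 𝒱.N x η) (𝒱.N x ξ) (by simp [N_idem]) (𝒱.N_idem x ξ)
    rw [𝒱.g.symm] at h2
    simp only [map_sub, sub_apply] at h1 h2
    linarith

theorem isOrthogonalProjection_hProj : 𝒱.IsOrthogonalProjection 𝒱.hProj where
  smooth x := by
    refine contMDiffAt_hom_of_apply fun σ hσ ↦ ?_
    exact hσ.sub_section (ContMDiffAt.clm_bundle_apply (𝒱.N_smooth x) hσ)
  idem x ξ := by simp [hProj, N_idem]
  symm x ξ η := by simp [hProj, 𝒱.isOrthogonalProjection_N.symm]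

variable {𝒱}

theorem IsOrthogonalProjection.smoothAt {P : ∀ x : V, TangentSpace I x →L[ℝ] TangentSpace I x}
    (hP : 𝒱.IsOrthogonalProjection P) {X : ∀ x : V, TangentSpace I x} {x : V}
    (hX : SmoothAt I E X x) : SmoothAt I E (fun y ↦ P y (X y)) x :=
  ContMDiffAt.clm_bundle_apply (hP.smooth x) hX

theorem IsOrthogonalProjection.diffAt {P : ∀ x : V, TangentSpace I x →L[ℝ] TangentSpace I x}
    (hP : 𝒱.IsOrthogonalProjection P) {X : ∀ x : V, TangentSpace I x} {x : V}
    (hX : DiffAt I E X x) : DiffAt I E (fun y ↦ P y (X y)) x :=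
  MDifferentiableAt.clm_bundle_apply ((hP.smooth x).mdifferentiableAt (by simp)) hX

variable (𝒱)

/-- The Koszul expression for the part of the canonical d-connection which acts on sections of
the image of the orthogonal projection `P`. -/
def koszul (P : ∀ x : V, TangentSpace I x →L[ℝ] TangentSpace I x)
    (X Y Z : ∀ x : V, TangentSpace I x) (x : V) : ℝ :=
  mvfderiv I (𝒱.gFun Y Z) x (X x) + mvfderiv I (𝒱.gFun X Z) x (Y x)
    - mvfderiv I (𝒱.gFun X Y) x (Z x)
    + 𝒱.g.inner x (VectorField.mlieBracket I X Y x) (Z x)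
    - 𝒱.g.inner x (VectorField.mlieBracket I X Z x) (Y x)
    - 𝒱.g.inner x (VectorField.mlieBracket I Y Z x) (P x (X x))

section koszul

variable {X X' Y Y' Z Z' : ∀ x : V, TangentSpace I x} {f : V → ℝ} {x : V}
  {P : ∀ x : V, TangentSpace I x →L[ℝ] TangentSpace I x}

theorem gFun_add_left : 𝒱.gFun (X + X') Z = 𝒱.gFun X Z + 𝒱.gFun X' Z := by
  ext; simp [gFun]

theorem gFun_add_right : 𝒱.gFun X (Z + Z') = 𝒱.gFun X Z + 𝒱.gFun X Z' := by
  ext; simp [gFun]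

theorem gFun_smul_left : 𝒱.gFun (f • X) Z = f * 𝒱.gFun X Z := by
  ext; simp [gFun]

theorem gFun_smul_right : 𝒱.gFun X (f • Z) = f * 𝒱.gFun X Z := by
  ext; simp [gFun]

theorem gFun_comm : 𝒱.gFun X Z = 𝒱.gFun Z X := by
  ext; exact 𝒱.g.symm ..

theorem koszul_add_left (hX : DiffAt I E X x) (hX' : DiffAt I E X' x) (hY : DiffAt I E Y x)
    (hZ : DiffAt I E Z x) :
    𝒱.koszul P (X + X') Y Z x = 𝒱.koszul P X Y Z x + 𝒱.koszul P X' Y Z x := by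
  simp only [koszul, gFun_add_left, Pi.add_apply, map_add, add_apply,
    mvfderiv_add (𝒱.mdifferentiableAt_gFun hX hZ) (𝒱.mdifferentiableAt_gFun hX' hZ),
    mvfderiv_add (𝒱.mdifferentiableAt_gFun hX hY) (𝒱.mdifferentiableAt_gFun hX' hY),
    VectorField.mlieBracket_add_left hX hX']
  ring

theorem koszul_smul_left (hf : MDifferentiableAt I 𝓘(ℝ, ℝ) f x) (hX : DiffAt I E X x)
    (hY : DiffAt I E Y x) (hZ : DiffAt I E Z x) :
    𝒱.koszul P (f • X) Y Z x = f x * 𝒱.koszul P X Y Z x := by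
  simp only [koszul, gFun_smul_left, Pi.smul_apply', map_add, map_smul, map_neg,
    add_apply, smul_apply, neg_apply,
    mvfderiv_mul hf (𝒱.mdifferentiableAt_gFun hX hZ), smul_eq_mul, neg_smul,
    mvfderiv_mul hf (𝒱.mdifferentiableAt_gFun hX hY),
    VectorField.mlieBracket_smul_left hf hX, gFun]
  ring

theorem koszul_add_middle (hX : DiffAt I E X x) (hY : DiffAt I E Y x) (hY' : DiffAt I E Y' x)
    (hZ : DiffAt I E Z x) :
    𝒱.koszul P X (Y + Y') Z x = 𝒱.koszul P X Y Z x + 𝒱.koszul P X Y' Z x := by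
  simp only [koszul, gFun_add_left, gFun_add_right, Pi.add_apply, map_add,
    add_apply,
    mvfderiv_add (𝒱.mdifferentiableAt_gFun hY hZ) (𝒱.mdifferentiableAt_gFun hY' hZ),
    mvfderiv_add (𝒱.mdifferentiableAt_gFun hX hY) (𝒱.mdifferentiableAt_gFun hX hY'),
    VectorField.mlieBracket_add_left hY hY', VectorField.mlieBracket_add_right hY hY']
  ring

theorem koszul_smul_middle (hf : MDifferentiableAt I 𝓘(ℝ, ℝ) f x) (hX : DiffAt I E X x)
    (hY : DiffAt I E Y x) (hZ : DiffAt I E Z x)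
    (hPY : 𝒱.g.inner x (Y x) (P x (X x)) = 𝒱.g.inner x (Y x) (X x)) :
    𝒱.koszul P X (f • Y) Z x = f x * 𝒱.koszul P X Y Z x
      + 2 * mvfderiv I f x (X x) * 𝒱.g.inner x (Y x) (Z x) := by
  simp only [koszul, gFun_smul_left, gFun_smul_right, Pi.smul_apply', map_add, map_smul, map_neg,
    add_apply, smul_apply, neg_apply,
    mvfderiv_mul hf (𝒱.mdifferentiableAt_gFun hY hZ), smul_eq_mul, neg_smul,
    mvfderiv_mul hf (𝒱.mdifferentiableAt_gFun hX hY),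
    VectorField.mlieBracket_smul_left hf hY, VectorField.mlieBracket_smul_right hf hY, hPY]
  simp only [gFun, 𝒱.g.symm x (Y x) (X x)]
  ring

theorem koszul_add_right (hX : DiffAt I E X x) (hY : DiffAt I E Y x) (hZ : DiffAt I E Z x)
    (hZ' : DiffAt I E Z' x) :
    𝒱.koszul P X Y (Z + Z') x = 𝒱.koszul P X Y Z x + 𝒱.koszul P X Y Z' x := by
  simp only [koszul, gFun_add_right, Pi.add_apply, map_add, add_apply,
    mvfderiv_add (𝒱.mdifferentiableAt_gFun hY hZ) (𝒱.mdifferentiableAt_gFun hY hZ'),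
    mvfderiv_add (𝒱.mdifferentiableAt_gFun hX hZ) (𝒱.mdifferentiableAt_gFun hX hZ'),
    VectorField.mlieBracket_add_right hZ hZ']
  ring

theorem koszul_smul_right (hf : MDifferentiableAt I 𝓘(ℝ, ℝ) f x) (hX : DiffAt I E X x)
    (hY : DiffAt I E Y x) (hZ : DiffAt I E Z x)
    (hPZ : 𝒱.g.inner x (Z x) (P x (X x)) = 𝒱.g.inner x (Z x) (X x)) :
    𝒱.koszul P X Y (f • Z) x = f x * 𝒱.koszul P X Y Z x := by
  simp only [koszul, gFun_smul_right, Pi.smul_apply', map_add, map_smul,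
    add_apply, smul_apply,
    mvfderiv_mul hf (𝒱.mdifferentiableAt_gFun hY hZ), smul_eq_mul,
    mvfderiv_mul hf (𝒱.mdifferentiableAt_gFun hX hZ),
    VectorField.mlieBracket_smul_right hf hZ, hPZ]
  simp only [gFun, 𝒱.g.symm x (Z x) (X x), 𝒱.g.symm x (Z x) (Y x)]
  ring

end koszul

end NAnholonomicManifold

theorem SmoothAt.eventually_diffAt {E : Type*} [NormedAddCommGroup E] [NormedSpace ℝ E]
    {H : Type*} [TopologicalSpace H] {I : ModelWithCorners ℝ E H}
    {V : Type*} [TopologicalSpace V] [ChartedSpace H V] [IsManifold I ∞ V]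
    {F : Type*} [NormedAddCommGroup F] [NormedSpace ℝ F]
    {W : V → Type*} [TopologicalSpace (TotalSpace F W)]
    [∀ x, AddCommGroup (W x)] [∀ x, Module ℝ (W x)] [∀ x, TopologicalSpace (W x)]
    [FiberBundle F W] [VectorBundle ℝ F W] [ContMDiffVectorBundle ∞ F W I]
    {σ : ∀ x, W x} {x : V} (h : SmoothAt I F σ x) : ∀ᶠ y in 𝓝 x, DiffAt I F σ y :=
  ((contMDiffAt_iff_contMDiffAt_nhds (n := 1) (by simp)).1
    (ContMDiffAt.of_le h (by simp))).mono fun _ hy ↦ hy.mdifferentiableAt (by simp)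

namespace NAnholonomicManifold

variable {E : Type*} [NormedAddCommGroup E] [NormedSpace ℝ E] [FiniteDimensional ℝ E]
  {H : Type*} [TopologicalSpace H] {I : ModelWithCorners ℝ E H}
  {V : Type*} [TopologicalSpace V] [ChartedSpace H V] [IsManifold I ∞ V]
  {E' : Type*} [NormedAddCommGroup E'] [NormedSpace ℝ E']
  {H' : Type*} [TopologicalSpace H'] {I' : ModelWithCorners ℝ E' H'}
  {M : Type*} [TopologicalSpace M] [ChartedSpace H' M]
  (𝒱 : NAnholonomicManifold I V I' M)

/-- The sum of the Koszul expressions for the vertical and for the horizontal parts. -/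
def koszulSum (X Y Z : ∀ x : V, TangentSpace I x) (x : V) : ℝ :=
  𝒱.koszul 𝒱.N X (fun y ↦ 𝒱.N y (Y y)) (fun y ↦ 𝒱.N y (Z y)) x
    + 𝒱.koszul 𝒱.hProj X (fun y ↦ 𝒱.hProj y (Y y)) (fun y ↦ 𝒱.hProj y (Z y)) x

section

variable {X X' Y Y' Z Z' : ∀ x : V, TangentSpace I x} {f : V → ℝ} {x : V}
  {P : ∀ x : V, TangentSpace I x →L[ℝ] TangentSpace I x}

theorem proj_add : (fun y ↦ P y ((X + X') y)) = (fun y ↦ P y (X y)) + fun y ↦ P y (X' y) := by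
  ext; simp

theorem proj_smul : (fun y ↦ P y ((f • X) y)) = f • fun y ↦ P y (X y) := by
  ext; simp

variable {𝒱} in
theorem IsOrthogonalProjection.inner_proj (hP : 𝒱.IsOrthogonalProjection P)
    (ξ η : TangentSpace I x) : 𝒱.g.inner x (P x ξ) (P x η) = 𝒱.g.inner x (P x ξ) η := by
  rw [← hP.symm, hP.idem]

theorem tensorialAt_koszulSum_left (hY : DiffAt I E Y x) (hZ : DiffAt I E Z x) :
    TensorialAt I E (fun X ↦ 𝒱.koszulSum X Y Z x) x where
  smul hf hX := by
    have hN := 𝒱.isOrthogonalProjection_N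
    have hh := 𝒱.isOrthogonalProjection_hProj
    simp only [koszulSum, 𝒱.koszul_smul_left hf hX (hN.diffAt hY) (hN.diffAt hZ),
      𝒱.koszul_smul_left hf hX (hh.diffAt hY) (hh.diffAt hZ), smul_eq_mul]
    ring
  add hX hX' := by
    have hN := 𝒱.isOrthogonalProjection_N
    have hh := 𝒱.isOrthogonalProjection_hProj
    simp only [koszulSum, 𝒱.koszul_add_left hX hX' (hN.diffAt hY) (hN.diffAt hZ),
      𝒱.koszul_add_left hX hX' (hh.diffAt hY) (hh.diffAt hZ)]
    ring

theorem tensorialAt_koszulSum_right (hX : DiffAt I E X x) (hY : DiffAt I E Y x) :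
    TensorialAt I E (fun Z ↦ 𝒱.koszulSum X Y Z x) x where
  smul hf hZ := by
    have hN := 𝒱.isOrthogonalProjection_N
    have hh := 𝒱.isOrthogonalProjection_hProj
    simp only [koszulSum, proj_smul,
      𝒱.koszul_smul_right hf hX (hN.diffAt hY) (hN.diffAt hZ) (hN.inner_proj _ _),
      𝒱.koszul_smul_right hf hX (hh.diffAt hY) (hh.diffAt hZ) (hh.inner_proj _ _), smul_eq_mul]
    ring
  add hZ hZ' := by
    have hN := 𝒱.isOrthogonalProjection_N
    have hh := 𝒱.isOrthogonalProjection_hProj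
    simp only [koszulSum, proj_add,
      𝒱.koszul_add_right hX (hN.diffAt hY) (hN.diffAt hZ) (hN.diffAt hZ'),
      𝒱.koszul_add_right hX (hh.diffAt hY) (hh.diffAt hZ) (hh.diffAt hZ')]
    ring

theorem koszulSum_add_middle (hX : DiffAt I E X x) (hY : DiffAt I E Y x) (hY' : DiffAt I E Y' x)
    (hZ : DiffAt I E Z x) :
    𝒱.koszulSum X (Y + Y') Z x = 𝒱.koszulSum X Y Z x + 𝒱.koszulSum X Y' Z x := by
  have hN := 𝒱.isOrthogonalProjection_N
  have hh := 𝒱.isOrthogonalProjection_hProj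
  simp only [koszulSum, proj_add,
    𝒱.koszul_add_middle hX (hN.diffAt hY) (hN.diffAt hY') (hN.diffAt hZ),
    𝒱.koszul_add_middle hX (hh.diffAt hY) (hh.diffAt hY') (hh.diffAt hZ)]
  ring

theorem inner_N_add_inner_hProj (ξ η : TangentSpace I x) :
    𝒱.g.inner x (𝒱.N x ξ) (𝒱.N x η) + 𝒱.g.inner x (𝒱.hProj x ξ) (𝒱.hProj x η) =
      𝒱.g.inner x ξ η := by
  rw [𝒱.isOrthogonalProjection_N.inner_proj, 𝒱.isOrthogonalProjection_hProj.inner_proj]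
  simp [hProj]

theorem koszulSum_smul_middle (hf : MDifferentiableAt I 𝓘(ℝ, ℝ) f x) (hX : DiffAt I E X x)
    (hY : DiffAt I E Y x) (hZ : DiffAt I E Z x) :
    𝒱.koszulSum X (f • Y) Z x = f x * 𝒱.koszulSum X Y Z x
      + 2 * mvfderiv I f x (X x) * 𝒱.g.inner x (Y x) (Z x) := by
  have hN := 𝒱.isOrthogonalProjection_N
  have hh := 𝒱.isOrthogonalProjection_hProj
  simp only [koszulSum, proj_smul,
    𝒱.koszul_smul_middle hf hX (hN.diffAt hY) (hN.diffAt hZ) (hN.inner_proj _ _),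
    𝒱.koszul_smul_middle hf hX (hh.diffAt hY) (hh.diffAt hZ) (hh.inner_proj _ _)]
  rw [← 𝒱.inner_N_add_inner_hProj (Y x) (Z x)]
  ring

end

/-- The bilinear form `(ξ, ζ) ↦ 2 g(D_ξ Y, ζ)` for the canonical d-connection. -/
def canonicalForm (Y : ∀ x : V, TangentSpace I x) (x : V) (hY : DiffAt I E Y x) :
    TangentSpace I x →L[ℝ] TangentSpace I x →L[ℝ] ℝ :=
  TensorialAt.mkHom₂ (fun X Z ↦ 𝒱.koszulSum X Y Z x) x
    (fun _ hZ ↦ 𝒱.tensorialAt_koszulSum_left hY hZ)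
    (fun _ hX ↦ 𝒱.tensorialAt_koszulSum_right hX hY)

open Classical in
/-- The covariant derivative of `Y` for the canonical d-connection. -/
def canonicalFun (Y : ∀ x : V, TangentSpace I x) (x : V) :
    TangentSpace I x →L[ℝ] TangentSpace I x :=
  if hY : DiffAt I E Y x then LinearMap.toContinuousLinearMap
    (((1 / 2 : ℝ) • (LinearMap.BilinForm.toDual _ (𝒱.gForm_nondegenerate x)).symm.toLinearMap) ∘ₗ
      ContinuousLinearMap.coeLM ℝ ∘ₗ (𝒱.canonicalForm Y x hY).toLinearMap)
  else 0

variable {X Y Z : ∀ x : V, TangentSpace I x} {f : V → ℝ} {x : V}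

theorem two_inner_canonicalFun (hX : DiffAt I E X x) (hY : DiffAt I E Y x)
    (hZ : DiffAt I E Z x) :
    2 * 𝒱.g.inner x (𝒱.canonicalFun Y x (X x)) (Z x) = 𝒱.koszulSum X Y Z x := by
  have h1 := TensorialAt.mkHom₂_apply (Φ := fun X Z ↦ 𝒱.koszulSum X Y Z x)
    (fun _ hZ ↦ 𝒱.tensorialAt_koszulSum_left hY hZ)
    (fun _ hX ↦ 𝒱.tensorialAt_koszulSum_right hX hY) hX hZ
  rw [← h1]
  simp only [canonicalFun, dif_pos hY, ← gForm_apply]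
  simp
  rfl

theorem eq_of_inner_extend_eq {A B : TangentSpace I x →L[ℝ] TangentSpace I x}
    (h : ∀ X Z : ∀ x : V, TangentSpace I x, DiffAt I E X x → DiffAt I E Z x →
      𝒱.g.inner x (A (X x)) (Z x) = 𝒱.g.inner x (B (X x)) (Z x)) : A = B := by
  ext ξ
  refine 𝒱.eq_of_inner_eq fun η ↦ ?_
  simpa using h _ _ (FiberBundle.mdifferentiableAt_extend I E ξ)
    (FiberBundle.mdifferentiableAt_extend I E η)

/-- The canonical d-connection. -/
def canonicalD : CovariantDerivative I E (fun x : V ↦ TangentSpace I x) where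
  toFun := 𝒱.canonicalFun
  isCovariantDerivativeOnUniv :=
    { add := by
        intro Y Y' x hY hY' _
        refine 𝒱.eq_of_inner_extend_eq fun X Z hX hZ ↦ ?_
        have h1 := 𝒱.two_inner_canonicalFun hX (mdifferentiableAt_add_section hY hY') hZ
        have h2 := 𝒱.two_inner_canonicalFun hX hY hZ
        have h3 := 𝒱.two_inner_canonicalFun hX hY' hZ
        rw [𝒱.koszulSum_add_middle hX hY hY' hZ] at h1
        simp only [add_apply, map_add]
        linarith
      leibniz := by
        intro Y f x hY hf _
        refine 𝒱.eq_of_inner_extend_eq fun X Z hX hZ ↦ ?_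
        have h1 := 𝒱.two_inner_canonicalFun hX (hf.smul_section hY) hZ
        have h2 := 𝒱.two_inner_canonicalFun hX hY hZ
        rw [𝒱.koszulSum_smul_middle hf hX hY hZ, ← h2] at h1
        simp only [add_apply, smul_apply, map_add, map_smul, smul_eq_mul,
          ContinuousLinearMap.smulRight_apply]
        linear_combination h1 / 2 }

theorem two_inner_canonicalD (hX : DiffAt I E X x) (hY : DiffAt I E Y x)
    (hZ : DiffAt I E Z x) :
    2 * 𝒱.g.inner x (𝒱.canonicalD Y x (X x)) (Z x) = 𝒱.koszulSum X Y Z x :=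
  𝒱.two_inner_canonicalFun hX hY hZ

section smoothness

variable {P : ∀ x : V, TangentSpace I x →L[ℝ] TangentSpace I x}

theorem SmoothAt.mlieBracket (hX : SmoothAt I E X x) (hY : SmoothAt I E Y x) :
    SmoothAt I E (VectorField.mlieBracket I X Y) x :=
  have : IsManifold I (minSmoothness ℝ 2) V := by
    rw [minSmoothness_of_isRCLikeNormedField]; infer_instance
  have : IsManifold I (∞ + 1) V := inferInstanceAs (IsManifold I ∞ V)
  ContMDiffAt.mlieBracket_vectorField (m := (⊤ : ℕ∞)) (n := (⊤ : ℕ∞)) hX hY (by simp)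

theorem contMDiffAt_koszul (hP : 𝒱.IsOrthogonalProjection P) (hX : SmoothAt I E X x)
    (hY : SmoothAt I E Y x) (hZ : SmoothAt I E Z x) :
    ContMDiffAt I 𝓘(ℝ, ℝ) ∞ (𝒱.koszul P X Y Z) x := by
  have h1 := SmoothAt.mvfderiv_apply (𝒱.contMDiffAt_gFun hY hZ) hX
  have h2 := SmoothAt.mvfderiv_apply (𝒱.contMDiffAt_gFun hX hZ) hY
  have h3 := SmoothAt.mvfderiv_apply (𝒱.contMDiffAt_gFun hX hY) hZ
  have h4 := 𝒱.contMDiffAt_gFun (SmoothAt.mlieBracket hX hY) hZ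
  have h5 := 𝒱.contMDiffAt_gFun (SmoothAt.mlieBracket hX hZ) hY
  have h6 := 𝒱.contMDiffAt_gFun (SmoothAt.mlieBracket hY hZ) (hP.smoothAt hX)
  exact ((((h1.add h2).sub h3).add h4).sub h5).sub h6

theorem contMDiffAt_koszulSum (hX : SmoothAt I E X x) (hY : SmoothAt I E Y x)
    (hZ : SmoothAt I E Z x) : ContMDiffAt I 𝓘(ℝ, ℝ) ∞ (𝒱.koszulSum X Y Z) x := by
  have hN := 𝒱.isOrthogonalProjection_N
  have hh := 𝒱.isOrthogonalProjection_hProj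
  exact (𝒱.contMDiffAt_koszul hN hX (hN.smoothAt hY) (hN.smoothAt hZ)).add
    (𝒱.contMDiffAt_koszul hh hX (hh.smoothAt hY) (hh.smoothAt hZ))

/-- A vector field is smooth if its scalar products with smooth vector fields are. -/
theorem smoothAt_of_inner
    (h : ∀ Z : ∀ x : V, TangentSpace I x, SmoothAt I E Z x →
      ContMDiffAt I 𝓘(ℝ, ℝ) ∞ (fun y ↦ 𝒱.g.inner y (Y y) (Z y)) x) : SmoothAt I E Y x := by
  obtain ⟨U, e, hxU, he⟩ := 𝒱.isSmoothMetric_gForm.exists_orthonormalFrame x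
  have h1 : SmoothAt I E (fun y ↦ ∑ i, 𝒱.g.inner y (Y y) (e i y) • e i y) x :=
    ContMDiffAt.sum_section fun i _ ↦ (h _ (he.smooth x hxU i)).smul_section (he.smooth x hxU i)
  refine h1.congr_of_eventuallyEq ?_
  filter_upwards [he.isOpen.mem_nhds hxU] with y hy
  have h2 := he.sum_eq y hy (Y y)
  simp only [gForm_apply] at h2
  conv_lhs => rw [← h2]
  simp only [𝒱.g.symm y (Y y)]

theorem smoothAt_canonicalD (hX : SmoothAt I E X x) (hY : SmoothAt I E Y x) :
    SmoothAt I E (fun y ↦ 𝒱.canonicalD Y y (X y)) x := by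
  refine 𝒱.smoothAt_of_inner fun Z hZ ↦ ?_
  have h1 : ContMDiffAt I 𝓘(ℝ, ℝ) ∞ (fun y ↦ (1 / 2 : ℝ) * 𝒱.koszulSum X Y Z y) x :=
    contMDiffAt_const.mul (𝒱.contMDiffAt_koszulSum hX hY hZ)
  refine h1.congr_of_eventuallyEq ?_
  filter_upwards [hX.eventually_diffAt, hY.eventually_diffAt, hZ.eventually_diffAt]
    with y hXy hYy hZy
  rw [← 𝒱.two_inner_canonicalD hXy hYy hZy]
  ring

theorem contMDiffCovariantDerivative_canonicalD :
    CovariantDerivative.ContMDiffCovariantDerivative 𝒱.canonicalD ∞ where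
  contMDiff :=
    { contMDiff := by
        intro Y hY x _
        refine (contMDiffAt_hom_of_apply fun X hX ↦ ?_).contMDiffWithinAt
        exact 𝒱.smoothAt_canonicalD hX ((hY x (mem_univ x)).contMDiffAt univ_mem) }

end smoothness

end NAnholonomicManifold

theorem SmoothVF.diffAt {E : Type*} [NormedAddCommGroup E] [NormedSpace ℝ E]
    [FiniteDimensional ℝ E]
    {H : Type*} [TopologicalSpace H] {I : ModelWithCorners ℝ E H}
    {V : Type*} [TopologicalSpace V] [ChartedSpace H V] [IsManifold I ∞ V]
    {X : ∀ x : V, TangentSpace I x} (hX : SmoothVF X) (x : V) : DiffAt I E X x :=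
  SmoothAt.diffAt (hX x)

namespace NAnholonomicManifold

variable {E : Type*} [NormedAddCommGroup E] [NormedSpace ℝ E] [FiniteDimensional ℝ E]
  {H : Type*} [TopologicalSpace H] {I : ModelWithCorners ℝ E H}
  {V : Type*} [TopologicalSpace V] [ChartedSpace H V] [IsManifold I ∞ V]
  {E' : Type*} [NormedAddCommGroup E'] [NormedSpace ℝ E']
  {H' : Type*} [TopologicalSpace H'] {I' : ModelWithCorners ℝ E' H'}
  {M : Type*} [TopologicalSpace M] [ChartedSpace H' M]
  (𝒱 : NAnholonomicManifold I V I' M)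
  {X Y Z : ∀ x : V, TangentSpace I x} {x : V}
  {P : ∀ x : V, TangentSpace I x →L[ℝ] TangentSpace I x}

theorem gFun_zero_left : 𝒱.gFun (fun _ ↦ 0) Z = fun _ ↦ 0 := by
  ext; simp [gFun]

theorem gFun_zero_right : 𝒱.gFun X (fun _ ↦ 0) = fun _ ↦ 0 := by
  ext; simp [gFun]

theorem koszul_zero_middle : 𝒱.koszul P X (fun _ ↦ 0) Z x = 0 := by
  have h1 : VectorField.mlieBracket I X (fun _ ↦ 0) x = 0 := by
    exact congrFun VectorField.mlieBracket_zero_right x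
  have h2 : VectorField.mlieBracket I (fun _ ↦ 0) Z x = 0 := by
    exact congrFun VectorField.mlieBracket_zero_left x
  simp only [koszul, gFun_zero_left, gFun_zero_right, mvfderiv_const, h1, h2]
  simp

theorem koszul_add_koszul_swap :
    𝒱.koszul P X Y Z x + 𝒱.koszul P X Z Y x = 2 * mvfderiv I (𝒱.gFun Y Z) x (X x) := by
  simp only [koszul, 𝒱.gFun_comm (X := Z) (Z := Y),
    VectorField.mlieBracket_swap_apply (V := Z) (W := Y), map_neg, neg_apply]
  ring

theorem koszul_sub_koszul_swap (hX : ∀ y, P y (X y) = X y) (hY : ∀ y, P y (Y y) = Y y) :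
    𝒱.koszul P X Y Z x - 𝒱.koszul P Y X Z x =
      2 * 𝒱.g.inner x (VectorField.mlieBracket I X Y x) (Z x) := by
  simp only [koszul, 𝒱.gFun_comm (X := Y) (Z := X), hX, hY,
    VectorField.mlieBracket_swap_apply (V := Y) (W := X), map_neg, neg_apply]
  ring

variable {𝒱} in
theorem koszul_mixed (hP : 𝒱.IsOrthogonalProjection P) (hX : ∀ y, P y (X y) = 0)
    (hY : ∀ y, P y (Y y) = Y y) (hZ : ∀ y, P y (Z y) = Z y) :
    𝒱.koszul P X Y Z x = mvfderiv I (𝒱.gFun Y Z) x (X x)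
      + 𝒱.g.inner x (VectorField.mlieBracket I X Y x) (Z x)
      - 𝒱.g.inner x (VectorField.mlieBracket I X Z x) (Y x) := by
  have h : ∀ W : ∀ x : V, TangentSpace I x, (∀ y, P y (W y) = W y) →
      𝒱.gFun X W = fun _ ↦ 0 := by
    intro W hW
    ext y
    rw [gFun, ← hW y, ← hP.symm, hX]
    simp
  simp only [koszul, h Y hY, h Z hZ, hX, mvfderiv_const]
  simp

theorem koszulSum_of_vertical (hY : 𝒱.IsVertical Y) :
    𝒱.koszulSum X Y Z x = 𝒱.koszul 𝒱.N X Y (fun y ↦ 𝒱.N y (Z y)) x := by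
  have h1 : (fun y ↦ 𝒱.N y (Y y)) = Y := funext hY
  have h2 : (fun y ↦ 𝒱.hProj y (Y y)) = fun _ ↦ 0 := by
    ext y; simp [hProj, hY y]
  rw [koszulSum, h1, h2, koszul_zero_middle, add_zero]

theorem koszulSum_of_horizontal (hY : 𝒱.IsHorizontal Y) :
    𝒱.koszulSum X Y Z x = 𝒱.koszul 𝒱.hProj X Y (fun y ↦ 𝒱.hProj y (Z y)) x := by
  have h1 : (fun y ↦ 𝒱.N y (Y y)) = fun _ ↦ 0 := funext hY
  have h2 : (fun y ↦ 𝒱.hProj y (Y y)) = Y := by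
    ext y; simp [hProj, hY y]
  rw [koszulSum, h1, h2, koszul_zero_middle, zero_add]

theorem hProj_apply (ξ : TangentSpace I x) : 𝒱.hProj x ξ = ξ - 𝒱.N x ξ := rfl

theorem hProj_eq_self_iff (ξ : TangentSpace I x) : 𝒱.hProj x ξ = ξ ↔ 𝒱.N x ξ = 0 := by
  rw [hProj_apply, sub_eq_self]

theorem hProj_eq_zero_iff (ξ : TangentSpace I x) : 𝒱.hProj x ξ = 0 ↔ 𝒱.N x ξ = ξ := by
  rw [hProj_apply, sub_eq_zero, eq_comm]

/-- The canonical d-connection preserves the sections of the image of a projection for which it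
is given by a Koszul formula. -/
theorem proj_canonicalD (hP : 𝒱.IsOrthogonalProjection P)
    (h : ∀ X Z : ∀ x : V, TangentSpace I x, 𝒱.koszulSum X Y Z x =
      𝒱.koszul P X Y (fun y ↦ P y (Z y)) x)
    (hY : DiffAt I E Y x) (ξ : TangentSpace I x) :
    P x (𝒱.canonicalD Y x ξ) = 𝒱.canonicalD Y x ξ := by
  suffices P x ∘L 𝒱.canonicalD Y x = 𝒱.canonicalD Y x from
    congrArg (fun A : TangentSpace I x →L[ℝ] TangentSpace I x ↦ A ξ) this
  refine 𝒱.eq_of_inner_extend_eq fun X Z hX hZ ↦ ?_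
  have h1 := 𝒱.two_inner_canonicalD hX hY (hP.diffAt hZ)
  have h2 := 𝒱.two_inner_canonicalD hX hY hZ
  rw [h] at h1 h2
  simp only [hP.idem] at h1
  rw [ContinuousLinearMap.comp_apply, hP.symm]
  linarith

theorem canonicalD_metric (hY : DiffAt I E Y x) (hZ : DiffAt I E Z x) (ξ : TangentSpace I x) :
    mvfderiv I (𝒱.gFun Y Z) x ξ =
      𝒱.g.inner x (𝒱.canonicalD Y x ξ) (Z x) + 𝒱.g.inner x (Y x) (𝒱.canonicalD Z x ξ) := by
  have hN := 𝒱.isOrthogonalProjection_N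
  have hh := 𝒱.isOrthogonalProjection_hProj
  have hX := FiberBundle.mdifferentiableAt_extend I E ξ
  have h1 := 𝒱.two_inner_canonicalD hX hY hZ
  have h2 := 𝒱.two_inner_canonicalD hX hZ hY
  have h3 : 𝒱.gFun Y Z = 𝒱.gFun (fun y ↦ 𝒱.N y (Y y)) (fun y ↦ 𝒱.N y (Z y)) +
      𝒱.gFun (fun y ↦ 𝒱.hProj y (Y y)) (fun y ↦ 𝒱.hProj y (Z y)) := by
    ext y
    exact (𝒱.inner_N_add_inner_hProj _ _).symm
  have h4 := mvfderiv_add (𝒱.mdifferentiableAt_gFun (hN.diffAt hY) (hN.diffAt hZ))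
    (𝒱.mdifferentiableAt_gFun (hh.diffAt hY) (hh.diffAt hZ))
  rw [← h3] at h4
  have h5 := congrArg (fun l : TangentSpace I x →L[ℝ] ℝ ↦ l ξ) h4
  have h6 := 𝒱.koszul_add_koszul_swap (X := FiberBundle.extend E ξ) (x := x) (P := 𝒱.N)
    (Y := fun y ↦ 𝒱.N y (Y y)) (Z := fun y ↦ 𝒱.N y (Z y))
  have h7 := 𝒱.koszul_add_koszul_swap (X := FiberBundle.extend E ξ) (x := x) (P := 𝒱.hProj)
    (Y := fun y ↦ 𝒱.hProj y (Y y)) (Z := fun y ↦ 𝒱.hProj y (Z y))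
  simp only [koszulSum, FiberBundle.extend_apply_self, add_apply] at h1 h2 h5 h6 h7
  rw [𝒱.g.symm x (Y x)]
  linarith

theorem canonicalD_torsion (hP : 𝒱.IsOrthogonalProjection P)
    (h : ∀ X Y Z : ∀ x : V, TangentSpace I x, (∀ y, P y (Y y) = Y y) →
      𝒱.koszulSum X Y Z x = 𝒱.koszul P X Y (fun y ↦ P y (Z y)) x)
    (hX : DiffAt I E X x) (hY : DiffAt I E Y x)
    (hPX : ∀ y, P y (X y) = X y) (hPY : ∀ y, P y (Y y) = Y y) :
    P x (torsionField 𝒱.canonicalD X Y x) = 0 := by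
  refine 𝒱.eq_of_inner_eq fun η ↦ ?_
  rw [hP.symm]
  have hZ := hP.diffAt (FiberBundle.mdifferentiableAt_extend I E η)
  have h1 := 𝒱.two_inner_canonicalD hX hY hZ
  have h2 := 𝒱.two_inner_canonicalD hY hX hZ
  rw [h _ _ _ hPY] at h1
  rw [h _ _ _ hPX] at h2
  have h3 := 𝒱.koszul_sub_koszul_swap (x := x)
    (Z := fun y ↦ P y (P y (FiberBundle.extend E η y))) hPX hPY
  simp only [hP.idem, FiberBundle.extend_apply_self] at h1 h2 h3
  simp only [torsionField, map_sub, sub_apply, map_zero, zero_apply]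
  linarith

theorem isCanonicalDConnection_canonicalD : 𝒱.IsCanonicalDConnection 𝒱.canonicalD where
  smooth := 𝒱.contMDiffCovariantDerivative_canonicalD
  horizontal Y hY hY' x ξ := (𝒱.hProj_eq_self_iff _).1 <|
    𝒱.proj_canonicalD 𝒱.isOrthogonalProjection_hProj
      (fun _ _ ↦ 𝒱.koszulSum_of_horizontal hY') (hY.diffAt x) ξ
  vertical Y hY hY' x ξ := 𝒱.proj_canonicalD 𝒱.isOrthogonalProjection_N
      (fun _ _ ↦ 𝒱.koszulSum_of_vertical hY') (hY.diffAt x) ξ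
  metric Y Z hY hZ x ξ := 𝒱.canonicalD_metric (hY.diffAt x) (hZ.diffAt x) ξ
  torsion_hh X Y hX hY hX' hY' x := 𝒱.canonicalD_torsion 𝒱.isOrthogonalProjection_hProj
    (fun _ _ _ h ↦ 𝒱.koszulSum_of_horizontal fun y ↦ (𝒱.hProj_eq_self_iff _).1 (h y))
    (hX.diffAt x) (hY.diffAt x) (fun y ↦ (𝒱.hProj_eq_self_iff _).2 (hX' y))
    (fun y ↦ (𝒱.hProj_eq_self_iff _).2 (hY' y))
  torsion_vv X Y hX hY hX' hY' x := 𝒱.canonicalD_torsion 𝒱.isOrthogonalProjection_N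
    (fun _ _ _ h ↦ 𝒱.koszulSum_of_vertical h) (hX.diffAt x) (hY.diffAt x) hX' hY'
  mixed_hv X Y Z hX hY hZ hX' hY' hZ' x := by
    rw [𝒱.two_inner_canonicalD (hX.diffAt x) (hY.diffAt x) (hZ.diffAt x),
      𝒱.koszulSum_of_vertical hY', show (fun y ↦ 𝒱.N y (Z y)) = Z from funext hZ',
      koszul_mixed 𝒱.isOrthogonalProjection_N hX' hY' hZ']
  mixed_vh X Y Z hX hY hZ hX' hY' hZ' x := by
    have hZ'' : ∀ y, 𝒱.hProj y (Z y) = Z y := fun y ↦ (𝒱.hProj_eq_self_iff _).2 (hZ' y)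
    rw [𝒱.two_inner_canonicalD (hX.diffAt x) (hY.diffAt x) (hZ.diffAt x),
      𝒱.koszulSum_of_horizontal hY', show (fun y ↦ 𝒱.hProj y (Z y)) = Z from funext hZ'',
      koszul_mixed 𝒱.isOrthogonalProjection_hProj (fun y ↦ (𝒱.hProj_eq_zero_iff _).2 (hX' y))
        (fun y ↦ (𝒱.hProj_eq_self_iff _).2 (hY' y)) hZ'']

section uniqueness

variable {𝒱} {D : CovariantDerivative I E (fun x : V ↦ TangentSpace I x)}

theorem IsCanonicalDConnection.two_inner_eq_koszul_of_torsion (hD : 𝒱.IsCanonicalDConnection D)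
    (hP : 𝒱.IsOrthogonalProjection P)
    (hT : ∀ X Y, SmoothVF X → SmoothVF Y → (∀ y, P y (X y) = X y) → (∀ y, P y (Y y) = Y y) →
      ∀ x, P x (torsionField D X Y x) = 0)
    (hX : SmoothVF X) (hY : SmoothVF Y) (hZ : SmoothVF Z) (hX' : ∀ y, P y (X y) = X y)
    (hY' : ∀ y, P y (Y y) = Y y) (hZ' : ∀ y, P y (Z y) = Z y) :
    2 * 𝒱.g.inner x (D Y x (X x)) (Z x) = 𝒱.koszul P X Y Z x := by
  have hT' : ∀ X Y Z : ∀ x : V, TangentSpace I x, SmoothVF X → SmoothVF Y → (∀ y, P y (X y) = X y) →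
      (∀ y, P y (Y y) = Y y) → (∀ y, P y (Z y) = Z y) →
      𝒱.g.inner x (torsionField D X Y x) (Z x) = 0 := by
    intro X Y Z hX hY hX' hY' hZ'
    rw [← hZ' x, ← hP.symm, hT X Y hX hY hX' hY' x]
    simp
  have h1 := hD.metric Y Z hY hZ x (X x)
  have h2 := hD.metric X Z hX hZ x (Y x)
  have h3 := hD.metric X Y hX hY x (Z x)
  have h4 := hT' X Y Z hX hY hX' hY' hZ'
  have h5 := hT' X Z Y hX hZ hX' hZ' hY'
  have h6 := hT' Y Z X hY hZ hY' hZ' hX'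
  simp only [torsionField, map_sub, sub_apply] at h4 h5 h6
  rw [koszul, h1, h2, h3, hX' x, 𝒱.g.symm x (Y x), 𝒱.g.symm x (X x) (D Z x (Y x)),
    𝒱.g.symm x (X x) (D Y x (Z x))]
  linarith

theorem IsCanonicalDConnection.two_inner_eq_koszul (hD : 𝒱.IsCanonicalDConnection D)
    (hP : 𝒱.IsOrthogonalProjection P) {Q : ∀ x : V, TangentSpace I x →L[ℝ] TangentSpace I x}
    (hQ : 𝒱.IsOrthogonalProjection Q) (hPQ : ∀ x ξ, P x ξ + Q x ξ = ξ)
    (hT : ∀ X Y, SmoothVF X → SmoothVF Y → (∀ y, P y (X y) = X y) → (∀ y, P y (Y y) = Y y) →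
      ∀ x, P x (torsionField D X Y x) = 0)
    (hM : ∀ X Y Z : ∀ x : V, TangentSpace I x, SmoothVF X → SmoothVF Y → SmoothVF Z → (∀ y, P y (X y) = 0) →
      (∀ y, P y (Y y) = Y y) → (∀ y, P y (Z y) = Z y) → ∀ x,
      2 * 𝒱.g.inner x (D Y x (X x)) (Z x) = mvfderiv I (𝒱.gFun Y Z) x (X x)
        + 𝒱.g.inner x (VectorField.mlieBracket I X Y x) (Z x)
        - 𝒱.g.inner x (VectorField.mlieBracket I X Z x) (Y x))
    (hV : ∀ Y, SmoothVF Y → (∀ y, P y (Y y) = Y y) → ∀ x ξ, P x (D Y x ξ) = D Y x ξ)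
    (hX : SmoothVF X) (hY : SmoothVF Y) (hZ : SmoothVF Z) (hY' : ∀ y, P y (Y y) = Y y) :
    2 * 𝒱.g.inner x (D Y x (X x)) (Z x) = 𝒱.koszul P X Y (fun y ↦ P y (Z y)) x := by
  have hPX : SmoothVF (fun y ↦ P y (X y)) := fun y ↦ hP.smoothAt (hX y)
  have hQX : SmoothVF (fun y ↦ Q y (X y)) := fun y ↦ hQ.smoothAt (hX y)
  have hPZ : SmoothVF (fun y ↦ P y (Z y)) := fun y ↦ hP.smoothAt (hZ y)
  have hPQ0 : ∀ y, P y (Q y (X y)) = 0 := fun y ↦ by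
    have := hPQ y (P y (X y))
    rw [hP.idem, add_eq_left] at this
    have h2 := congrArg (P y) (hPQ y (X y))
    rw [map_add, hP.idem, add_eq_left] at h2
    exact h2
  have h1 := hD.two_inner_eq_koszul_of_torsion hP hT (x := x) hPX hY hPZ (fun y ↦ hP.idem _ _) hY'
    (fun y ↦ hP.idem _ _)
  have h2 := hM _ _ _ hQX hY hPZ hPQ0 hY' (fun y ↦ hP.idem _ _) x
  rw [← koszul_mixed hP hPQ0 hY' (fun y ↦ hP.idem _ _)] at h2
  have h3 : X = (fun y ↦ P y (X y)) + (fun y ↦ Q y (X y)) := funext fun y ↦ (hPQ y _).symm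
  conv_rhs => rw [h3]
  rw [𝒱.koszul_add_left (hPX.diffAt x) (hQX.diffAt x) (hY.diffAt x) (hPZ.diffAt x), ← h1, ← h2,
    ← hP.symm, ← hP.symm, hV Y hY hY', hV Y hY hY']
  conv_lhs => rw [← hPQ x (X x)]
  simp only [map_add, add_apply]
  ring

theorem IsCanonicalDConnection.two_inner_eq_koszulSum (hD : 𝒱.IsCanonicalDConnection D)
    (hX : SmoothVF X) (hY : SmoothVF Y) (hZ : SmoothVF Z) :
    2 * 𝒱.g.inner x (D Y x (X x)) (Z x) = 𝒱.koszulSum X Y Z x := by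
  have hN := 𝒱.isOrthogonalProjection_N
  have hh := 𝒱.isOrthogonalProjection_hProj
  have hNY : SmoothVF (fun y ↦ 𝒱.N y (Y y)) := fun y ↦ hN.smoothAt (hY y)
  have hhY : SmoothVF (fun y ↦ 𝒱.hProj y (Y y)) := fun y ↦ hh.smoothAt (hY y)
  have h1 := hD.two_inner_eq_koszul (x := x) hN hh (by simp [hProj]) hD.torsion_vv hD.mixed_hv
    hD.vertical hX hNY hZ (fun y ↦ hN.idem _ _)
  have h2 := hD.two_inner_eq_koszul (x := x) hh hN (by simp [hProj])
    (by simpa only [hProj_eq_self_iff] using! hD.torsion_hh)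
    (by simpa only [hProj_eq_self_iff, hProj_eq_zero_iff] using! hD.mixed_vh)
    (by simpa only [hProj_eq_self_iff] using! hD.horizontal) hX hhY hZ (fun y ↦ hh.idem _ _)
  have h3 : Y = (fun y ↦ 𝒱.N y (Y y)) + (fun y ↦ 𝒱.hProj y (Y y)) := by ext y; simp [hProj]
  rw [koszulSum, ← h1, ← h2]
  conv_lhs => rw [h3]
  have h4 := D.isCovariantDerivativeOnUniv.add (hNY.diffAt x) (hhY.diffAt x)
  rw [h4]
  simp only [map_add, add_apply]
  ring

theorem IsCanonicalDConnection.eq_canonicalD [T2Space V] (hD : 𝒱.IsCanonicalDConnection D)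
    (hY : SmoothVF Y) : D Y = 𝒱.canonicalD Y := by
  ext x ξ
  obtain ⟨X, hX, rfl⟩ := exists_smooth_section_apply_eq (I := I) (F := E) ξ
  refine 𝒱.eq_of_inner_eq fun η ↦ ?_
  obtain ⟨Z, hZ, rfl⟩ := exists_smooth_section_apply_eq (I := I) (F := E) η
  have h1 := hD.two_inner_eq_koszulSum (x := x) hX hY hZ
  have h2 := 𝒱.isCanonicalDConnection_canonicalD.two_inner_eq_koszulSum (x := x) hX hY hZ
  linarith

end uniqueness

end NAnholonomicManifold

section CliffordAlgebra

theorem finite_cliffordAlgebra {K L : Type*} [Field K] [AddCommGroup L] [Module K L]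
    [FiniteDimensional K L] (Q : QuadraticForm K L) : FiniteDimensional K (CliffordAlgebra Q) := by
  let b := Module.finBasis K L
  let e (i) := CliffordAlgebra.ι Q (b i)
  have main : ∀ k : ℕ, ∃ W : Submodule K (CliffordAlgebra Q), FiniteDimensional K W ∧ 1 ∈ W ∧
      ∀ i : Fin (Module.finrank K L), i < k → ∀ w ∈ W, e i * w ∈ W := by
    intro k
    induction k with
    | zero => exact ⟨K ∙ 1, inferInstance, Submodule.mem_span_singleton_self 1, by simp⟩
    | succ k ih =>
      obtain ⟨W, hW, h1, he⟩ := ih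
      by_cases hk : k < Module.finrank K L
      swap
      · exact ⟨W, hW, h1, fun i _ ↦ he i (by omega)⟩
      let f := LinearMap.mulLeft K (e ⟨k, hk⟩)
      refine ⟨W ⊔ W.map f, inferInstance, Submodule.mem_sup_left h1, fun i hi w hw ↦ ?_⟩
      obtain ⟨u, hu, _, ⟨v, hv, rfl⟩, rfl⟩ := Submodule.mem_sup.1 hw
      rw [mul_add]
      rcases Nat.lt_succ_iff_lt_or_eq.1 hi with hi' | hi'
      · refine add_mem (Submodule.mem_sup_left (he i hi' u hu)) ?_
        have h2 : e i * f v = QuadraticMap.polar Q (b i) (b ⟨k, hk⟩) • v - f (e i * v) := by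
          have := CliffordAlgebra.ι_mul_ι_add_swap (Q := Q) (b i) (b ⟨k, hk⟩)
          simp only [f, LinearMap.mulLeft_apply, e, ← mul_assoc]
          rw [eq_sub_iff_add_eq, ← add_mul, this, Algebra.smul_def]
        rw [h2]
        exact sub_mem (Submodule.mem_sup_left (Submodule.smul_mem _ _ hv))
          (Submodule.mem_sup_right ⟨_, he i hi' v hv, rfl⟩)
      · obtain rfl : i = ⟨k, hk⟩ := Fin.ext hi'
        refine add_mem (Submodule.mem_sup_right ⟨u, hu, rfl⟩) (Submodule.mem_sup_left ?_)
        have h2 : e ⟨k, hk⟩ * f v = Q (b ⟨k, hk⟩) • v := by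
          simp only [f, LinearMap.mulLeft_apply, e, ← mul_assoc]
          rw [CliffordAlgebra.ι_sq_scalar, Algebra.smul_def]
        rw [h2]
        exact Submodule.smul_mem _ _ hv
  obtain ⟨W, hW, h1, he⟩ := main (Module.finrank K L)
  have htop : W = ⊤ := by
    refine eq_top_iff.2 fun a _ ↦ ?_
    induction a using CliffordAlgebra.left_induction with
    | algebraMap r => rw [Algebra.algebraMap_eq_smul_one]; exact W.smul_mem _ h1
    | add x y hx hy => exact W.add_mem (hx trivial) (hy trivial)
    | ι_mul x m hx =>
      rw [← b.sum_repr m]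
      simp only [map_sum, map_smul, Finset.sum_mul, smul_mul_assoc]
      exact W.sum_mem fun i _ ↦ W.smul_mem _ (he i i.2 x (hx trivial))
  exact Module.finite_def.2 (htop ▸ (Submodule.fg_top W).1 (Module.finite_def.1 hW))

variable {R : Type*} [Ring R] [Algebra ℝ R] {ι : Type*} [Fintype ι] [DecidableEq ι]

/-- The element `-1/4 ∑ S_{αβ} γ_β γ_α`, which generates the infinitesimal rotation `S`. -/
def spinGenerator (γ : ι → R) (S : ι → ι → ℝ) : R :=
  -((1 / 4 : ℝ) • ∑ α, ∑ β, S α β • (γ β * γ α))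

theorem spinGenerator_commutator {γ : ι → R} {S : ι → ι → ℝ}
    (hγ : ∀ α β, γ α * γ β + γ β * γ α = if α = β then 2 else 0)
    (hS : ∀ α β, S α β = -S β α) (μ : ι) :
    spinGenerator γ S * γ μ - γ μ * spinGenerator γ S = ∑ α, S α μ • γ α := by
  have h1 : ∀ α β, γ β * γ α * γ μ - γ μ * (γ β * γ α) =
      (if α = μ then (2 : ℝ) • γ β else 0) - if β = μ then (2 : ℝ) • γ α else 0 := by
    intro α β
    have h2 : γ β * γ α * γ μ - γ μ * (γ β * γ α) =
        γ β * (γ α * γ μ + γ μ * γ α) - (γ β * γ μ + γ μ * γ β) * γ α := by noncomm_ring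
    rw [h2, hγ, hγ]
    split_ifs <;> simp [two_mul, mul_two, two_smul]
  calc spinGenerator γ S * γ μ - γ μ * spinGenerator γ S
      = -((1 / 4 : ℝ) • ∑ α, ∑ β, S α β • (γ β * γ α * γ μ - γ μ * (γ β * γ α))) := by
        simp only [spinGenerator, neg_mul, mul_neg, smul_mul_assoc, mul_smul_comm, Finset.sum_mul,
          Finset.mul_sum, smul_sub, Finset.sum_sub_distrib]
        abel
    _ = -((1 / 4 : ℝ) • (∑ β, (2 * S μ β) • γ β - ∑ α, (2 * S α μ) • γ α)) := by
        simp only [h1, smul_sub, Finset.sum_sub_distrib, smul_ite, smul_zero, smul_smul]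
        rw [Finset.sum_comm (f := fun α β ↦ if α = μ then (S α β * 2) • γ β else 0)]
        simp [mul_comm]
    _ = ∑ α, S α μ • γ α := by
        rw [← Finset.sum_sub_distrib, Finset.smul_sum, ← Finset.sum_neg_distrib]
        refine Finset.sum_congr rfl fun α _ ↦ ?_
        rw [hS μ α, ← sub_smul, smul_smul, ← neg_smul]
        congr 1
        ring

end CliffordAlgebra

/-- The standard Euclidean quadratic form on `ℝⁿ`. -/
abbrev stdQuad (n : ℕ) : QuadraticForm ℝ (Fin n → ℝ) :=
  QuadraticMap.weightedSumSquares ℝ (fun _ : Fin n ↦ (1 : ℝ))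

/-- The complexified Clifford algebra of `ℝⁿ`. -/
abbrev ModelCl (n : ℕ) : Type := ℂ ⊗[ℝ] CliffordAlgebra (stdQuad n)

namespace ModelCl

variable {n : ℕ}

instance : FiniteDimensional ℝ (CliffordAlgebra (stdQuad n)) := finite_cliffordAlgebra _

/-- The regular representation of the Clifford algebra of `ℝⁿ` by matrices. -/
def toMatrix (n : ℕ) : ModelCl n →ₐ[ℝ] Matrix (Fin (Module.finrank ℝ (ModelCl n)))
    (Fin (Module.finrank ℝ (ModelCl n))) ℝ :=
  Algebra.leftMulMatrix (Module.finBasis ℝ (ModelCl n))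

theorem toMatrix_injective : Injective (toMatrix n) :=
  Algebra.leftMulMatrix_injective _

open scoped Matrix.Norms.Operator in
instance : NormedRing (ModelCl n) :=
  NormedRing.induced _ _ (toMatrix n) toMatrix_injective

open scoped Matrix.Norms.Operator in
instance : NormedAlgebra ℝ (ModelCl n) :=
  letI : SeminormedRing (ModelCl n) := NormedRing.toSeminormedRing
  { norm_smul_le := fun r x ↦ by
      change ‖toMatrix n (r • x)‖ ≤ ‖r‖ * ‖toMatrix n x‖
      rw [map_smul]
      exact norm_smul_le r _ }

/-- The generators of the Clifford algebra of `ℝⁿ`. -/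
def gen (i : Fin n) : ModelCl n := 1 ⊗ₜ CliffordAlgebra.ι (stdQuad n) (Pi.single i 1)

theorem gen_anticomm (i j : Fin n) :
    (gen i * gen j + gen j * gen i : ModelCl n) = if i = j then 2 else 0 := by
  simp only [gen, Algebra.TensorProduct.tmul_mul_tmul, mul_one, ← TensorProduct.tmul_add]
  rw [CliffordAlgebra.ι_mul_ι_add_swap, QuadraticMap.polar]
  simp only [QuadraticMap.weightedSumSquares_apply]
  have : ∑ k, (1 : ℝ) • ((Pi.single i 1 + Pi.single j 1 : Fin n → ℝ) k *
      (Pi.single i 1 + Pi.single j 1 : Fin n → ℝ) k) -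
      ∑ k, (1 : ℝ) • ((Pi.single i 1 : Fin n → ℝ) k * (Pi.single i 1 : Fin n → ℝ) k) -
      ∑ k, (1 : ℝ) • ((Pi.single j 1 : Fin n → ℝ) k * (Pi.single j 1 : Fin n → ℝ) k)
      = if i = j then 2 else 0 := by
    simp only [one_smul, Pi.add_apply, add_mul, mul_add, Finset.sum_add_distrib, Pi.single_apply]
    by_cases h : i = j
    · subst h
      simp
      norm_num
    · simp [h, Ne.symm h]
  rw [this]
  split_ifs
  · rw [Algebra.algebraMap_eq_smul_one, TensorProduct.tmul_smul, ← Algebra.TensorProduct.one_def]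
    rw [two_smul, one_add_one_eq_two]
  · simp

end ModelCl

theorem mvfderiv_mul_apply {E : Type*} [NormedAddCommGroup E] [NormedSpace ℝ E]
    {H : Type*} [TopologicalSpace H] {I : ModelWithCorners ℝ E H}
    {V : Type*} [TopologicalSpace V] [ChartedSpace H V] {A : Type*} [NormedRing A]
    [NormedAlgebra ℝ A] {f k : V → A} {x : V} (hf : MDifferentiableAt I 𝓘(ℝ, A) f x)
    (hk : MDifferentiableAt I 𝓘(ℝ, A) k x) (ξ : TangentSpace I x) :
    mvfderiv I (f * k) x ξ = f x * mvfderiv I k x ξ + mvfderiv I f x ξ * k x := by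
  have h := (hf.hasMFDerivAt.mul' hk.hasMFDerivAt).mfderiv
  exact congrArg (fun l : E →L[ℝ] A ↦ l ξ) h

theorem mvfderiv_smul_const_apply {E : Type*} [NormedAddCommGroup E] [NormedSpace ℝ E]
    {H : Type*} [TopologicalSpace H] {I : ModelWithCorners ℝ E H}
    {V : Type*} [TopologicalSpace V] [ChartedSpace H V] {A : Type*} [NormedAddCommGroup A]
    [NormedSpace ℝ A] {f : V → ℝ} {x : V} (hf : MDifferentiableAt I 𝓘(ℝ, ℝ) f x) (v : A)
    (ξ : TangentSpace I x) :
    mvfderiv I (fun y ↦ f y • v) x ξ = mvfderiv I f x ξ • v := by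
  have h : mvfderiv I (f • fun _ ↦ v) x = _ := mvfderiv_smul hf mdifferentiableAt_const
  rw [mvfderiv_const] at h
  simpa using! congrArg (fun l : TangentSpace I x →L[ℝ] A ↦ l ξ) h

theorem mvfderiv_sum_smul_const_apply {E : Type*} [NormedAddCommGroup E] [NormedSpace ℝ E]
    {H : Type*} [TopologicalSpace H] {I : ModelWithCorners ℝ E H}
    {V : Type*} [TopologicalSpace V] [ChartedSpace H V] {A : Type*} [NormedAddCommGroup A]
    [NormedSpace ℝ A] {ι : Type*} {f : ι → V → ℝ} {x : V} (s : Finset ι)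
    (hf : ∀ i, MDifferentiableAt I 𝓘(ℝ, ℝ) (f i) x) (v : ι → A) (ξ : TangentSpace I x) :
    MDifferentiableAt I 𝓘(ℝ, A) (fun y ↦ ∑ i ∈ s, f i y • v i) x ∧
    mvfderiv I (fun y ↦ ∑ i ∈ s, f i y • v i) x ξ = ∑ i ∈ s, mvfderiv I (f i) x ξ • v i := by
  classical
  induction s using Finset.induction_on with
  | empty =>
    simp only [Finset.sum_empty, mvfderiv_const]
    exact ⟨mdifferentiableAt_const, rfl⟩
  | insert j s hj ih =>
    simp only [Finset.sum_insert hj]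
    have h1 : MDifferentiableAt I 𝓘(ℝ, A) (fun y ↦ f j y • v j) x :=
      (hf j).smul mdifferentiableAt_const
    refine ⟨h1.add ih.1, ?_⟩
    rw [← ih.2, ← mvfderiv_smul_const_apply (hf j)]
    exact congrArg (fun l : TangentSpace I x →L[ℝ] A ↦ l ξ) (mvfderiv_add h1 ih.1)

theorem contMDiffAt_mul {E : Type*} [NormedAddCommGroup E] [NormedSpace ℝ E]
    {H : Type*} [TopologicalSpace H] {I : ModelWithCorners ℝ E H}
    {V : Type*} [TopologicalSpace V] [ChartedSpace H V] {A : Type*} [NormedRing A]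
    [NormedAlgebra ℝ A] {f k : V → A} {x : V} (hf : ContMDiffAt I 𝓘(ℝ, A) ∞ f x)
    (hk : ContMDiffAt I 𝓘(ℝ, A) ∞ k x) : ContMDiffAt I 𝓘(ℝ, A) ∞ (f * k) x :=
  ContMDiffAt.comp (g := fun p : A × A ↦ p.1 * p.2) x contDiff_mul.contMDiff.contMDiffAt
    (hf.prodMk_space hk)

theorem spinGenerator_add {R ι : Type*} [Ring R] [Algebra ℝ R] [Fintype ι] (γ : ι → R)
    (S S' : ι → ι → ℝ) :
    spinGenerator γ (S + S') = spinGenerator γ S + spinGenerator γ S' := by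
  simp only [spinGenerator, Pi.add_apply, add_smul, Finset.sum_add_distrib, smul_add]
  abel

theorem spinGenerator_smul {R ι : Type*} [Ring R] [Algebra ℝ R] [Fintype ι] (γ : ι → R)
    (t : ℝ) (S : ι → ι → ℝ) : spinGenerator γ (t • S) = t • spinGenerator γ S := by
  simp only [spinGenerator, Pi.smul_apply, smul_eq_mul, mul_smul, ← Finset.smul_sum, smul_neg]
  rw [smul_comm]

namespace NAnholonomicManifold

variable {E : Type*} [NormedAddCommGroup E] [NormedSpace ℝ E] [FiniteDimensional ℝ E]
  {H : Type*} [TopologicalSpace H] {I : ModelWithCorners ℝ E H}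
  {V : Type*} [TopologicalSpace V] [ChartedSpace H V] [IsManifold I ∞ V]
  {E' : Type*} [NormedAddCommGroup E'] [NormedSpace ℝ E']
  {H' : Type*} [TopologicalSpace H'] {I' : ModelWithCorners ℝ E' H'}
  {M : Type*} [TopologicalSpace M] [ChartedSpace H' M]
  {𝒱 : NAnholonomicManifold I V I' M}

section derivation

variable {x : V} {ξ : TangentSpace I x} {D : CovariantDerivative I E (fun x : V ↦ TangentSpace I x)}
  {a b : ∀ x : V, 𝒱.Cl x}

theorem SmoothCl.of_mem (h : a ∈ 𝒱.clGen) : 𝒱.SmoothCl a :=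
  fun _ ↦ ⟨a, h, Eventually.of_forall fun _ ↦ rfl⟩

theorem func_mem_clGen {f : V → ℝ} (hf : ContMDiff I 𝓘(ℝ, ℝ) ∞ f) :
    (fun x ↦ algebraMap ℝ (𝒱.Cl x) (f x)) ∈ 𝒱.clGen :=
  Algebra.subset_adjoin (Or.inl ⟨f, hf, rfl⟩)

theorem clVec_mem_clGen {X : ∀ x : V, TangentSpace I x} (hX : SmoothVF X) :
    (fun x ↦ 𝒱.clVec x (X x)) ∈ 𝒱.clGen :=
  Algebra.subset_adjoin (Or.inr ⟨X, hX, rfl⟩)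

theorem const_mem_clGen (z : ℂ) : (fun x ↦ algebraMap ℂ (𝒱.Cl x) z) ∈ 𝒱.clGen :=
  𝒱.clGen.algebraMap_mem z

/-- `T` is a derivation on the germs at `x` of sections of `Cl(V)` which extends `D_ξ`. -/
structure IsCliffordDerivationAt (D : CovariantDerivative I E (fun x : V ↦ TangentSpace I x))
    (x : V) (ξ : TangentSpace I x) (T : (∀ y : V, 𝒱.Cl y) → 𝒱.Cl x) : Prop where
  congr : ∀ a b, 𝒱.SmoothCl a → 𝒱.SmoothCl b → (∀ᶠ y in 𝓝 x, a y = b y) → T a = T b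
  add : ∀ a b, 𝒱.SmoothCl a → 𝒱.SmoothCl b → T (a + b) = T a + T b
  mul : ∀ a b, 𝒱.SmoothCl a → 𝒱.SmoothCl b → T (a * b) = T a * b x + a x * T b
  const : ∀ z : ℂ, T (fun y ↦ algebraMap ℂ (𝒱.Cl y) z) = 0
  func : ∀ f : V → ℝ, ContMDiff I 𝓘(ℝ, ℝ) ∞ f →
    T (fun y ↦ algebraMap ℝ (𝒱.Cl y) (f y)) = algebraMap ℝ (𝒱.Cl x) (mvfderiv I f x ξ)
  vec : ∀ X, SmoothVF X → T (fun y ↦ 𝒱.clVec y (X y)) = 𝒱.clVec x (D X x ξ)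

theorem IsCliffordDerivationAt.ext {T T' : (∀ y : V, 𝒱.Cl y) → 𝒱.Cl x}
    (hT : IsCliffordDerivationAt D x ξ T) (hT' : IsCliffordDerivationAt D x ξ T')
    (ha : 𝒱.SmoothCl a) : T a = T' a := by
  obtain ⟨b, hb, hab⟩ := ha x
  rw [hT.congr a b ha (.of_mem hb) hab, hT'.congr a b ha (.of_mem hb) hab]
  clear hab
  induction hb using Algebra.adjoin_induction with
  | mem b hb =>
    rcases hb with ⟨f, hf, rfl⟩ | ⟨X, hX, rfl⟩
    · rw [hT.func f hf, hT'.func f hf]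
    · rw [hT.vec X hX, hT'.vec X hX]
  | algebraMap z => exact (hT.const z).trans (hT'.const z).symm
  | add b c hb hc hb' hc' =>
    rw [hT.add b c (.of_mem hb) (.of_mem hc), hT'.add b c (.of_mem hb) (.of_mem hc), hb', hc']
  | mul b c hb hc hb' hc' =>
    rw [hT.mul b c (.of_mem hb) (.of_mem hc), hT'.mul b c (.of_mem hb) (.of_mem hc), hb', hc']

theorem IsCliffordExtension.isCliffordDerivationAt [T2Space V]
    {𝒟 : (∀ x : V, 𝒱.Cl x) → ∀ x : V, TangentSpace I x →ₗ[ℝ] 𝒱.Cl x}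
    (h : 𝒱.IsCliffordExtension D 𝒟) (x : V) (ξ : TangentSpace I x) :
    IsCliffordDerivationAt D x ξ (fun a ↦ 𝒟 a x ξ) where
  congr a b ha hb hab := by
    obtain ⟨f, hf, hf1, hfU⟩ := exists_smooth_bump I hab
    have h1 : mvfderiv I f x = 0 := by
      rw [mvfderiv_congr hf1]
      exact mvfderiv_const 1
    have h2 : (fun y ↦ algebraMap ℝ (𝒱.Cl y) (f y)) * a =
        (fun y ↦ algebraMap ℝ (𝒱.Cl y) (f y)) * b := by
      ext y
      by_cases hy : y ∈ tsupport f
      · have := hfU hy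
        simp only [mem_ofPred_eq] at this
        simp [this]
      · simp [image_eq_zero_of_notMem_tsupport hy]
    have h3 : ∀ c, 𝒱.SmoothCl c →
        𝒟 ((fun y ↦ algebraMap ℝ (𝒱.Cl y) (f y)) * c) x ξ = 𝒟 c x ξ := by
      intro c hc
      rw [h.mul _ _ (.of_mem (func_mem_clGen hf)) hc, h.func f hf, h1]
      have h4 : f x = 1 := hf1.self_of_nhds
      simp only [zero_apply, map_zero, zero_mul, zero_add, h4, map_one, one_mul]
    change 𝒟 a x ξ = 𝒟 b x ξ
    rw [← h3 a ha, h2, h3 b hb]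
  add a b ha hb := by simp [h.add a b ha hb]
  mul a b ha hb := h.mul a b ha hb x ξ
  const z := by
    have h1 := h.func (fun _ ↦ 1) contMDiff_const x ξ
    rw [mvfderiv_const] at h1
    have h2 := h.smul z _ (.of_mem (func_mem_clGen (contMDiff_const (c := (1 : ℝ))))) x ξ
    rw [h1] at h2
    have h3 : (fun y ↦ algebraMap ℂ (𝒱.Cl y) z) =
        z • fun y : V ↦ algebraMap ℝ (𝒱.Cl y) 1 := by
      ext y
      simp [Algebra.algebraMap_eq_smul_one]
    rw [h3, h2]
    simp
  func f hf := h.func f hf x ξ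
  vec X hX := h.vec X hX x ξ

end derivation

section frame

variable {n : ℕ} {U : Set V} {e : Fin n → ∀ x : V, TangentSpace I x}
  (h : IsOrthonormalFrameOn I E 𝒱.gForm e U) {x : V} (hx : x ∈ U)

/-- An orthonormal frame identifies the tangent spaces with `ℝⁿ`. -/
def frameIsometry : (𝒱.quad x).IsometryEquiv (stdQuad n) where
  toFun ξ i := 𝒱.g.inner x (e i x) ξ
  map_add' ξ η := by ext; simp
  map_smul' t ξ := by ext; simp
  invFun v := ∑ i, v i • e i x
  left_inv ξ := h.sum_eq x hx ξ
  right_inv v := by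
    ext i
    have := h.orthonormal x hx i
    simp only [gForm_apply] at this
    simp [this]
  map_app' ξ := by
    change stdQuad n (fun i ↦ 𝒱.g.inner x (e i x) ξ) = 𝒱.g.inner x ξ ξ
    conv_rhs => rw [← h.sum_eq x hx ξ]
    simp only [QuadraticMap.weightedSumSquares_apply, map_sum, map_smul, sum_apply,
      smul_apply, gForm_apply, smul_eq_mul]
    have := h.orthonormal x hx
    simp only [gForm_apply] at this
    simp [this]

/-- An orthonormal frame identifies the fibres of `Cl(V)` with the Clifford algebra of `ℝⁿ`. -/
def frameEquiv : 𝒱.Cl x ≃ₐ[ℂ] ModelCl n :=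
  Algebra.TensorProduct.congr AlgEquiv.refl
    (CliffordAlgebra.equivOfIsometry (frameIsometry h hx))

theorem frameEquiv_clVec (ξ : TangentSpace I x) :
    frameEquiv h hx (𝒱.clVec x ξ) = ∑ i, 𝒱.g.inner x (e i x) ξ • ModelCl.gen i := by
  have h1 : frameEquiv h hx (𝒱.clVec x ξ) =
      1 ⊗ₜ CliffordAlgebra.ι (stdQuad n) (fun i ↦ 𝒱.g.inner x (e i x) ξ) := by
    change (1 : ℂ) ⊗ₜ[ℝ] CliffordAlgebra.map (frameIsometry h hx).toIsometry
      (CliffordAlgebra.ι _ ξ) = _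
    rw [CliffordAlgebra.map_apply_ι]
    rfl
  rw [h1, ← Finset.univ_sum_single (fun i ↦ 𝒱.g.inner x (e i x) ξ)]
  simp only [map_sum, TensorProduct.tmul_sum, ModelCl.gen]
  refine Finset.sum_congr rfl fun i _ ↦ ?_
  rw [← TensorProduct.tmul_smul, ← map_smul, ← Pi.single_smul, smul_eq_mul, mul_one]

theorem frameEquiv_algebraMap (r : ℝ) :
    frameEquiv h hx (algebraMap ℝ (𝒱.Cl x) r) = r • 1 := by
  rw [IsScalarTower.algebraMap_apply ℝ ℂ, AlgEquiv.commutes, ← IsScalarTower.algebraMap_apply,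
    Algebra.algebraMap_eq_smul_one]

open Classical in
/-- The coordinates of a section of `Cl(V)` with respect to an orthonormal frame. -/
def coords (a : ∀ x : V, 𝒱.Cl x) (y : V) : ModelCl n :=
  if hy : y ∈ U then frameEquiv h hy (a y) else 0

theorem coords_of_mem (a : ∀ x : V, 𝒱.Cl x) : coords h a x = frameEquiv h hx (a x) :=
  dif_pos hx

theorem coords_add (a b : ∀ x : V, 𝒱.Cl x) : coords h (a + b) = coords h a + coords h b := by
  ext y
  by_cases hy : y ∈ U <;> simp [coords, hy]

theorem coords_mul (a b : ∀ x : V, 𝒱.Cl x) : coords h (a * b) = coords h a * coords h b := by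
  ext y
  by_cases hy : y ∈ U <;> simp [coords, hy]

theorem coords_congr {a b : ∀ x : V, 𝒱.Cl x} (hab : ∀ᶠ y in 𝓝 x, a y = b y) :
    coords h a =ᶠ[𝓝 x] coords h b := by
  filter_upwards [hab] with y hy
  simp [coords, hy]

include hx in
theorem coords_const (z : ℂ) : coords h (fun y ↦ algebraMap ℂ (𝒱.Cl y) z) =ᶠ[𝓝 x]
    fun _ ↦ algebraMap ℂ (ModelCl n) z := by
  filter_upwards [h.isOpen.mem_nhds hx] with y hy
  rw [coords_of_mem h hy, AlgEquiv.commutes]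

include hx in
theorem coords_func (f : V → ℝ) : coords h (fun y ↦ algebraMap ℝ (𝒱.Cl y) (f y)) =ᶠ[𝓝 x]
    fun y ↦ f y • 1 := by
  filter_upwards [h.isOpen.mem_nhds hx] with y hy
  rw [coords_of_mem h hy, frameEquiv_algebraMap]

include hx in
theorem coords_vec (X : ∀ x : V, TangentSpace I x) :
    coords h (fun y ↦ 𝒱.clVec y (X y)) =ᶠ[𝓝 x]
      fun y ↦ ∑ i, 𝒱.gFun (e i) X y • ModelCl.gen i := by
  filter_upwards [h.isOpen.mem_nhds hx] with y hy
  rw [coords_of_mem h hy, frameEquiv_clVec]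
  rfl

include hx in
theorem contMDiffAt_coords {a : ∀ x : V, 𝒱.Cl x} (ha : 𝒱.SmoothCl a) :
    ContMDiffAt I 𝓘(ℝ, ModelCl n) ∞ (coords h a) x := by
  obtain ⟨b, hb, hab⟩ := ha x
  refine ContMDiffAt.congr_of_eventuallyEq ?_ (coords_congr h hab)
  clear hab
  induction hb using Algebra.adjoin_induction with
  | mem b hb =>
    rcases hb with ⟨f, hf, rfl⟩ | ⟨X, hX, rfl⟩
    · exact (hf.contMDiffAt.smul contMDiffAt_const).congr_of_eventuallyEq (coords_func h hx f)
    · refine ContMDiffAt.congr_of_eventuallyEq ?_ (coords_vec h hx X)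
      refine contMDiffAt_finsetSum fun i _ ↦ ?_
      have h1 : ContMDiffAt I 𝓘(ℝ, ModelCl n) ∞ (fun _ ↦ (ModelCl.gen i : ModelCl n)) x :=
        contMDiffAt_const
      exact (𝒱.contMDiffAt_gFun (h.smooth x hx i) (hX x)).smul h1
  | algebraMap z => exact contMDiffAt_const.congr_of_eventuallyEq (coords_const h hx z)
  | add b c hb hc hb' hc' => rw [coords_add]; exact hb'.add hc'
  | mul b c hb hc hb' hc' => rw [coords_mul]; exact contMDiffAt_mul hb' hc'

include hx in
theorem mdifferentiableAt_coords {a : ∀ x : V, 𝒱.Cl x} (ha : 𝒱.SmoothCl a) :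
    MDifferentiableAt I 𝓘(ℝ, ModelCl n) (coords h a) x :=
  (contMDiffAt_coords h hx ha).mdifferentiableAt (by simp)

variable (𝒱) in
/-- The coefficients of the canonical d-connection in the frame `e`. -/
def frameCoeff {ι : Type*} (e : ι → ∀ x : V, TangentSpace I x) (x : V) (ξ : TangentSpace I x)
    (α β : ι) : ℝ :=
  𝒱.g.inner x (𝒱.canonicalD (e β) x ξ) (e α x)

theorem frameCoeff_add {ι : Type*} (e : ι → ∀ x : V, TangentSpace I x) (x : V)
    (ξ η : TangentSpace I x) :
    𝒱.frameCoeff e x (ξ + η) = 𝒱.frameCoeff e x ξ + 𝒱.frameCoeff e x η := by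
  ext; simp [frameCoeff]

theorem frameCoeff_smul {ι : Type*} (e : ι → ∀ x : V, TangentSpace I x) (x : V) (t : ℝ)
    (ξ : TangentSpace I x) : 𝒱.frameCoeff e x (t • ξ) = t • 𝒱.frameCoeff e x ξ := by
  ext; simp [frameCoeff]

theorem frameCoeff_antisymm {ι : Type*} [DecidableEq ι] {e : ι → ∀ x : V, TangentSpace I x}
    (he : ∀ i, DiffAt I E (e i) x)
    (ho : ∀ᶠ y in 𝓝 x, ∀ i j, 𝒱.g.inner y (e i y) (e j y) = if i = j then 1 else 0)
    (ξ : TangentSpace I x) (α β : ι) : 𝒱.frameCoeff e x ξ α β = -𝒱.frameCoeff e x ξ β α := by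
  have h1 := 𝒱.canonicalD_metric (he α) (he β) ξ
  have h2 : 𝒱.gFun (e α) (e β) =ᶠ[𝓝 x] fun _ ↦ if α = β then 1 else 0 := by
    filter_upwards [ho] with y hy using hy α β
  rw [mvfderiv_congr h2, mvfderiv_const] at h1
  simp only [frameCoeff, 𝒱.g.symm x (𝒱.canonicalD (e β) x ξ)]
  simp only [zero_apply] at h1
  linarith

include h hx in
theorem IsOrthonormalFrameOn.frameCoeff_antisymm (ξ : TangentSpace I x) (α β : Fin n) :
    𝒱.frameCoeff e x ξ α β = -𝒱.frameCoeff e x ξ β α :=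
  NAnholonomicManifold.frameCoeff_antisymm (fun i ↦ (h.smooth x hx i).diffAt)
    (mem_of_superset (h.isOpen.mem_nhds hx) fun y hy ↦ h.orthonormal y hy) ξ α β

include h hx in
theorem sum_mvfderiv_add_frameCoeff {R : Type*} [AddCommGroup R] [Module ℝ R]
    {X : ∀ x : V, TangentSpace I x} (hX : DiffAt I E X x) (ξ : TangentSpace I x) (v : Fin n → R) :
    ∑ i, mvfderiv I (𝒱.gFun (e i) X) x ξ • v i +
      ∑ j, 𝒱.gFun (e j) X x • ∑ i, 𝒱.frameCoeff e x ξ i j • v i =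
      ∑ i, 𝒱.g.inner x (e i x) (𝒱.canonicalD X x ξ) • v i := by
  simp only [Finset.smul_sum, smul_smul]
  rw [Finset.sum_comm, ← Finset.sum_add_distrib]
  refine Finset.sum_congr rfl fun i _ ↦ ?_
  rw [← Finset.sum_smul, ← add_smul]
  congr 1
  have h3 := 𝒱.canonicalD_metric (h.smooth x hx i).diffAt hX ξ
  have h4 : 𝒱.g.inner x (𝒱.canonicalD (e i) x ξ) (X x) =
      ∑ j, 𝒱.gFun (e j) X x * 𝒱.frameCoeff e x ξ j i := by
    conv_lhs => rw [← h.sum_eq x hx (X x)]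
    simp [frameCoeff, gFun]
  simp only [IsOrthonormalFrameOn.frameCoeff_antisymm h hx ξ i, mul_neg,
    Finset.sum_neg_distrib]
  rw [h3, h4]
  ring

/-- The extension of the canonical d-connection to `Cl(V)`, in terms of an orthonormal frame. -/
def frameCliffordD (a : ∀ x : V, 𝒱.Cl x) : TangentSpace I x →ₗ[ℝ] 𝒱.Cl x where
  toFun ξ := (frameEquiv h hx).symm (mvfderiv I (coords h a) x ξ +
    (spinGenerator ModelCl.gen (𝒱.frameCoeff e x ξ) * coords h a x -
      coords h a x * spinGenerator ModelCl.gen (𝒱.frameCoeff e x ξ)))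
  map_add' ξ η := by
    rw [← map_add (frameEquiv h hx).symm, frameCoeff_add, spinGenerator_add,
      map_add (mvfderiv I (coords h a) x)]
    congr 1
    noncomm_ring
  map_smul' t ξ := by
    have : ∀ a : ModelCl n, (frameEquiv h hx).symm (t • a) = t • (frameEquiv h hx).symm a :=
      fun a ↦ map_smul ((frameEquiv h hx).symm.restrictScalars ℝ) t a
    rw [RingHom.id_apply, ← this, frameCoeff_smul, spinGenerator_smul, map_smul]
    simp [smul_sub]

theorem isCliffordDerivationAt_frameCliffordD (ξ : TangentSpace I x) :
    IsCliffordDerivationAt 𝒱.canonicalD x ξ (fun a ↦ frameCliffordD h hx a ξ) where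
  congr a b _ _ hab := by
    have h1 := coords_congr h hab
    simp only [frameCliffordD, LinearMap.coe_mk, AddHom.coe_mk]
    rw [mvfderiv_congr h1, h1.self_of_nhds]
  add a b ha hb := by
    simp only [frameCliffordD, LinearMap.coe_mk, AddHom.coe_mk]
    rw [coords_add, mvfderiv_add (mdifferentiableAt_coords h hx ha)
      (mdifferentiableAt_coords h hx hb), ← map_add, add_apply, Pi.add_apply]
    congr 1
    noncomm_ring
  mul a b ha hb := by
    simp only [frameCliffordD, LinearMap.coe_mk, AddHom.coe_mk]
    apply (frameEquiv h hx).injective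
    rw [coords_mul, mvfderiv_mul_apply (mdifferentiableAt_coords h hx ha)
      (mdifferentiableAt_coords h hx hb), Pi.mul_apply]
    simp only [map_add, map_mul, AlgEquiv.apply_symm_apply, ← coords_of_mem]
    noncomm_ring
  const z := by
    simp only [frameCliffordD, LinearMap.coe_mk, AddHom.coe_mk]
    have h1 := coords_const h hx z
    rw [mvfderiv_congr h1, h1.self_of_nhds, mvfderiv_const, Algebra.commutes]
    simp
  func f hf := by
    simp only [frameCliffordD, LinearMap.coe_mk, AddHom.coe_mk]
    have h1 := coords_func h hx f
    apply (frameEquiv h hx).injective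
    have h2 := mvfderiv_smul_const_apply (hf.mdifferentiable (by simp) x) (1 : ModelCl n) ξ
    rw [mvfderiv_congr h1, h1.self_of_nhds, AlgEquiv.apply_symm_apply, frameEquiv_algebraMap, h2]
    simp
  vec X hX := by
    simp only [frameCliffordD, LinearMap.coe_mk, AddHom.coe_mk]
    apply (frameEquiv h hx).injective
    have h1 := coords_vec h hx X
    have h2 := (mvfderiv_sum_smul_const_apply Finset.univ (f := fun i ↦ 𝒱.gFun (e i) X)
      (fun i ↦ 𝒱.mdifferentiableAt_gFun (h.smooth x hx i).diffAt (hX.diffAt x))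
      (ModelCl.gen (n := n)) ξ).2
    rw [mvfderiv_congr h1, h1.self_of_nhds, AlgEquiv.apply_symm_apply, frameEquiv_clVec, h2]
    simp only [Finset.mul_sum, Finset.sum_mul, mul_smul_comm, smul_mul_assoc,
      ← Finset.sum_sub_distrib, ← smul_sub]
    simp only [spinGenerator_commutator ModelCl.gen_anticomm
      (IsOrthonormalFrameOn.frameCoeff_antisymm h hx ξ), Finset.smul_sum, smul_smul]
    simpa only [Finset.smul_sum, smul_smul] using
      sum_mvfderiv_add_frameCoeff h hx (hX.diffAt x) ξ ModelCl.gen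

end frame

end NAnholonomicManifold

namespace NAnholonomicManifold

variable {E : Type*} [NormedAddCommGroup E] [NormedSpace ℝ E] [FiniteDimensional ℝ E]
  {H : Type*} [TopologicalSpace H] {I : ModelWithCorners ℝ E H}
  {V : Type*} [TopologicalSpace V] [ChartedSpace H V] [IsManifold I ∞ V]
  {E' : Type*} [NormedAddCommGroup E'] [NormedSpace ℝ E']
  {H' : Type*} [TopologicalSpace H'] {I' : ModelWithCorners ℝ E' H'}
  {M : Type*} [TopologicalSpace M] [ChartedSpace H' M]
  {𝒱 : NAnholonomicManifold I V I' M}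

section

variable {n : ℕ} {U : Set V} {e : Fin n → ∀ x : V, TangentSpace I x}
  (h : IsOrthonormalFrameOn I E 𝒱.gForm e U) {x : V} (hx : x ∈ U)

include hx in
theorem exists_coords_eventuallyEq_const [T2Space V] (m : ModelCl n) :
    ∃ b ∈ 𝒱.clGen, coords h b =ᶠ[𝓝 x] fun _ ↦ m := by
  induction m using TensorProduct.induction_on with
  | zero => exact ⟨_, const_mem_clGen 0, by simpa using coords_const h hx 0⟩
  | add m m' hm hm' =>
    obtain ⟨b, hb, hb'⟩ := hm
    obtain ⟨c, hc, hc'⟩ := hm'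
    exact ⟨b + c, add_mem hb hc, by rw [coords_add]; exact hb'.add hc'⟩
  | tmul z m =>
    suffices ∃ b ∈ 𝒱.clGen, coords h b =ᶠ[𝓝 x] fun _ ↦ 1 ⊗ₜ m by
      obtain ⟨b, hb, hb'⟩ := this
      refine ⟨_, mul_mem (const_mem_clGen z) hb, ?_⟩
      rw [coords_mul]
      refine ((coords_const h hx z).mul hb').trans (Eventually.of_forall fun y ↦ ?_)
      simp [Algebra.TensorProduct.algebraMap_apply]
    induction m using CliffordAlgebra.induction with
    | algebraMap r =>
      refine ⟨_, const_mem_clGen r, (coords_const h hx r).trans (Eventually.of_forall fun y ↦ ?_)⟩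
      change (r : ℂ) ⊗ₜ[ℝ] (1 : CliffordAlgebra (stdQuad n)) = 1 ⊗ₜ _
      rw [Algebra.algebraMap_eq_smul_one, ← TensorProduct.smul_tmul]
      simp
    | mul m m' hm hm' =>
      obtain ⟨b, hb, hb'⟩ := hm
      obtain ⟨c, hc, hc'⟩ := hm'
      refine ⟨b * c, mul_mem hb hc, ?_⟩
      rw [coords_mul]
      refine (hb'.mul hc').trans (Eventually.of_forall fun y ↦ ?_)
      simp
    | add m m' hm hm' =>
      obtain ⟨b, hb, hb'⟩ := hm
      obtain ⟨c, hc, hc'⟩ := hm'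
      refine ⟨b + c, add_mem hb hc, ?_⟩
      rw [coords_add]
      refine (hb'.add hc').trans (Eventually.of_forall fun y ↦ ?_)
      simp [TensorProduct.tmul_add]
    | ι v =>
      obtain ⟨X, hX, hXe⟩ := exists_smooth_section_eventuallyEq (I := I) (F := E)
        (σ := fun y ↦ ∑ i, v i • e i y) h.isOpen hx fun y hy ↦
          ContMDiffAt.sum_section fun i _ ↦ (h.smooth y hy i).const_smul_section
      refine ⟨_, clVec_mem_clGen hX, (coords_vec h hx X).trans ?_⟩
      filter_upwards [hXe, h.isOpen.mem_nhds hx] with y hy hyU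
      have h1 : ∀ i, 𝒱.gFun (e i) X y = v i := fun i ↦ by
        have := h.orthonormal y hyU i
        simp only [gForm_apply] at this
        simp [gFun, hy, this]
      simp only [h1, ModelCl.gen, ← TensorProduct.tmul_smul, ← map_smul, ← Pi.single_smul,
        smul_eq_mul, mul_one, ← TensorProduct.tmul_sum, ← map_sum, Finset.univ_sum_single]

include hx in
theorem exists_coords_eventuallyEq [T2Space V] {w : V → ModelCl n} {U' : Set V} (hU' : IsOpen U')
    (hx' : x ∈ U') (hw : ∀ y ∈ U', ContMDiffAt I 𝓘(ℝ, ModelCl n) ∞ w y) :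
    ∃ b ∈ 𝒱.clGen, coords h b =ᶠ[𝓝 x] w := by
  let B := Module.finBasis ℝ (ModelCl n)
  have h1 : ∀ k, ∃ f : V → ℝ, ContMDiff I 𝓘(ℝ, ℝ) ∞ f ∧ f =ᶠ[𝓝 x] fun y ↦ B.repr (w y) k := by
    intro k
    let L : ModelCl n →L[ℝ] ℝ := LinearMap.toContinuousLinearMap (B.coord k)
    exact exists_smooth_fun_eventuallyEq hU' hx' fun y hy ↦
      L.contMDiff.contMDiffAt.comp y (hw y hy)
  choose f hf hfw using h1
  choose b hb hbB using fun k ↦ exists_coords_eventuallyEq_const h hx (B k)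
  have h2 : ∀ s : Finset (Fin (Module.finrank ℝ (ModelCl n))), ∃ c ∈ 𝒱.clGen,
      coords h c =ᶠ[𝓝 x] fun y ↦ ∑ k ∈ s, B.repr (w y) k • B k := by
    intro s
    induction s using Finset.induction_on with
    | empty => exact ⟨_, const_mem_clGen 0, by simpa using coords_const h hx 0⟩
    | insert j s hj ih =>
      obtain ⟨c, hc, hc'⟩ := ih
      refine ⟨_, add_mem (mul_mem (func_mem_clGen (hf j)) (hb j)) hc, ?_⟩
      rw [coords_add, coords_mul]
      filter_upwards [coords_func h hx (f j), hbB j, hc', hfw j] with y h3 h4 h5 h6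
      rw [Pi.add_apply, Pi.mul_apply, h3, h4, h5, Finset.sum_insert hj, h6, smul_mul_assoc,
        one_mul]
  obtain ⟨c, hc, hc'⟩ := h2 Finset.univ
  exact ⟨c, hc, by simpa [B.sum_repr] using hc'⟩

end

variable (𝒱) in
/-- The extension of the canonical d-connection to the Clifford bundle. -/
def cliffordD (a : ∀ x : V, 𝒱.Cl x) (x : V) : TangentSpace I x →ₗ[ℝ] 𝒱.Cl x :=
  have h := 𝒱.isSmoothMetric_gForm.exists_orthonormalFrame x
  frameCliffordD h.choose_spec.choose_spec.2 h.choose_spec.choose_spec.1 a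

variable (𝒱) in
theorem isCliffordDerivationAt_cliffordD (x : V) (ξ : TangentSpace I x) :
    IsCliffordDerivationAt 𝒱.canonicalD x ξ (fun a ↦ 𝒱.cliffordD a x ξ) :=
  isCliffordDerivationAt_frameCliffordD _ _ ξ

variable (𝒱) in
theorem isCliffordExtension_cliffordD [T2Space V] :
    𝒱.IsCliffordExtension 𝒱.canonicalD 𝒱.cliffordD where
  smooth a X ha hX x := by
    obtain ⟨U, e, hx, h⟩ := 𝒱.isSmoothMetric_gForm.exists_orthonormalFrame x
    let w : V → ModelCl _ := fun y ↦ mvfderiv I (coords h a) y (X y) +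
      (spinGenerator ModelCl.gen (𝒱.frameCoeff e y (X y)) * coords h a y -
        coords h a y * spinGenerator ModelCl.gen (𝒱.frameCoeff e y (X y)))
    have h1 : ∀ y ∈ U, ContMDiffAt I 𝓘(ℝ, ModelCl (Module.finrank ℝ E)) ∞ w y := by
      intro y hy
      have h2 := contMDiffAt_coords h hy ha
      have h3 : ContMDiffAt I 𝓘(ℝ, ModelCl (Module.finrank ℝ E)) ∞
          (fun y ↦ spinGenerator (ModelCl.gen (n := Module.finrank ℝ E))
            (𝒱.frameCoeff e y (X y))) y := by
        refine ContMDiffAt.neg (ContDiffAt.contMDiffAt (contDiff_const_smul (1 / 4 : ℝ)).contDiffAt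
          |>.comp y (contMDiffAt_finsetSum fun i _ ↦ contMDiffAt_finsetSum fun j _ ↦ ?_))
        have h4 : ContMDiffAt I 𝓘(ℝ, ModelCl (Module.finrank ℝ E)) ∞
          (fun _ ↦ (ModelCl.gen j * ModelCl.gen i : ModelCl (Module.finrank ℝ E))) y :=
            contMDiffAt_const
        exact (𝒱.contMDiffAt_gFun (𝒱.smoothAt_canonicalD (hX y) (h.smooth y hy j))
          (h.smooth y hy i)).smul h4
      exact (SmoothAt.mvfderiv_apply h2 (hX y)).add
        ((contMDiffAt_mul h3 h2).sub (contMDiffAt_mul h2 h3))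
    obtain ⟨b, hb, hbw⟩ := exists_coords_eventuallyEq h hx h.isOpen hx h1
    refine ⟨b, hb, ?_⟩
    filter_upwards [hbw, h.isOpen.mem_nhds hx] with y hy hyU
    rw [(𝒱.isCliffordDerivationAt_cliffordD y (X y)).ext
      (isCliffordDerivationAt_frameCliffordD h hyU (X y)) ha]
    apply (frameEquiv h hyU).injective
    rw [← coords_of_mem h hyU b, hy]
    exact AlgEquiv.apply_symm_apply _ _
  add a b ha hb := by
    ext x ξ
    exact (𝒱.isCliffordDerivationAt_cliffordD x ξ).add a b ha hb
  smul z a ha x ξ := by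
    have h := 𝒱.isCliffordDerivationAt_cliffordD x ξ
    have h1 := h.mul _ a (.of_mem (const_mem_clGen z)) ha
    rw [h.const, zero_mul, zero_add, ← Algebra.smul_def] at h1
    rw [← h1]
    congr 2
    exact funext fun y ↦ Algebra.smul_def z (a y)
  mul a b ha hb x ξ := (𝒱.isCliffordDerivationAt_cliffordD x ξ).mul a b ha hb
  func f hf x ξ := (𝒱.isCliffordDerivationAt_cliffordD x ξ).func f hf
  vec X hX x ξ := (𝒱.isCliffordDerivationAt_cliffordD x ξ).vec X hX

theorem IsCliffordExtension.eq_cliffordD [T2Space V]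
    {𝒟 : (∀ x : V, 𝒱.Cl x) → ∀ x : V, TangentSpace I x →ₗ[ℝ] 𝒱.Cl x}
    (h : 𝒱.IsCliffordExtension 𝒱.canonicalD 𝒟) {a : ∀ x : V, 𝒱.Cl x} (ha : 𝒱.SmoothCl a) :
    𝒟 a = 𝒱.cliffordD a := by
  ext x ξ
  exact (h.isCliffordDerivationAt x ξ).ext (𝒱.isCliffordDerivationAt_cliffordD x ξ) ha

end NAnholonomicManifold

section MetricConnection

variable {E : Type*} [NormedAddCommGroup E] [NormedSpace ℝ E] [FiniteDimensional ℝ E]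
  {H : Type*} [TopologicalSpace H] {I : ModelWithCorners ℝ E H}
  {V : Type*} [TopologicalSpace V] [ChartedSpace H V] [IsManifold I ∞ V]
  {F : Type*} [NormedAddCommGroup F] [NormedSpace ℝ F]
  {W : V → Type*} [TopologicalSpace (TotalSpace F W)]
  [∀ x, AddCommGroup (W x)] [∀ x, Module ℝ (W x)] [∀ x, TopologicalSpace (W x)]
  [∀ x, IsTopologicalAddGroup (W x)] [∀ x, ContinuousSMul ℝ (W x)]
  [FiberBundle F W] [VectorBundle ℝ F W] [ContMDiffVectorBundle ∞ F W I]

variable (I F) in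
/-- `nab` is a smooth metric connection on the restriction of `W` to the open set `U`. -/
structure IsMetricConnectionOn (g : ∀ x, LinearMap.BilinForm ℝ (W x)) (U : Set V)
    (nab : (∀ x, W x) → ∀ x, TangentSpace I x →L[ℝ] W x) : Prop where
  add : ∀ {x σ τ}, x ∈ U → DiffAt I F σ x → DiffAt I F τ x →
    nab (σ + τ) x = nab σ x + nab τ x
  leibniz : ∀ {x σ} {f : V → ℝ}, x ∈ U → MDifferentiableAt I 𝓘(ℝ, ℝ) f x → DiffAt I F σ x →
    nab (f • σ) x = f x • nab σ x + (mvfderiv I f x).smulRight (σ x)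
  congr : ∀ {x σ τ}, x ∈ U → (∀ᶠ y in 𝓝 x, σ y = τ y) → nab σ x = nab τ x
  smooth : ∀ {x σ} {X : ∀ x : V, TangentSpace I x}, x ∈ U → SmoothAt I F σ x →
    SmoothAt I E X x → SmoothAt I F (fun y ↦ nab σ y (X y)) x
  metric : ∀ {x σ τ}, x ∈ U → DiffAt I F σ x → DiffAt I F τ x → ∀ ξ,
    mvfderiv I (fun y ↦ g y (σ y) (τ y)) x ξ = g x (nab σ x ξ) (τ x) + g x (σ x) (nab τ x ξ)

theorem DiffAt.add {σ τ : ∀ x, W x} {x : V} (hσ : DiffAt I F σ x) (hτ : DiffAt I F τ x) :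
    DiffAt I F (σ + τ) x :=
  mdifferentiableAt_add_section hσ hτ

theorem DiffAt.smul {σ : ∀ x, W x} {f : V → ℝ} {x : V} (hf : MDifferentiableAt I 𝓘(ℝ, ℝ) f x)
    (hσ : DiffAt I F σ x) : DiffAt I F (f • σ) x :=
  hf.smul_section hσ

theorem IsMetricConnectionOn.const_smul {g : ∀ x, LinearMap.BilinForm ℝ (W x)} {U : Set V}
    {nab : (∀ x, W x) → ∀ x, TangentSpace I x →L[ℝ] W x} (h : IsMetricConnectionOn I F g U nab)
    {x : V} {σ : ∀ x, W x} (hx : x ∈ U) (hσ : DiffAt I F σ x) (c : ℝ) :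
    nab (fun y ↦ c • σ y) x = c • nab σ x := by
  have := h.leibniz (f := fun _ ↦ c) hx mdifferentiableAt_const hσ
  rw [mvfderiv_const] at this
  refine this.trans ?_
  ext; simp

variable (I F) in
/-- The section `A` of `End(W)` is parallel for the connection `nab` on `U`. -/
def IsParallelOn (U : Set V) (nab : (∀ x, W x) → ∀ x, TangentSpace I x →L[ℝ] W x)
    (A : ∀ x, W x →L[ℝ] W x) : Prop :=
  ∀ x ∈ U, ∀ σ, DiffAt I F σ x → ∀ ξ, nab (fun y ↦ A y (σ y)) x ξ = A x (nab σ x ξ)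

variable (I F) in
/-- `A` is a smooth field of isometries with `A² = ± 1` on `U`. -/
structure IsIsometryOn (g : ∀ x, LinearMap.BilinForm ℝ (W x)) (U : Set V)
    (A : ∀ x, W x →L[ℝ] W x) : Prop where
  smooth : ∀ x ∈ U, ContMDiffAt I (I.prod 𝓘(ℝ, F →L[ℝ] F)) ∞
    (fun x ↦ TotalSpace.mk' (F →L[ℝ] F) (E := fun x : V ↦ W x →L[ℝ] W x) x (A x)) x
  sq : ∃ s : ℝ, s * s = 1 ∧ ∀ x ∈ U, ∀ v, A x (A x v) = s • v
  isometry : ∀ x ∈ U, ∀ v w, g x (A x v) (A x w) = g x v w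

variable {g : ∀ x, LinearMap.BilinForm ℝ (W x)} {U : Set V}
  {nab : (∀ x, W x) → ∀ x, TangentSpace I x →L[ℝ] W x} {A B : ∀ x, W x →L[ℝ] W x}

theorem IsIsometryOn.smoothAt (hA : IsIsometryOn I F g U A) {x : V} (hx : x ∈ U)
    {σ : ∀ x, W x} (hσ : SmoothAt I F σ x) : SmoothAt I F (fun y ↦ A y (σ y)) x :=
  ContMDiffAt.clm_bundle_apply (hA.smooth x hx) hσ

theorem IsIsometryOn.diffAt (hA : IsIsometryOn I F g U A) {x : V} (hx : x ∈ U)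
    {σ : ∀ x, W x} (hσ : DiffAt I F σ x) : DiffAt I F (fun y ↦ A y (σ y)) x :=
  MDifferentiableAt.clm_bundle_apply ((hA.smooth x hx).mdifferentiableAt (by simp)) hσ

/-- A metric connection can be averaged over an isometry so that the isometry becomes parallel;
the operators which commute with it up to sign remain parallel. -/
theorem IsMetricConnectionOn.exists_parallel (hU : IsOpen U)
    (h : IsMetricConnectionOn I F g U nab) (hA : IsIsometryOn I F g U A) :
    ∃ nab' : (∀ x, W x) → ∀ x, TangentSpace I x →L[ℝ] W x,
      IsMetricConnectionOn I F g U nab' ∧ IsParallelOn I F U nab' A ∧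
      ∀ B, IsIsometryOn I F g U B → IsParallelOn I F U nab B →
        (∃ s : ℝ, s * s = 1 ∧ ∀ x ∈ U, ∀ v, A x (B x v) = s • B x (A x v)) →
        IsParallelOn I F U nab' B := by
  obtain ⟨s, hs, hsq⟩ := hA.sq
  refine ⟨fun σ x ↦ (1 / 2 : ℝ) • (nab σ x + s • A x ∘L nab (fun y ↦ A y (σ y)) x), ?_, ?_, ?_⟩
  · constructor
    · intro x σ τ hx hσ hτ
      have h1 : (fun y ↦ A y ((σ + τ) y)) = (fun y ↦ A y (σ y)) + fun y ↦ A y (τ y) := by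
        ext; simp
      ext ξ
      simp only [h1, h.add hx hσ hτ, h.add hx (hA.diffAt hx hσ) (hA.diffAt hx hτ), smul_apply,
        add_apply, ContinuousLinearMap.comp_apply, map_add, smul_add]
      abel
    · intro x σ f hx hf hσ
      have h1 : (fun y ↦ A y ((f • σ) y)) = f • fun y ↦ A y (σ y) := by
        ext; simp
      ext ξ
      simp only [h1, h.leibniz hx hf hσ, h.leibniz hx hf (hA.diffAt hx hσ), smul_apply,
        add_apply, ContinuousLinearMap.comp_apply, map_add, map_smul,
        ContinuousLinearMap.smulRight_apply, hsq x hx]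
      match_scalars <;> first | ring1 | linear_combination (mvfderiv I f x ξ) / 2 * hs
    · intro x σ τ hx hστ
      have h1 : ∀ᶠ y in 𝓝 x, A y (σ y) = A y (τ y) := hστ.mono fun y hy ↦ by rw [hy]
      simp only [h.congr hx hστ, h.congr hx h1]
    · intro x σ X hx hσ hX
      exact ((h.smooth hx hσ hX).add_section
        (hA.smoothAt hx (h.smooth hx (hA.smoothAt hx hσ) hX)).const_smul_section).const_smul_section
    · intro x σ τ hx hσ hτ ξ
      have h1 := h.metric hx hσ hτ ξ
      have h2 := h.metric hx (hA.diffAt hx hσ) (hA.diffAt hx hτ) ξ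
      have h3 : (fun y ↦ g y (A y (σ y)) (A y (τ y))) =ᶠ[𝓝 x] fun y ↦ g y (σ y) (τ y) := by
        filter_upwards [hU.mem_nhds hx] with y hy using hA.isometry y hy _ _
      rw [mvfderiv_congr h3] at h2
      have h4 := hA.isometry x hx (nab (fun y ↦ A y (σ y)) x ξ) (A x (τ x))
      have h5 := hA.isometry x hx (A x (σ x)) (nab (fun y ↦ A y (τ y)) x ξ)
      simp only [hsq x hx, map_smul, LinearMap.smul_apply, smul_eq_mul] at h4 h5
      simp only [smul_apply, add_apply, ContinuousLinearMap.comp_apply, map_smul, map_add,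
        LinearMap.smul_apply, LinearMap.add_apply, smul_eq_mul]
      linear_combination h1 / 2 + h2 / 2 - h4 / 2 - h5 / 2
  · intro x hx σ hσ ξ
    have h1 : ∀ᶠ y in 𝓝 x, A y (A y (σ y)) = s • σ y := by
      filter_upwards [hU.mem_nhds hx] with y hy using hsq y hy _
    simp only [h.congr hx h1, h.const_smul hx hσ, smul_apply, add_apply,
      ContinuousLinearMap.comp_apply, map_smul, map_add, hsq x hx, smul_smul, hs, one_smul]
    rw [add_comm]
  · rintro B hB hpar ⟨t, ht, hcomm⟩ x hx σ hσ ξ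
    have h1 : ∀ᶠ y in 𝓝 x, A y (B y (σ y)) = t • B y (A y (σ y)) := by
      filter_upwards [hU.mem_nhds hx] with y hy using hcomm y hy _
    have h2 := hpar x hx _ (hA.diffAt hx hσ) ξ
    simp only [h.congr hx h1, h.const_smul hx (hB.diffAt hx (hA.diffAt hx hσ)), smul_apply,
      add_apply, ContinuousLinearMap.comp_apply, map_smul, map_add, hpar x hx σ hσ, h2,
      hcomm x hx, smul_smul]
    rw [ht, mul_one]

theorem IsMetricConnectionOn.exists_forall_parallel (hU : IsOpen U)
    (h : IsMetricConnectionOn I F g U nab) {κ : Type*} (A : κ → ∀ x, W x →L[ℝ] W x)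
    (hA : ∀ k, IsIsometryOn I F g U (A k))
    (hcomm : ∀ k l, ∃ s : ℝ, s * s = 1 ∧ ∀ x ∈ U, ∀ v, A k x (A l x v) = s • A l x (A k x v))
    (t : Finset κ) :
    ∃ nab' : (∀ x, W x) → ∀ x, TangentSpace I x →L[ℝ] W x,
      IsMetricConnectionOn I F g U nab' ∧ ∀ k ∈ t, IsParallelOn I F U nab' (A k) := by
  classical
  induction t using Finset.induction_on with
  | empty => exact ⟨nab, h, by simp⟩
  | insert k t hk ih =>
    obtain ⟨nab', h1, h2⟩ := ih
    obtain ⟨nab'', h3, h4, h5⟩ := h1.exists_parallel hU (hA k)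
    refine ⟨nab'', h3, fun l hl ↦ ?_⟩
    rcases Finset.mem_insert.1 hl with rfl | hl
    · exact h4
    · exact h5 _ (hA l) (h2 l hl) (hcomm k l)

/-- The flat connection for which an orthonormal frame is parallel. -/
theorem IsOrthonormalFrameOn.exists_metricConnection (hg : IsSmoothMetric I F g) {ι : Type*}
    [Fintype ι] [DecidableEq ι] {s : ι → ∀ x, W x} (hs : IsOrthonormalFrameOn I F g s U) :
    ∃ nab : (∀ x, W x) → ∀ x, TangentSpace I x →L[ℝ] W x, IsMetricConnectionOn I F g U nab := by
  have hd : ∀ {x σ} (i), x ∈ U → DiffAt I F σ x →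
      MDifferentiableAt I 𝓘(ℝ, ℝ) (fun y ↦ g y (s i y) (σ y)) x :=
    fun i hx hσ ↦ hg.diff (hs.smooth _ hx i).diffAt hσ
  refine ⟨fun σ x ↦ ∑ i, (mvfderiv I (fun y ↦ g y (s i y) (σ y)) x).smulRight (s i x), ?_⟩
  constructor
  · intro x σ τ hx hσ hτ
    rw [← Finset.sum_add_distrib]
    refine Finset.sum_congr rfl fun i _ ↦ ?_
    have h1 := mvfderiv_add (hd i hx hσ) (hd i hx hτ)
    have h2 : (fun y ↦ g y (s i y) ((σ + τ) y)) =
        (fun y ↦ g y (s i y) (σ y)) + fun y ↦ g y (s i y) (τ y) := by ext; simp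
    ext ξ
    rw [h2, h1]
    simp [add_smul]
  · intro x σ f hx hf hσ
    have h0 := hs.sum_eq x hx (σ x)
    ext ξ
    have h1 : ∀ i, mvfderiv I (fun y ↦ g y (s i y) ((f • σ) y)) x ξ =
        f x * mvfderiv I (fun y ↦ g y (s i y) (σ y)) x ξ +
          mvfderiv I f x ξ * g x (s i x) (σ x) := by
      intro i
      have h2 : (fun y ↦ g y (s i y) ((f • σ) y)) = f * fun y ↦ g y (s i y) (σ y) := by ext; simp
      rw [h2, mvfderiv_mul hf (hd i hx hσ)]
      simp [mul_comm]
    simp only [sum_apply, ContinuousLinearMap.smulRight_apply, add_apply, smul_apply, h1]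
    conv_rhs => rw [← h0]
    simp only [add_smul, Finset.sum_add_distrib, mul_smul, Finset.smul_sum]
  · intro x σ τ hx hστ
    refine Finset.sum_congr rfl fun i _ ↦ ?_
    rw [mvfderiv_congr (hστ.mono fun y hy ↦ by rw [hy])]
  · intro x σ X hx hσ hX
    have h1 : SmoothAt I F (fun y ↦ ∑ i, mvfderiv I (fun y ↦ g y (s i y) (σ y)) y (X y) • s i y)
        x := ContMDiffAt.sum_section fun i _ ↦
      (SmoothAt.mvfderiv_apply (hg.smooth (hs.smooth x hx i) hσ) hX).smul_section
        (hs.smooth x hx i)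
    simpa using! h1
  · intro x σ τ hx hσ hτ ξ
    have h1 : (fun y ↦ g y (σ y) (τ y)) =ᶠ[𝓝 x]
        fun y ↦ ∑ i, (g y (s i y) (σ y) * g y (s i y) (τ y)) • (1 : ℝ) := by
      filter_upwards [hs.isOpen.mem_nhds hx] with y hy
      conv_lhs => rw [← hs.sum_eq y hy (σ y)]
      simp
    have h2 := (mvfderiv_sum_smul_const_apply (I := I) Finset.univ
      (f := fun i y ↦ g y (s i y) (σ y) * g y (s i y) (τ y))
      (fun i ↦ (hd i hx hσ).mul (hd i hx hτ)) (fun _ ↦ (1 : ℝ)) ξ).2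
    have h3 : ∀ i, mvfderiv I (fun y ↦ g y (s i y) (σ y) * g y (s i y) (τ y)) x ξ =
        g x (s i x) (σ x) * mvfderiv I (fun y ↦ g y (s i y) (τ y)) x ξ +
          mvfderiv I (fun y ↦ g y (s i y) (σ y)) x ξ * g x (s i x) (τ x) :=
      fun i ↦ mvfderiv_mul_apply (hd i hx hσ) (hd i hx hτ) ξ
    rw [mvfderiv_congr h1, h2]
    simp only [h3, smul_eq_mul, mul_one, sum_apply, ContinuousLinearMap.smulRight_apply, map_sum,
      LinearMap.sum_apply, map_smul, LinearMap.smul_apply, hg.symm x (σ x),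
      Finset.sum_add_distrib]
    rw [add_comm]
    congr 1
    exact Finset.sum_congr rfl fun i _ ↦ mul_comm _ _

end MetricConnection

namespace SpinStructure

variable {E : Type*} [NormedAddCommGroup E] [NormedSpace ℝ E] [FiniteDimensional ℝ E]
  {H : Type*} [TopologicalSpace H] {I : ModelWithCorners ℝ E H}
  {V : Type*} [TopologicalSpace V] [ChartedSpace H V] [IsManifold I ∞ V]
  {E' : Type*} [NormedAddCommGroup E'] [NormedSpace ℝ E']
  {H' : Type*} [TopologicalSpace H'] {I' : ModelWithCorners ℝ E' H'}
  {M : Type*} [TopologicalSpace M] [ChartedSpace H' M]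
  {𝒱 : NAnholonomicManifold I V I' M}
  {F : Type*} [NormedAddCommGroup F] [NormedSpace ℝ F]
  {Sp : V → Type*} [TopologicalSpace (TotalSpace F Sp)]
  [∀ x, AddCommGroup (Sp x)] [∀ x, Module ℂ (Sp x)] [∀ x, TopologicalSpace (Sp x)]
  [∀ x, IsTopologicalAddGroup (Sp x)] [∀ x, ContinuousSMul ℝ (Sp x)]
  [FiberBundle F Sp] [VectorBundle ℝ F Sp]
  (𝒮 : SpinStructure 𝒱 F Sp)

section fibre

variable {x : V}

theorem herm_smul_left (z : ℂ) (φ ψ : Sp x) :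
    𝒮.herm x (z • φ) ψ = conj z * 𝒮.herm x φ ψ := by
  rw [𝒮.herm_symm x ψ (z • φ), 𝒮.herm_smul, map_mul, ← 𝒮.herm_symm]

/-- The real part of the spinor inner product. -/
def reForm (x : V) : LinearMap.BilinForm ℝ (Sp x) :=
  LinearMap.mk₂ ℝ (fun φ ψ ↦ (𝒮.herm x φ ψ).re) (by simp) (by simp) (by simp) (by simp)

theorem reForm_apply (φ ψ : Sp x) : 𝒮.reForm x φ ψ = (𝒮.herm x φ ψ).re := rfl

theorem reForm_I_smul (φ ψ : Sp x) : 𝒮.reForm x φ (Complex.I • ψ) = -(𝒮.herm x φ ψ).im := by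
  rw [reForm_apply, 𝒮.herm_smul]
  simp

theorem isSmoothMetric_reForm : IsSmoothMetric I F 𝒮.reForm where
  smooth hσ hτ := Complex.reCLM.contMDiff.contMDiffAt.comp _
    (SmoothAt.bilin (𝒮.herm_smooth _) hσ hτ)
  diff hσ hτ := Complex.reCLM.mdifferentiableAt.comp _ (DiffAt.bilin (𝒮.herm_smooth _) hσ hτ)
  symm x φ ψ := by simp [reForm_apply, 𝒮.herm_symm x ψ φ]
  pos x ψ hψ := 𝒮.herm_pos x ψ hψ

theorem γ_sq (ξ : TangentSpace I x) (ψ : Sp x) :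
    𝒮.γ x ξ (𝒮.γ x ξ ψ) = 𝒱.g.inner x ξ ξ • ψ := by
  have h := 𝒮.γ_anticomm x ξ ξ ψ
  rw [← two_smul ℝ, mul_smul] at h
  exact smul_right_injective (Sp x) (two_ne_zero (α := ℝ)) h

variable [FiniteDimensional ℝ F]

include 𝒱 𝒮 F in
theorem finiteDimensional_fibre (x : V) : FiniteDimensional ℂ (Sp x) :=
  have := VectorBundle.finiteDimensional ℝ F Sp x
  Module.Finite.of_restrictScalars_finite ℝ ℂ (Sp x)

/-- Schur's lemma for the irreducible Clifford module `Sp_x`. -/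
theorem exists_eq_smul (T : Sp x →ₗ[ℂ] Sp x) (hT : ∀ ξ ψ, T (𝒮.γ x ξ ψ) = 𝒮.γ x ξ (T ψ)) :
    ∃ μ : ℂ, ∀ ψ, T ψ = μ • ψ := by
  have := 𝒮.finiteDimensional_fibre x
  have := 𝒮.nontrivial x
  obtain ⟨μ, hμ⟩ := Module.End.exists_eigenvalue T
  refine ⟨μ, fun ψ ↦ ?_⟩
  rcases 𝒮.irreducible x (Module.End.eigenspace T μ) fun ξ ψ hψ ↦ by
    rw [Module.End.mem_eigenspace_iff] at hψ ⊢
    rw [hT, hψ, 𝒮.γ_complex] with h | h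
  · exact absurd h hμ
  · have : ψ ∈ Module.End.eigenspace T μ := by rw [h]; trivial
    exact Module.End.mem_eigenspace_iff.1 this

theorem eq_zero_of_commutes (T : Sp x →ₗ[ℝ] Sp x)
    (hI : ∀ ψ, T (Complex.I • ψ) = Complex.I • T ψ)
    (hγ : ∀ ξ ψ, T (𝒮.γ x ξ ψ) = 𝒮.γ x ξ (T ψ)) (hJ : ∀ ψ, T (𝒮.J x ψ) = 𝒮.J x (T ψ))
    (hh : ∀ ψ φ, 𝒮.herm x (T ψ) φ + 𝒮.herm x ψ (T φ) = 0) (ψ : Sp x) : T ψ = 0 := by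
  let T' : Sp x →ₗ[ℂ] Sp x :=
    { toFun := T
      map_add' := T.map_add
      map_smul' := fun z φ ↦ by
        have h1 : ∀ (w : Sp x), z • w = z.re • w + z.im • (Complex.I • w) := fun w ↦ by
          conv_lhs => rw [← Complex.re_add_im z]
          rw [add_smul, mul_smul, Complex.coe_smul, Complex.coe_smul]
        rw [RingHom.id_apply, h1, map_add, map_smul, map_smul, hI, ← h1] }
  obtain ⟨μ, hμ⟩ := 𝒮.exists_eq_smul T' hγ
  replace hμ : ∀ ψ, T ψ = μ • ψ := hμ
  have := 𝒮.nontrivial x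
  obtain ⟨φ, hφ⟩ := exists_ne (0 : Sp x)
  have h1 := hh φ φ
  rw [hμ, 𝒮.herm_smul, herm_smul_left, ← add_mul] at h1
  have h2 : 𝒮.herm x φ φ ≠ 0 := fun h ↦ by
    have := 𝒮.herm_pos x φ hφ
    rw [h] at this
    exact lt_irrefl _ this
  have h3 := (mul_eq_zero.1 h1).resolve_right h2
  have h4 := hJ φ
  rw [hμ, hμ, 𝒮.J_antilinear] at h4
  have h5 : 𝒮.J x φ ≠ 0 := fun h ↦ hφ ((𝒮.J_bijective x).1 (h.trans (map_zero _).symm))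
  have h6 : μ = conj μ := smul_left_injective ℂ h5 h4
  rw [← h6, ← two_mul] at h3
  rw [hμ, (mul_eq_zero.1 h3).resolve_left two_ne_zero, zero_smul]

theorem ε_mul_self : 𝒮.ε * 𝒮.ε = 1 := by
  rcases 𝒮.ε_sign with h | h <;> simp [h]

theorem exists_J_sq (x : V) : ∃ s : ℝ, (s = 1 ∨ s = -1) ∧ ∀ ψ, 𝒮.J x (𝒮.J x ψ) = s • ψ := by
  let T : Sp x →ₗ[ℂ] Sp x :=
    { toFun := fun ψ ↦ 𝒮.J x (𝒮.J x ψ)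
      map_add' := by simp
      map_smul' := fun z φ ↦ by simp [𝒮.J_antilinear] }
  obtain ⟨μ, hμ⟩ := 𝒮.exists_eq_smul T fun ξ ψ ↦ by
    simp only [T, LinearMap.coe_mk, AddHom.coe_mk, 𝒮.J_γ, map_smul, smul_smul, 𝒮.ε_mul_self,
      one_smul]
  replace hμ : ∀ ψ, 𝒮.J x (𝒮.J x ψ) = μ • ψ := hμ
  have := 𝒮.nontrivial x
  obtain ⟨φ, hφ⟩ := exists_ne (0 : Sp x)
  have h5 : 𝒮.J x φ ≠ 0 := fun h ↦ hφ ((𝒮.J_bijective x).1 (h.trans (map_zero _).symm))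
  have h4 := hμ (𝒮.J x φ)
  rw [hμ φ, 𝒮.J_antilinear] at h4
  have h6 : conj μ = μ := smul_left_injective ℂ h5 h4
  obtain ⟨s, rfl⟩ := Complex.conj_eq_iff_real.1 h6
  refine ⟨s, ?_, fun ψ ↦ by rw [hμ, Complex.coe_smul]⟩
  have h7 := 𝒮.J_herm x (𝒮.J x φ) (𝒮.J x φ)
  rw [hμ, 𝒮.J_herm, 𝒮.herm_smul, herm_smul_left, Complex.conj_ofReal, ← mul_assoc] at h7
  have h2 : 𝒮.herm x φ φ ≠ 0 := fun h ↦ by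
    have := 𝒮.herm_pos x φ hφ
    rw [h] at this
    exact lt_irrefl _ this
  have h8 := mul_right_cancel₀ h2 (h7.trans (one_mul _).symm)
  exact mul_self_eq_one_iff.1 (by exact_mod_cast h8)

end fibre

section local_

variable [FiniteDimensional ℝ F] [ContMDiffVectorBundle ∞ F Sp I]

variable {𝒮} in
theorem _root_.NSpin.SmoothAt.J {ψ : ∀ x, Sp x} {x : V} (hψ : SmoothAt I F ψ x) :
    SmoothAt I F (fun y ↦ 𝒮.J y (ψ y)) x :=
  ContMDiffAt.clm_bundle_apply (𝒮.J_smooth x) hψ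

theorem exists_nhds_J_sq [T2Space V] (x : V) : ∃ U : Set V, IsOpen U ∧ x ∈ U ∧
    ∃ s : ℝ, s * s = 1 ∧ ∀ y ∈ U, ∀ ψ, 𝒮.J y (𝒮.J y ψ) = s • ψ := by
  obtain ⟨s, hs, hsx⟩ := 𝒮.exists_J_sq x
  have := 𝒮.nontrivial x
  obtain ⟨φ, hφ⟩ := exists_ne (0 : Sp x)
  obtain ⟨ψ, hψ, rfl⟩ := exists_smooth_section_apply_eq (I := I) (F := F) φ
  let f : V → ℝ := fun y ↦ s * 𝒮.reForm y (ψ y) (𝒮.J y (𝒮.J y (ψ y)))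
  have hf : Continuous f := continuous_iff_continuousAt.2 fun y ↦
    (continuous_const.mul continuous_id).continuousAt.comp
      (𝒮.isSmoothMetric_reForm.smooth (hψ y) ((hψ y).J (𝒮 := 𝒮)).J).continuousAt
  have hs2 : s * s = 1 := by rcases hs with rfl | rfl <;> simp
  refine ⟨{y | 0 < f y}, isOpen_lt continuous_const hf, ?_, s, hs2, fun y hy ↦ ?_⟩
  · simp only [mem_ofPred_eq, f, hsx, map_smul, smul_eq_mul, ← mul_assoc, hs2, one_mul]
    exact 𝒮.herm_pos x _ hφ
  · obtain ⟨t, ht, hty⟩ := 𝒮.exists_J_sq y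
    simp only [mem_ofPred_eq, f, hty, map_smul, smul_eq_mul] at hy
    suffices t = s by rwa [← this]
    have h1 : 0 ≤ 𝒮.reForm y (ψ y) (ψ y) := by
      by_cases h0 : ψ y = 0
      · simp [h0]
      · exact (𝒮.herm_pos y _ h0).le
    rcases hs with rfl | rfl <;> rcases ht with rfl | rfl <;> first | rfl | (exfalso; linarith)

end local_

end SpinStructure

theorem mvfderiv_clm_apply {E : Type*} [NormedAddCommGroup E] [NormedSpace ℝ E]
    {H : Type*} [TopologicalSpace H] {I : ModelWithCorners ℝ E H}
    {V : Type*} [TopologicalSpace V] [ChartedSpace H V] {A B : Type*} [NormedAddCommGroup A]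
    [NormedSpace ℝ A] [NormedAddCommGroup B] [NormedSpace ℝ B] (L : A →L[ℝ] B) {f : V → A} {x : V}
    (hf : MDifferentiableAt I 𝓘(ℝ, A) f x) (ξ : TangentSpace I x) :
    mvfderiv I (fun y ↦ L (f y)) x ξ = L (mvfderiv I f x ξ) := by
  have h := mfderiv_comp x (L.mdifferentiableAt (x := f x)) hf
  rw [ContinuousLinearMap.mfderiv_eq] at h
  exact congrArg (fun l : E →L[ℝ] B ↦ l ξ) h

theorem IsMetricConnectionOn.sum_smul {E : Type*} [NormedAddCommGroup E] [NormedSpace ℝ E]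
    [FiniteDimensional ℝ E]
    {H : Type*} [TopologicalSpace H] {I : ModelWithCorners ℝ E H}
    {V : Type*} [TopologicalSpace V] [ChartedSpace H V] [IsManifold I ∞ V]
    {F : Type*} [NormedAddCommGroup F] [NormedSpace ℝ F]
    {W : V → Type*} [TopologicalSpace (TotalSpace F W)]
    [∀ x, AddCommGroup (W x)] [∀ x, Module ℝ (W x)] [∀ x, TopologicalSpace (W x)]
    [∀ x, IsTopologicalAddGroup (W x)] [∀ x, ContinuousSMul ℝ (W x)]
    [FiberBundle F W] [VectorBundle ℝ F W] [ContMDiffVectorBundle ∞ F W I]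
    {g : ∀ x, LinearMap.BilinForm ℝ (W x)} {U : Set V}
    {nab : (∀ x, W x) → ∀ x, TangentSpace I x →L[ℝ] W x} (h : IsMetricConnectionOn I F g U nab)
    {x : V} (hx : x ∈ U) {ι : Type*} (s : Finset ι) {f : ι → V → ℝ} {σ : ι → ∀ x, W x}
    (hf : ∀ i, MDifferentiableAt I 𝓘(ℝ, ℝ) (f i) x) (hσ : ∀ i, DiffAt I F (σ i) x)
    (ξ : TangentSpace I x) :
    DiffAt I F (fun y ↦ ∑ i ∈ s, f i y • σ i y) x ∧
    nab (fun y ↦ ∑ i ∈ s, f i y • σ i y) x ξ =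
      ∑ i ∈ s, (f i x • nab (σ i) x ξ + mvfderiv I (f i) x ξ • σ i x) := by
  classical
  induction s using Finset.induction_on with
  | empty =>
    have h0 : DiffAt I F (fun y ↦ (0 : W y)) x :=
      (contMDiff_zeroSection ℝ W x).mdifferentiableAt one_ne_zero
    have h1 := h.const_smul hx h0 0
    simp only [Finset.sum_empty]
    refine ⟨h0, ?_⟩
    simpa using congrArg (fun l : TangentSpace I x →L[ℝ] W x ↦ l ξ) h1
  | insert j s hj ih =>
    simp only [Finset.sum_insert hj]
    have h1 := DiffAt.smul (hf j) (hσ j)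
    refine ⟨h1.add ih.1, ?_⟩
    have h2 := congrArg (fun l : TangentSpace I x →L[ℝ] W x ↦ l ξ) (h.add hx h1 ih.1)
    have h3 := congrArg (fun l : TangentSpace I x →L[ℝ] W x ↦ l ξ) (h.leibniz hx (hf j) (hσ j))
    rw [← ih.2]
    refine h2.trans ?_
    simp only [add_apply, h3, smul_apply, ContinuousLinearMap.smulRight_apply]

namespace SpinStructure

variable {E : Type*} [NormedAddCommGroup E] [NormedSpace ℝ E] [FiniteDimensional ℝ E]
  {H : Type*} [TopologicalSpace H] {I : ModelWithCorners ℝ E H}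
  {V : Type*} [TopologicalSpace V] [ChartedSpace H V] [IsManifold I ∞ V]
  {E' : Type*} [NormedAddCommGroup E'] [NormedSpace ℝ E']
  {H' : Type*} [TopologicalSpace H'] {I' : ModelWithCorners ℝ E' H'}
  {M : Type*} [TopologicalSpace M] [ChartedSpace H' M]
  {𝒱 : NAnholonomicManifold I V I' M}
  {F : Type*} [NormedAddCommGroup F] [NormedSpace ℝ F] [FiniteDimensional ℝ F]
  {Sp : V → Type*} [TopologicalSpace (TotalSpace F Sp)]
  [∀ x, AddCommGroup (Sp x)] [∀ x, Module ℂ (Sp x)] [∀ x, TopologicalSpace (Sp x)]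
  [∀ x, IsTopologicalAddGroup (Sp x)] [∀ x, ContinuousSMul ℝ (Sp x)]
  [FiberBundle F Sp] [VectorBundle ℝ F Sp] [ContMDiffVectorBundle ∞ F Sp I]
  (𝒮 : SpinStructure 𝒱 F Sp)

theorem smoothAt_γ {X : ∀ x : V, TangentSpace I x} {ψ : ∀ x, Sp x} {x : V}
    (hX : SmoothAt I E X x) (hψ : SmoothAt I F ψ x) :
    SmoothAt I F (fun y ↦ 𝒮.γ y (X y) (ψ y)) x :=
  ContMDiffAt.clm_bundle_apply₂ (F₁ := E) (F₂ := F) (𝒮.γ_smooth x) hX hψ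

theorem diffAt_γ {X : ∀ x : V, TangentSpace I x} {ψ : ∀ x, Sp x} {x : V}
    (hX : DiffAt I E X x) (hψ : DiffAt I F ψ x) :
    DiffAt I F (fun y ↦ 𝒮.γ y (X y) (ψ y)) x :=
  MDifferentiableAt.clm_bundle_apply₂ (F₁ := E) (F₂ := F)
    ((𝒮.γ_smooth x).mdifferentiableAt (by simp)) hX hψ

/-- Near every point there is a metric connection on `Sp` for which the complex structure, the
charge conjugation and the Clifford action of an orthonormal frame are parallel. -/
theorem exists_parallelConnection [T2Space V] (x : V) :
    ∃ (U : Set V) (e : Fin (Module.finrank ℝ E) → ∀ x : V, TangentSpace I x)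
      (nab : (∀ x, Sp x) → ∀ x, TangentSpace I x →L[ℝ] Sp x), x ∈ U ∧
      IsOrthonormalFrameOn I E 𝒱.gForm e U ∧ IsMetricConnectionOn I F 𝒮.reForm U nab ∧
      IsParallelOn I F U nab 𝒮.cplx ∧ IsParallelOn I F U nab 𝒮.J ∧
      ∀ i, IsParallelOn I F U nab (fun y ↦ 𝒮.γ y (e i y)) := by
  obtain ⟨U₁, e, hx₁, he⟩ := 𝒱.isSmoothMetric_gForm.exists_orthonormalFrame x
  obtain ⟨U₂, s, hx₂, hs⟩ := 𝒮.isSmoothMetric_reForm.exists_orthonormalFrame x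
  obtain ⟨U₃, hU₃, hx₃, t, ht, hJ⟩ := 𝒮.exists_nhds_J_sq x
  let U := U₁ ∩ U₂ ∩ U₃
  have hU : IsOpen U := (he.isOpen.inter hs.isOpen).inter hU₃
  replace he := he.mono hU fun y hy ↦ hy.1.1
  replace hs := hs.mono hU fun y hy ↦ hy.1.2
  replace hJ : ∀ y ∈ U, ∀ ψ, 𝒮.J y (𝒮.J y ψ) = t • ψ := fun y hy ↦ hJ y hy.2
  obtain ⟨nab, hnab⟩ := hs.exists_metricConnection 𝒮.isSmoothMetric_reForm
  let A : Fin (Module.finrank ℝ E) ⊕ Bool → ∀ x, Sp x →L[ℝ] Sp x :=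
    Sum.elim (fun i y ↦ 𝒮.γ y (e i y)) fun b ↦ bif b then 𝒮.J else 𝒮.cplx
  have hunit : ∀ y ∈ U, ∀ i, 𝒱.g.inner y (e i y) (e i y) = 1 := fun y hy i ↦ by
    simpa using he.orthonormal y hy i i
  have hA : ∀ k, IsIsometryOn I F 𝒮.reForm U (A k) := by
    rintro (i | _ | _)
    · refine ⟨fun y hy ↦ ?_, ⟨1, by simp, fun y hy v ↦ ?_⟩, fun y hy v w ↦ ?_⟩
      · exact ContMDiffAt.clm_bundle_apply (F₁ := E) (F₂ := F →L[ℝ] F) (𝒮.γ_smooth y)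
          (he.smooth y hy i)
      · simp only [A, Sum.elim_inl, γ_sq, hunit y hy]
      · simp only [A, Sum.elim_inl, reForm_apply, 𝒮.herm_γ, γ_sq, hunit y hy, one_smul]
    · refine ⟨fun y hy ↦ 𝒮.cplx_smooth y, ⟨-1, by simp, fun y hy v ↦ ?_⟩, fun y hy v w ↦ ?_⟩
      · simp [A, 𝒮.cplx_apply, smul_smul]
      · simp [A, 𝒮.cplx_apply, reForm_apply, 𝒮.herm_smul, herm_smul_left]
    · refine ⟨fun y hy ↦ 𝒮.J_smooth y, ⟨t, ht, fun y hy v ↦ hJ y hy v⟩, fun y hy v w ↦ ?_⟩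
      simp [A, reForm_apply, 𝒮.J_herm, 𝒮.herm_symm y v w]
  have hcomm : ∀ k l, ∃ s : ℝ, s * s = 1 ∧
      ∀ x ∈ U, ∀ v, A k x (A l x v) = s • A l x (A k x v) := by
    have hJγ : ∀ y i v, 𝒮.γ y (e i y) (𝒮.J y v) = 𝒮.ε • 𝒮.J y (𝒮.γ y (e i y) v) :=
      fun y i v ↦ by rw [𝒮.J_γ, smul_smul, 𝒮.ε_mul_self, one_smul]
    rintro (i | _ | _) (j | _ | _)
    · by_cases hij : i = j
      · subst hij
        exact ⟨1, by simp, by simp⟩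
      · refine ⟨-1, by simp, fun y hy v ↦ ?_⟩
        have h1 := 𝒮.γ_anticomm y (e i y) (e j y) v
        have h2 := he.orthonormal y hy i j
        simp only [NAnholonomicManifold.gForm_apply, hij, if_false] at h2
        rw [h2, mul_zero, zero_smul] at h1
        simpa [A] using eq_neg_of_add_eq_zero_left h1
    · exact ⟨1, by simp, fun y _ v ↦ by simp [A, 𝒮.cplx_apply, 𝒮.γ_complex]⟩
    · exact ⟨𝒮.ε, 𝒮.ε_mul_self, fun y _ v ↦ hJγ y i v⟩
    · exact ⟨1, by simp, fun y _ v ↦ by simp [A, 𝒮.cplx_apply, 𝒮.γ_complex]⟩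
    · exact ⟨1, by simp, by simp⟩
    · exact ⟨-1, by simp, fun y _ v ↦ by simp [A, 𝒮.cplx_apply, 𝒮.J_antilinear]⟩
    · exact ⟨𝒮.ε, 𝒮.ε_mul_self, fun y _ v ↦ 𝒮.J_γ y _ v⟩
    · exact ⟨-1, by simp, fun y _ v ↦ by simp [A, 𝒮.cplx_apply, 𝒮.J_antilinear]⟩
    · exact ⟨1, by simp, by simp⟩
  obtain ⟨nab', h1, h2⟩ := hnab.exists_forall_parallel hU A hA hcomm Finset.univ
  exact ⟨U, e, nab', ⟨⟨hx₁, hx₂⟩, hx₃⟩, he, h1, h2 (Sum.inr false) (Finset.mem_univ _),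
    h2 (Sum.inr true) (Finset.mem_univ _), fun i ↦ h2 (Sum.inl i) (Finset.mem_univ _)⟩

/-- `T` is a derivation on the germs at `x` of differentiable spinors along `ξ`, which is
compatible with all the structures on `Sp` and with the canonical d-connection. -/
structure IsSpinDerivationAt (x : V) (ξ : TangentSpace I x) (T : (∀ y, Sp y) → Sp x) : Prop where
  add : ∀ {ψ φ}, DiffAt I F ψ x → DiffAt I F φ x → T (ψ + φ) = T ψ + T φ
  leibniz : ∀ {ψ} {f : V → ℝ}, MDifferentiableAt I 𝓘(ℝ, ℝ) f x → DiffAt I F ψ x →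
    T (f • ψ) = f x • T ψ + mvfderiv I f x ξ • ψ x
  congr : ∀ {ψ φ}, (∀ᶠ y in 𝓝 x, ψ y = φ y) → T ψ = T φ
  complex : ∀ {ψ}, DiffAt I F ψ x → T (fun y ↦ Complex.I • ψ y) = Complex.I • T ψ
  J : ∀ {ψ}, DiffAt I F ψ x → T (fun y ↦ 𝒮.J y (ψ y)) = 𝒮.J x (T ψ)
  herm : ∀ {ψ φ}, DiffAt I F ψ x → DiffAt I F φ x →
    𝒮.herm x (T ψ) (φ x) + 𝒮.herm x (ψ x) (T φ) =
      mvfderiv I (fun y ↦ 𝒮.herm y (ψ y) (φ y)) x ξ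
  γ : ∀ {X ψ}, DiffAt I E X x → DiffAt I F ψ x →
    T (fun y ↦ 𝒮.γ y (X y) (ψ y)) =
      𝒮.γ x (𝒱.canonicalD X x ξ) (ψ x) + 𝒮.γ x (X x) (T ψ)

section rotation

variable {ι : Type*} [Fintype ι] {x : V}

theorem spinGenerator_γEnd_apply (e : ι → TangentSpace I x) (S : ι → ι → ℝ) (ψ : Sp x) :
    spinGenerator (fun α ↦ 𝒮.γEnd x (e α)) S ψ =
      -((1 / 4 : ℝ) • ∑ α, ∑ β, S α β • 𝒮.γ x (e β) (𝒮.γ x (e α) ψ)) := by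
  simp only [spinGenerator, LinearMap.neg_apply, LinearMap.smul_apply, LinearMap.sum_apply]
  rfl

theorem γEnd_apply (ξ : TangentSpace I x) (ψ : Sp x) : 𝒮.γEnd x ξ ψ = 𝒮.γ x ξ ψ := rfl

theorem J_spinGenerator (e : ι → TangentSpace I x) (S : ι → ι → ℝ) (ψ : Sp x) :
    𝒮.J x (spinGenerator (fun α ↦ 𝒮.γEnd x (e α)) S ψ) =
      spinGenerator (fun α ↦ 𝒮.γEnd x (e α)) S (𝒮.J x ψ) := by
  simp only [spinGenerator_γEnd_apply, map_neg, map_smul, map_sum, 𝒮.J_γ, smul_smul]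
  simp only [𝒮.ε_mul_self, mul_one]

theorem herm_spinGenerator (e : ι → TangentSpace I x) {S : ι → ι → ℝ}
    (hS : ∀ α β, S α β = -S β α) (ψ φ : Sp x) :
    𝒮.herm x (spinGenerator (fun α ↦ 𝒮.γEnd x (e α)) S ψ) φ +
      𝒮.herm x ψ (spinGenerator (fun α ↦ 𝒮.γEnd x (e α)) S φ) = 0 := by
  simp only [spinGenerator_γEnd_apply, map_neg, map_smul, map_sum, neg_apply, smul_apply,
    sum_apply, 𝒮.herm_γ]
  rw [← neg_add, ← smul_add, neg_eq_zero, smul_eq_zero]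
  refine Or.inr ?_
  conv_lhs => enter [1]; rw [Finset.sum_comm]
  rw [← Finset.sum_add_distrib]
  refine Finset.sum_eq_zero fun α _ ↦ ?_
  rw [← Finset.sum_add_distrib]
  refine Finset.sum_eq_zero fun β _ ↦ ?_
  rw [← add_smul, hS α β, add_neg_cancel, zero_smul]

theorem γEnd_anticomm [DecidableEq ι] {e : ι → TangentSpace I x}
    (he : ∀ α β, 𝒱.g.inner x (e α) (e β) = if α = β then 1 else 0) (α β : ι) :
    𝒮.γEnd x (e α) * 𝒮.γEnd x (e β) + 𝒮.γEnd x (e β) * 𝒮.γEnd x (e α) =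
      if α = β then 2 else 0 := by
  ext ψ
  have h := 𝒮.γ_anticomm x (e α) (e β) ψ
  rw [he] at h
  simp only [LinearMap.add_apply, Module.End.mul_apply, γEnd_apply, h]
  split_ifs
  · simp [two_smul, Module.End.ofNat_apply]
  · simp

theorem smoothAt_spinGenerator {e : ι → ∀ x : V, TangentSpace I x} {X : ∀ x : V, TangentSpace I x}
    {ψ : ∀ x, Sp x} (he : ∀ i, SmoothAt I E (e i) x) (hX : SmoothAt I E X x)
    (hψ : SmoothAt I F ψ x) :
    SmoothAt I F (fun y ↦ spinGenerator (fun α ↦ 𝒮.γEnd y (e α y))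
      (𝒱.frameCoeff e y (X y)) (ψ y)) x := by
  simp only [spinGenerator_γEnd_apply]
  refine ContMDiffAt.neg_section (ContMDiffAt.const_smul_section
    (ContMDiffAt.sum_section fun α _ ↦ ContMDiffAt.sum_section fun β _ ↦ ?_))
  exact (𝒱.contMDiffAt_gFun (𝒱.smoothAt_canonicalD hX (he β)) (he α)).smul_section
    (𝒮.smoothAt_γ (he β) (𝒮.smoothAt_γ (he α) hψ))

end rotation

/-- Near every point the canonical spin d-connection exists. -/
theorem exists_local_spinConnection [T2Space V] (x : V) :
    ∃ (U : Set V) (nab : (∀ x, Sp x) → ∀ x, TangentSpace I x →L[ℝ] Sp x), IsOpen U ∧ x ∈ U ∧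
      (∀ y ∈ U, ∀ ξ, 𝒮.IsSpinDerivationAt y ξ (fun ψ ↦ nab ψ y ξ)) ∧
      ∀ y ∈ U, ∀ ψ X, SmoothAt I F ψ y → SmoothAt I E X y →
        SmoothAt I F (fun y ↦ nab ψ y (X y)) y := by
  obtain ⟨U, e, nab, hx, he, hnab, hI, hJ, hγ⟩ := 𝒮.exists_parallelConnection x
  let rot (y : V) (ξ : TangentSpace I y) : Module.End ℂ (Sp y) :=
    spinGenerator (fun α ↦ 𝒮.γEnd y (e α y)) (𝒱.frameCoeff e y ξ)
  let Rot (ψ : ∀ x, Sp x) (y : V) : TangentSpace I y →L[ℝ] Sp y := LinearMap.toContinuousLinearMap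
    { toFun := fun ξ ↦ rot y ξ (ψ y)
      map_add' := fun ξ η ↦ by
        simp only [rot, NAnholonomicManifold.frameCoeff_add, spinGenerator_add, LinearMap.add_apply]
      map_smul' := fun t ξ ↦ by
        simp only [rot, NAnholonomicManifold.frameCoeff_smul, spinGenerator_smul,
          LinearMap.smul_apply, RingHom.id_apply] }
  have hRot : ∀ ψ y ξ, Rot ψ y ξ = rot y ξ (ψ y) := fun _ _ _ ↦ rfl
  have hS := fun y (hy : y ∈ U) ξ ↦
    NAnholonomicManifold.IsOrthonormalFrameOn.frameCoeff_antisymm he hy ξ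
  refine ⟨U, fun ψ y ↦ nab ψ y + Rot ψ y, he.isOpen, hx, fun y hy ξ ↦ ?_, ?_⟩
  · simp only [add_apply, hRot]
    constructor
    · intro ψ φ hψ hφ
      rw [hnab.add hy hψ hφ, Pi.add_apply, map_add, add_apply]
      abel
    · intro ψ f hf hψ
      rw [hnab.leibniz hy hf hψ, Pi.smul_apply', LinearMap.map_smul_of_tower, add_apply, smul_apply,
        ContinuousLinearMap.smulRight_apply, smul_add]
      abel
    · intro ψ φ h
      rw [hnab.congr hy h, h.self_of_nhds]
    · intro ψ hψ
      have := hI y hy ψ hψ ξ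
      simp only [𝒮.cplx_apply] at this
      rw [this, map_smul, smul_add]
    · intro ψ hψ
      rw [hJ y hy ψ hψ ξ, map_add]
      simp only [rot, J_spinGenerator]
    · intro ψ φ hψ hφ
      have h1 := hnab.metric hy hψ hφ ξ
      have hφ' : DiffAt I F (fun y ↦ Complex.I • φ y) y := by
        have := MDifferentiableAt.clm_bundle_apply ((𝒮.cplx_smooth y).mdifferentiableAt (by simp)) hφ
        simpa only [𝒮.cplx_apply] using this
      have h2 := hnab.metric hy hψ hφ' ξ
      have h3 := hI y hy φ hφ ξ
      simp only [𝒮.cplx_apply] at h3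
      rw [h3] at h2
      simp only [reForm_I_smul] at h2
      have h4 : MDifferentiableAt I 𝓘(ℝ, ℂ) (fun y ↦ 𝒮.herm y (ψ y) (φ y)) y :=
        DiffAt.bilin (𝒮.herm_smooth y) hψ hφ
      have h5 := mvfderiv_clm_apply Complex.reCLM h4 ξ
      have h6 := mvfderiv_clm_apply (-Complex.imCLM) h4 ξ
      have h7 := 𝒮.herm_spinGenerator (fun α ↦ e α y) (hS y hy ξ) (ψ y) (φ y)
      simp only [map_add, add_apply]
      have h8 : 𝒮.herm y (nab ψ y ξ) (φ y) + 𝒮.herm y (ψ y) (nab φ y ξ) =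
          mvfderiv I (fun y ↦ 𝒮.herm y (ψ y) (φ y)) y ξ := by
        apply Complex.ext
        · exact (h5.symm.trans h1).symm
        · have h9 := h6.symm.trans h2
          simp only [neg_apply, Complex.imCLM_apply] at h9
          rw [Complex.add_im]
          linarith
      rw [← h8]
      linear_combination h7
    · intro X ψ hX hψ
      have h1 : ∀ᶠ z in 𝓝 y, 𝒮.γ z (X z) (ψ z) =
          ∑ i, 𝒱.gFun (e i) X z • 𝒮.γ z (e i z) (ψ z) := by
        filter_upwards [he.isOpen.mem_nhds hy] with z hz
        conv_lhs => rw [← he.sum_eq z hz (X z)]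
        simp [NAnholonomicManifold.gFun]
      have h2 := (hnab.sum_smul hy Finset.univ
        (fun i ↦ 𝒱.mdifferentiableAt_gFun (he.smooth y hy i).diffAt hX)
        (fun i ↦ 𝒮.diffAt_γ (he.smooth y hy i).diffAt hψ) ξ).2
      rw [hnab.congr hy h1, h2]
      beta_reduce
      rw [h1.self_of_nhds, map_sum]
      have h3 : ∀ i, rot y ξ (𝒮.γ y (e i y) (ψ y)) = 𝒮.γ y (e i y) (rot y ξ (ψ y)) +
          ∑ α, 𝒱.frameCoeff e y ξ α i • 𝒮.γ y (e α y) (ψ y) := by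
        intro i
        have := congrArg (fun l : Module.End ℂ (Sp y) ↦ l (ψ y))
          (spinGenerator_commutator (𝒮.γEnd_anticomm (he.orthonormal y hy)) (hS y hy ξ) i)
        simp only [LinearMap.sub_apply, Module.End.mul_apply, LinearMap.sum_apply,
          LinearMap.smul_apply, γEnd_apply] at this
        rw [← this, add_sub_cancel]
      have h4 := NAnholonomicManifold.sum_mvfderiv_add_frameCoeff he hy hX ξ
        (fun i ↦ 𝒮.γ y (e i y) (ψ y))
      have h5 : ∀ (η : TangentSpace I y) (φ : Sp y), 𝒮.γ y η φ =
          ∑ i, 𝒱.g.inner y (e i y) η • 𝒮.γ y (e i y) φ := fun η φ ↦ by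
        conv_lhs => rw [← he.sum_eq y hy η]
        simp
      rw [h5 (𝒱.canonicalD X y ξ), h5 (X y), ← h4]
      have h6 : ∀ i, nab (fun z ↦ 𝒮.γ z (e i z) (ψ z)) y ξ = 𝒮.γ y (e i y) (nab ψ y ξ) :=
        fun i ↦ hγ i y hy ψ hψ ξ
      simp only [LinearMap.map_smul_of_tower, h3, h6, map_add, smul_add, Finset.sum_add_distrib]
      simp only [NAnholonomicManifold.gFun]
      abel
  · intro y hy ψ X hψ hX
    exact (hnab.smooth hy hψ hX).add_section
      (𝒮.smoothAt_spinGenerator (fun i ↦ he.smooth y hy i) hX hψ)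

end SpinStructure

namespace SpinStructure

variable {E : Type*} [NormedAddCommGroup E] [NormedSpace ℝ E] [FiniteDimensional ℝ E]
  {H : Type*} [TopologicalSpace H] {I : ModelWithCorners ℝ E H}
  {V : Type*} [TopologicalSpace V] [ChartedSpace H V] [IsManifold I ∞ V]
  {E' : Type*} [NormedAddCommGroup E'] [NormedSpace ℝ E']
  {H' : Type*} [TopologicalSpace H'] {I' : ModelWithCorners ℝ E' H'}
  {M : Type*} [TopologicalSpace M] [ChartedSpace H' M]
  {𝒱 : NAnholonomicManifold I V I' M}
  {F : Type*} [NormedAddCommGroup F] [NormedSpace ℝ F] [FiniteDimensional ℝ F]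
  {Sp : V → Type*} [TopologicalSpace (TotalSpace F Sp)]
  [∀ x, AddCommGroup (Sp x)] [∀ x, Module ℂ (Sp x)] [∀ x, TopologicalSpace (Sp x)]
  [∀ x, IsTopologicalAddGroup (Sp x)] [∀ x, ContinuousSMul ℝ (Sp x)]
  [FiberBundle F Sp] [VectorBundle ℝ F Sp] [ContMDiffVectorBundle ∞ F Sp I]
  (𝒮 : SpinStructure 𝒱 F Sp)

include 𝒮 in
theorem smoothAt_I_smul {ψ : ∀ x, Sp x} {x : V} (hψ : SmoothAt I F ψ x) :
    SmoothAt I F (fun y ↦ Complex.I • ψ y) x := by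
  have h : SmoothAt I F (fun y ↦ 𝒮.cplx y (ψ y)) x :=
    ContMDiffAt.clm_bundle_apply (𝒮.cplx_smooth x) hψ
  simpa only [𝒮.cplx_apply] using h

include 𝒮 in
theorem diffAt_I_smul {ψ : ∀ x, Sp x} {x : V} (hψ : DiffAt I F ψ x) :
    DiffAt I F (fun y ↦ Complex.I • ψ y) x := by
  have h : DiffAt I F (fun y ↦ 𝒮.cplx y (ψ y)) x :=
    MDifferentiableAt.clm_bundle_apply ((𝒮.cplx_smooth x).mdifferentiableAt (by simp)) hψ
  simpa only [𝒮.cplx_apply] using h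

theorem complex_smul_eq {x : V} (z : ℂ) (φ : Sp x) :
    z • φ = z.re • φ + z.im • (Complex.I • φ) := by
  conv_lhs => rw [← Complex.re_add_im z]
  rw [add_smul, mul_smul, Complex.coe_smul, Complex.coe_smul]

include 𝒮 in
theorem smoothAt_complex_smul {ψ : ∀ x, Sp x} {x : V} (z : ℂ) (hψ : SmoothAt I F ψ x) :
    SmoothAt I F (fun y ↦ z • ψ y) x := by
  simp only [complex_smul_eq z]
  exact hψ.const_smul_section.add_section (𝒮.smoothAt_I_smul hψ).const_smul_section

section derivation

variable {𝒮} {x : V} {ξ : TangentSpace I x} {T T' : (∀ y, Sp y) → Sp x}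

theorem IsSpinDerivationAt.const_smul (hT : 𝒮.IsSpinDerivationAt x ξ T) {ψ : ∀ y, Sp y}
    (hψ : DiffAt I F ψ x) (t : ℝ) :
    DiffAt I F (fun y ↦ t • ψ y) x ∧ T (fun y ↦ t • ψ y) = t • T ψ := by
  have h1 : MDifferentiableAt I 𝓘(ℝ, ℝ) (fun _ : V ↦ t) x := mdifferentiableAt_const
  have h2 := hT.leibniz h1 hψ
  rw [mvfderiv_const, zero_apply, zero_smul, add_zero] at h2
  exact ⟨DiffAt.smul h1 hψ, h2⟩

theorem IsSpinDerivationAt.complex_smul (hT : 𝒮.IsSpinDerivationAt x ξ T) {ψ : ∀ y, Sp y}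
    (hψ : DiffAt I F ψ x) (z : ℂ) :
    DiffAt I F (fun y ↦ z • ψ y) x ∧ T (fun y ↦ z • ψ y) = z • T ψ := by
  simp only [complex_smul_eq z]
  have h1 := hT.const_smul hψ z.re
  have h2 := hT.const_smul (𝒮.diffAt_I_smul hψ) z.im
  refine ⟨h1.1.add h2.1, (hT.add h1.1 h2.1).trans ?_⟩
  rw [h1.2, h2.2, hT.complex hψ]

theorem IsSpinDerivationAt.sum_complex_smul (hT : 𝒮.IsSpinDerivationAt x ξ T) {κ : Type*}
    (t : Finset κ) {s : κ → ∀ y, Sp y} (hs : ∀ A, DiffAt I F (s A) x) (z : κ → ℂ) :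
    DiffAt I F (fun y ↦ ∑ A ∈ t, z A • s A y) x ∧
      T (fun y ↦ ∑ A ∈ t, z A • s A y) = ∑ A ∈ t, z A • T (s A) := by
  classical
  induction t using Finset.induction_on with
  | empty =>
    have h0 : DiffAt I F (fun y ↦ (0 : Sp y)) x :=
      (contMDiff_zeroSection ℝ Sp x).mdifferentiableAt one_ne_zero
    have h1 := (hT.const_smul h0 0).2
    simp only [Finset.sum_empty]
    exact ⟨h0, by simpa using h1⟩
  | insert j t hj ih =>
    simp only [Finset.sum_insert hj]
    have h1 := hT.complex_smul (hs j) (z j)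
    refine ⟨h1.1.add ih.1, (hT.add h1.1 ih.1).trans ?_⟩
    rw [h1.2, ih.2]

/-- The canonical spin d-connection is unique. -/
theorem IsSpinDerivationAt.unique [T2Space V] (hT : 𝒮.IsSpinDerivationAt x ξ T)
    (hadd : ∀ {ψ φ}, DiffAt I F ψ x → DiffAt I F φ x → T' (ψ + φ) = T' ψ + T' φ)
    (hleibniz : ∀ {ψ} {f : V → ℝ}, MDifferentiableAt I 𝓘(ℝ, ℝ) f x → DiffAt I F ψ x →
      T' (f • ψ) = f x • T' ψ + mvfderiv I f x ξ • ψ x)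
    (hI : ∀ ψ, (∀ y, SmoothAt I F ψ y) → T' (fun y ↦ Complex.I • ψ y) = Complex.I • T' ψ)
    (hJ : ∀ ψ, (∀ y, SmoothAt I F ψ y) → T' (fun y ↦ 𝒮.J y (ψ y)) = 𝒮.J x (T' ψ))
    (hh : ∀ ψ φ, (∀ y, SmoothAt I F ψ y) → (∀ y, SmoothAt I F φ y) →
      𝒮.herm x (T' ψ) (φ x) + 𝒮.herm x (ψ x) (T' φ) =
        mvfderiv I (fun y ↦ 𝒮.herm y (ψ y) (φ y)) x ξ)
    (hγ : ∀ X ψ, SmoothVF X → (∀ y, SmoothAt I F ψ y) →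
      T' (fun y ↦ 𝒮.γ y (X y) (ψ y)) =
        𝒮.γ x (𝒱.canonicalD X x ξ) (ψ x) + 𝒮.γ x (X x) (T' ψ))
    {ψ : ∀ y, Sp y} (hψ : DiffAt I F ψ x) : T' ψ = T ψ := by
  have ht : TensorialAt I F (fun ψ ↦ T' ψ - T ψ) x :=
    { smul := by
        intro f σ hf hσ
        rw [hT.leibniz hf hσ, hleibniz hf hσ, add_sub_add_right_eq_sub, smul_sub]
      add := by
        intro σ τ hσ hτ
        rw [hT.add hσ hτ, hadd hσ hτ]
        abel }
  let L := TensorialAt.mkHom (fun ψ ↦ T' ψ - T ψ) x ht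
  have hL : ∀ {ψ}, DiffAt I F ψ x → L (ψ x) = T' ψ - T ψ := fun hψ ↦
    TensorialAt.mkHom_apply ht hψ
  have key : ∀ v, L v = 0 := by
    refine 𝒮.eq_zero_of_commutes L.toLinearMap (fun v ↦ ?_) (fun η v ↦ ?_) (fun v ↦ ?_)
      (fun v w ↦ ?_)
    · obtain ⟨ψ, hψ, rfl⟩ := exists_smooth_section_apply_eq (I := I) (F := F) v
      have h1 := hL (𝒮.smoothAt_I_smul (hψ x)).diffAt
      rw [hI ψ hψ, hT.complex (hψ x).diffAt, ← smul_sub, ← hL (hψ x).diffAt] at h1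
      exact h1
    · obtain ⟨ψ, hψ, rfl⟩ := exists_smooth_section_apply_eq (I := I) (F := F) v
      obtain ⟨X, hX, rfl⟩ := exists_smooth_section_apply_eq (I := I) (F := E) η
      have h1 := hL (𝒮.smoothAt_γ (hX x) (hψ x)).diffAt
      rw [hγ X ψ hX hψ, hT.γ (hX x).diffAt (hψ x).diffAt, add_sub_add_left_eq_sub, ← map_sub,
        ← hL (hψ x).diffAt] at h1
      exact h1
    · obtain ⟨ψ, hψ, rfl⟩ := exists_smooth_section_apply_eq (I := I) (F := F) v
      have h1 := hL ((hψ x).J (𝒮 := 𝒮)).diffAt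
      rw [hJ ψ hψ, hT.J (hψ x).diffAt, ← map_sub, ← hL (hψ x).diffAt] at h1
      exact h1
    · obtain ⟨ψ, hψ, rfl⟩ := exists_smooth_section_apply_eq (I := I) (F := F) v
      obtain ⟨φ, hφ, rfl⟩ := exists_smooth_section_apply_eq (I := I) (F := F) w
      have h1 := hh ψ φ hψ hφ
      rw [← hT.herm (hψ x).diffAt (hφ x).diffAt] at h1
      simp only [ContinuousLinearMap.coe_coe, hL (hψ x).diffAt, hL (hφ x).diffAt, map_sub,
        sub_apply]
      linear_combination h1
  have h1 := hL hψ
  rw [key] at h1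
  exact (sub_eq_zero.1 h1.symm)

theorem IsSpinDerivationAt.eq_of_isSpinDerivationAt [T2Space V] (hT : 𝒮.IsSpinDerivationAt x ξ T)
    (hT' : 𝒮.IsSpinDerivationAt x ξ T') {ψ : ∀ y, Sp y} (hψ : DiffAt I F ψ x) : T' ψ = T ψ :=
  hT.unique hT'.add hT'.leibniz (fun _ h ↦ hT'.complex (h x).diffAt)
    (fun _ h ↦ hT'.J (h x).diffAt) (fun _ _ h h' ↦ hT'.herm (h x).diffAt (h' x).diffAt)
    (fun _ _ h h' ↦ hT'.γ (h.diffAt x) (h' x).diffAt) hψ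

end derivation

section Clifford

variable {x : V}

theorem c_clVec (ξ : TangentSpace I x) (ψ : Sp x) : 𝒮.c x (𝒱.clVec x ξ) ψ = 𝒮.γ x ξ ψ := by
  have h : 𝒮.c x (𝒱.clVec x ξ) = 𝒮.γEnd x ξ := by
    change 𝒮.c x (1 ⊗ₜ CliffordAlgebra.ι _ ξ) = _
    refine (Algebra.TensorProduct.lift_tmul _ _ _ _ _).trans ?_
    rw [map_one, one_mul, CliffordAlgebra.lift_ι_apply]
  rw [h]
  rfl

theorem c_algebraMap_complex (z : ℂ) (ψ : Sp x) :
    𝒮.c x (algebraMap ℂ (𝒱.Cl x) z) ψ = z • ψ := by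
  rw [AlgHom.commutes, Module.algebraMap_end_apply]

theorem c_algebraMap_real (t : ℝ) (ψ : Sp x) :
    𝒮.c x (algebraMap ℝ (𝒱.Cl x) t) ψ = t • ψ := by
  rw [IsScalarTower.algebraMap_apply ℝ ℂ, c_algebraMap_complex]
  exact Complex.coe_smul t ψ

variable {𝒮} in
/-- A spin derivation satisfies the Leibniz rule for the Clifford action. -/
theorem IsSpinDerivationAt.clifford {ξ : TangentSpace I x} {T : (∀ y, Sp y) → Sp x}
    (hT : 𝒮.IsSpinDerivationAt x ξ T) {a : ∀ x, 𝒱.Cl x} (ha : 𝒱.SmoothCl a) {ψ : ∀ y, Sp y}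
    (hψ : SmoothAt I F ψ x) :
    T (fun y ↦ 𝒮.c y (a y) (ψ y)) =
      𝒮.c x (𝒱.cliffordD a x ξ) (ψ x) + 𝒮.c x (a x) (T ψ) := by
  have hD := 𝒱.isCliffordDerivationAt_cliffordD x ξ
  obtain ⟨b, hb, hab⟩ := ha x
  have h1 : 𝒱.cliffordD a x ξ = 𝒱.cliffordD b x ξ := hD.congr a b ha (.of_mem hb) hab
  have h2 : ∀ᶠ y in 𝓝 x, 𝒮.c y (a y) (ψ y) = 𝒮.c y (b y) (ψ y) := hab.mono fun y hy ↦ by rw [hy]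
  rw [hT.congr h2, h1, hab.self_of_nhds]
  clear h1 h2 hab
  suffices ∀ ψ : ∀ y, Sp y, SmoothAt I F ψ x → SmoothAt I F (fun y ↦ 𝒮.c y (b y) (ψ y)) x ∧
      T (fun y ↦ 𝒮.c y (b y) (ψ y)) =
        𝒮.c x (𝒱.cliffordD b x ξ) (ψ x) + 𝒮.c x (b x) (T ψ) from (this ψ hψ).2
  clear hψ ψ
  induction hb using Algebra.adjoin_induction with
  | mem b hb =>
    intro ψ hψ
    rcases hb with ⟨f, hf, rfl⟩ | ⟨X, hX, rfl⟩
    · rw [hD.func f hf]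
      simp only [c_algebraMap_real]
      refine ⟨hf.contMDiffAt.smul_section hψ, ?_⟩
      rw [add_comm]
      exact hT.leibniz (hf.mdifferentiable (by simp) x) hψ.diffAt
    · rw [hD.vec X hX]
      simp only [c_clVec]
      exact ⟨𝒮.smoothAt_γ (hX x) hψ, hT.γ (hX.diffAt x) hψ.diffAt⟩
  | algebraMap z =>
    intro ψ hψ
    have h1 : 𝒱.cliffordD (algebraMap ℂ (∀ x, 𝒱.Cl x) z) x ξ = 0 := hD.const z
    rw [h1, map_zero, LinearMap.zero_apply, zero_add]
    simp only [Pi.algebraMap_apply, c_algebraMap_complex]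
    exact ⟨𝒮.smoothAt_complex_smul z hψ, (hT.complex_smul hψ.diffAt z).2⟩
  | add b c hb hc hb' hc' =>
    intro ψ hψ
    obtain ⟨h1, h2⟩ := hb' ψ hψ
    obtain ⟨h3, h4⟩ := hc' ψ hψ
    rw [hD.add b c (.of_mem hb) (.of_mem hc)]
    simp only [Pi.add_apply, map_add, LinearMap.add_apply]
    refine ⟨h1.add_section h3, (hT.add h1.diffAt h3.diffAt).trans ?_⟩
    rw [h2, h4]
    abel
  | mul b c hb hc hb' hc' =>
    intro ψ hψ
    obtain ⟨h3, h4⟩ := hc' ψ hψ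
    obtain ⟨h1, h2⟩ := hb' _ h3
    rw [hD.mul b c (.of_mem hb) (.of_mem hc)]
    simp only [Pi.mul_apply, map_add, map_mul, LinearMap.add_apply, Module.End.mul_apply]
    refine ⟨h1, h2.trans ?_⟩
    rw [h4, map_add, add_assoc]

end Clifford

section global_

variable [T2Space V]

/-- The canonical spin d-connection. -/
def spinConnection : CovariantDerivative I F Sp where
  toFun ψ x := (𝒮.exists_local_spinConnection x).choose_spec.choose ψ x
  isCovariantDerivativeOnUniv :=
    { add := by
        intro ψ φ x hψ hφ _
        have h := (𝒮.exists_local_spinConnection x).choose_spec.choose_spec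
        ext ξ
        exact (h.2.2.1 x h.2.1 ξ).add hψ hφ
      leibniz := by
        intro ψ f x hψ hf _
        have h := (𝒮.exists_local_spinConnection x).choose_spec.choose_spec
        ext ξ
        exact (h.2.2.1 x h.2.1 ξ).leibniz hf hψ }

theorem isSpinDerivationAt_spinConnection (x : V) (ξ : TangentSpace I x) :
    𝒮.IsSpinDerivationAt x ξ (fun ψ ↦ 𝒮.spinConnection ψ x ξ) :=
  have h := (𝒮.exists_local_spinConnection x).choose_spec.choose_spec
  h.2.2.1 x h.2.1 ξ

theorem smoothAt_spinConnection {ψ : ∀ x, Sp x} {X : ∀ x : V, TangentSpace I x} {x : V}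
    (hψ : SmoothAt I F ψ x) (hX : SmoothAt I E X x) :
    SmoothAt I F (fun y ↦ 𝒮.spinConnection ψ y (X y)) x := by
  obtain ⟨U, nab, hU, hx, h, hs⟩ := 𝒮.exists_local_spinConnection x
  refine (hs x hx ψ X hψ hX).congr_of_eventuallyEq ?_
  filter_upwards [hU.mem_nhds hx, hψ.eventually_diffAt] with y hy hψy
  rw [(h y hy (X y)).eq_of_isSpinDerivationAt (𝒮.isSpinDerivationAt_spinConnection y (X y)) hψy]

theorem isSpinDConnection_spinConnection :
    𝒮.IsSpinDConnection 𝒱.cliffordD 𝒮.spinConnection where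
  smooth :=
    { contMDiff :=
      { contMDiff := by
          intro ψ hψ x _
          refine (contMDiffAt_hom_of_apply fun X hX ↦ ?_).contMDiffWithinAt
          exact 𝒮.smoothAt_spinConnection ((hψ x (mem_univ x)).contMDiffAt univ_mem) hX } }
  complex_linear z ψ hψ x ξ :=
    ((𝒮.isSpinDerivationAt_spinConnection x ξ).complex_smul (SmoothAt.diffAt (hψ x)) z).2
  commutes_J ψ hψ x ξ := (𝒮.isSpinDerivationAt_spinConnection x ξ).J (SmoothAt.diffAt (hψ x))
  hermitian ψ φ hψ hφ x ξ := (𝒮.isSpinDerivationAt_spinConnection x ξ).herm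
    (SmoothAt.diffAt (hψ x)) (SmoothAt.diffAt (hφ x))
  leibniz a ψ ha hψ x ξ := (𝒮.isSpinDerivationAt_spinConnection x ξ).clifford ha (hψ x)

variable {𝒮} in
theorem IsSpinDConnection.eq_spinConnection {nab : CovariantDerivative I F Sp}
    (h : 𝒮.IsSpinDConnection 𝒱.cliffordD nab) {ψ : ∀ x, Sp x}
    (hψ : SmoothSpinor (I := I) (F := F) ψ) : nab ψ = 𝒮.spinConnection ψ := by
  ext x ξ
  refine (𝒮.isSpinDerivationAt_spinConnection x ξ).unique (T' := fun ψ ↦ nab ψ x ξ)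
    (fun hψ hφ ↦ ?_) (fun hf hψ ↦ ?_) (fun ψ hψ ↦ h.complex_linear _ ψ hψ x ξ)
    (fun ψ hψ ↦ h.commutes_J ψ hψ x ξ) (fun ψ φ hψ hφ ↦ h.hermitian ψ φ hψ hφ x ξ)
    (fun X ψ hX hψ ↦ ?_) (SmoothAt.diffAt (hψ x))
  · rw [nab.isCovariantDerivativeOnUniv.add hψ hφ (mem_univ x)]
    rfl
  · rw [nab.isCovariantDerivativeOnUniv.leibniz hψ hf (mem_univ x)]
    rfl
  · have h1 := h.leibniz _ ψ
      (.of_mem (NAnholonomicManifold.clVec_mem_clGen hX)) hψ x ξ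
    rw [𝒱.isCliffordExtension_cliffordD.vec X hX] at h1
    simpa only [c_clVec] using h1

end global_

end SpinStructure

namespace SpinStructure

variable {E : Type*} [NormedAddCommGroup E] [NormedSpace ℝ E] [FiniteDimensional ℝ E]
  {H : Type*} [TopologicalSpace H] {I : ModelWithCorners ℝ E H}
  {V : Type*} [TopologicalSpace V] [ChartedSpace H V] [IsManifold I ∞ V]
  {E' : Type*} [NormedAddCommGroup E'] [NormedSpace ℝ E']
  {H' : Type*} [TopologicalSpace H'] {I' : ModelWithCorners ℝ E' H'}
  {M : Type*} [TopologicalSpace M] [ChartedSpace H' M]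
  {𝒱 : NAnholonomicManifold I V I' M}
  {F : Type*} [NormedAddCommGroup F] [NormedSpace ℝ F] [FiniteDimensional ℝ F]
  {Sp : V → Type*} [TopologicalSpace (TotalSpace F Sp)]
  [∀ x, AddCommGroup (Sp x)] [∀ x, Module ℂ (Sp x)] [∀ x, TopologicalSpace (Sp x)]
  [∀ x, IsTopologicalAddGroup (Sp x)] [∀ x, ContinuousSMul ℝ (Sp x)]
  [FiberBundle F Sp] [VectorBundle ℝ F Sp] [ContMDiffVectorBundle ∞ F Sp I]
  (𝒮 : SpinStructure 𝒱 F Sp)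

section localForm

variable {𝒮} {x : V} {ξ : TangentSpace I x} {T : (∀ y, Sp y) → Sp x}
  {ι κ : Type} [Fintype ι] [Fintype κ] {e : ι → ∀ x : V, TangentSpace I x} {s : κ → ∀ x, Sp x}

theorem IsAdaptedFrameAt.orthonormal [DecidableEq ι] (h : 𝒮.IsAdaptedFrameAt x e s) :
    ∀ᶠ y in 𝓝 x, ∀ i j, 𝒱.g.inner y (e i y) (e j y) = if i = j then 1 else 0 := by
  filter_upwards [h.e_unit, h.e_orthogonal] with y h1 h2 i j
  split_ifs with hij
  · rw [← hij, h1]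
  · exact h2 i j hij

/-- The action of a spin derivation on an adapted spinor frame. -/
theorem IsSpinDerivationAt.apply_frame (hT : 𝒮.IsSpinDerivationAt x ξ T)
    (h : 𝒮.IsAdaptedFrameAt x e s) (A : κ) :
    T (s A) = spinGenerator (fun α ↦ 𝒮.γEnd x (e α x)) (𝒱.frameCoeff e x ξ) (s A x) := by
  classical
  have he : ∀ i, DiffAt I E (e i) x := fun i ↦ SmoothAt.diffAt (h.e_smooth i)
  have hs : ∀ A, DiffAt I F (s A) x := fun A ↦ SmoothAt.diffAt (h.s_smooth A)
  have ho := h.orthonormal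
  have hox := ho.self_of_nhds
  have hexp : ∀ η : TangentSpace I x, ∑ i, 𝒱.g.inner x (e i x) η • e i x = η :=
    sum_smul_eq_of_orthonormal (𝒱.gForm x) hox h.e_span.self_of_nhds
  have hS := NAnholonomicManifold.frameCoeff_antisymm he ho ξ
  let b : Module.Basis κ ℂ (Sp x) :=
    Module.Basis.mk h.s_indep.self_of_nhds h.s_span.self_of_nhds.ge
  have hb : ∀ A, b A = s A x := fun A ↦ by simp [b]
  let L : Sp x →ₗ[ℂ] Sp x := b.constr ℂ fun A ↦ T (s A)
  have hL : ∀ A, L (s A x) = T (s A) := fun A ↦ by rw [← hb, Module.Basis.constr_basis]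
  let rot : Module.End ℂ (Sp x) :=
    spinGenerator (fun α ↦ 𝒮.γEnd x (e α x)) (𝒱.frameCoeff e x ξ)
  have hspan : ∀ p : Sp x → Prop, p 0 → (∀ A, p (s A x)) → (∀ v w, p v → p w → p (v + w)) →
      (∀ (z : ℂ) v, p v → p (z • v)) → ∀ v, p v := fun p h0 h1 h2 h3 v ↦
    Submodule.span_induction (p := fun v _ ↦ p v) (by rintro _ ⟨A, rfl⟩; exact h1 A) h0
      (fun v w _ _ ↦ h2 v w) (fun z v _ ↦ h3 z v)
      (by rw [h.s_span.self_of_nhds]; trivial : v ∈ Submodule.span ℂ (range fun A ↦ s A x))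
  have hcomb : ∀ (φ : ∀ y, Sp y) (z : κ → ℂ), (∀ᶠ y in 𝓝 x, φ y = ∑ B, z B • s B y) →
      T φ = L (φ x) := by
    intro φ z hφ
    rw [hT.congr hφ, (hT.sum_complex_smul Finset.univ hs z).2, hφ.self_of_nhds, map_sum]
    simp only [map_smul, hL]
  obtain ⟨G, hG⟩ := h.γ_const
  obtain ⟨C, hC⟩ := h.J_const
  obtain ⟨P, hP⟩ := h.herm_const
  have hγ1 : ∀ α A, L (𝒮.γ x (e α x) (s A x)) =
      𝒮.γ x (𝒱.canonicalD (e α) x ξ) (s A x) + 𝒮.γ x (e α x) (L (s A x)) := by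
    intro α A
    rw [hL, ← hT.γ (he α) (hs A)]
    exact (hcomb (fun y ↦ 𝒮.γ y (e α y) (s A y)) (fun B ↦ G α B A)
      (hG.mono fun y hy ↦ hy α A)).symm
  have hγ2 : ∀ α v, rot (𝒮.γ x (e α x) v) =
      𝒮.γ x (𝒱.canonicalD (e α) x ξ) v + 𝒮.γ x (e α x) (rot v) := by
    intro α v
    have h1 := congrArg (fun l : Module.End ℂ (Sp x) ↦ l v)
      (spinGenerator_commutator (𝒮.γEnd_anticomm hox) hS α)
    simp only [LinearMap.sub_apply, Module.End.mul_apply, LinearMap.sum_apply,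
      LinearMap.smul_apply, γEnd_apply] at h1
    rw [sub_eq_iff_eq_add] at h1
    refine h1.trans ?_
    congr 1
    conv_rhs => rw [← hexp (𝒱.canonicalD (e α) x ξ)]
    simp [NAnholonomicManifold.frameCoeff, 𝒱.g.symm x (𝒱.canonicalD (e α) x ξ)]
  have key := 𝒮.eq_zero_of_commutes ((L - rot).restrictScalars ℝ) (fun v ↦ ?_) (fun η ↦ ?_)
    (fun v ↦ ?_) ?_ (s A x)
  · simp only [LinearMap.restrictScalars_apply, LinearMap.sub_apply, hL] at key
    exact sub_eq_zero.1 key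
  · simp
  · refine hspan _ (by simp) (fun A ↦ ?_) (fun v w hv hw ↦ ?_) (fun z v hv ↦ ?_)
    · have h1 : ∀ ζ : Sp x, 𝒮.γ x η ζ = ∑ i, 𝒱.g.inner x (e i x) η • 𝒮.γ x (e i x) ζ :=
        fun ζ ↦ by
          conv_lhs => rw [← hexp η]
          simp
      rw [h1, h1, map_sum]
      refine Finset.sum_congr rfl fun i _ ↦ ?_
      rw [map_smul]
      congr 1
      simp only [LinearMap.restrictScalars_apply, LinearMap.sub_apply, hγ1, hγ2, map_sub]
      abel
    · simp only [map_add, hv, hw]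
    · simp only [LinearMap.restrictScalars_apply, 𝒮.γ_complex, map_smul] at hv ⊢
      rw [hv]
  · refine hspan (fun v ↦ ((L - rot).restrictScalars ℝ) (𝒮.J x v) =
      𝒮.J x (((L - rot).restrictScalars ℝ) v)) (by simp) (fun A ↦ ?_) (fun v w hv hw ↦ ?_)
      (fun z v hv ↦ ?_) v
    · have h1 := hcomb (fun y ↦ 𝒮.J y (s A y)) (fun B ↦ C B A) (hC.mono fun y hy ↦ hy A)
      rw [hT.J (hs A)] at h1
      simp only [LinearMap.restrictScalars_apply, LinearMap.sub_apply, map_sub, hL, h1, rot,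
        J_spinGenerator]
    · simp only [map_add, hv, hw]
    · simp only [LinearMap.restrictScalars_apply, 𝒮.J_antilinear, map_smul] at hv ⊢
      rw [hv]
  · intro v w
    have h1 : 𝒮.herm x (L v) w + 𝒮.herm x v (L w) = 0 := by
      refine hspan (fun v ↦ 𝒮.herm x (L v) w + 𝒮.herm x v (L w) = 0) (by simp) (fun A ↦ ?_)
        (fun v v' hv hv' ↦ ?_) (fun z v hv ↦ ?_) v
      · refine hspan (fun w ↦ 𝒮.herm x (L (s A x)) w + 𝒮.herm x (s A x) (L w) = 0) (by simp)
          (fun B ↦ ?_) (fun w w' hw hw' ↦ ?_) (fun z w hw ↦ ?_) w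
        · have h2 := hT.herm (hs A) (hs B)
          have h3 : (fun y ↦ 𝒮.herm y (s A y) (s B y)) =ᶠ[𝓝 x] fun _ ↦ P A B :=
            hP.mono fun y hy ↦ hy A B
          rw [mvfderiv_congr h3, mvfderiv_const, ← hL, ← hL] at h2
          exact h2
        · simp only [map_add]
          linear_combination hw + hw'
        · simp only [map_smul, 𝒮.herm_smul]
          linear_combination z * hw
      · simp only [map_add, add_apply]
        linear_combination hv + hv'
      · simp only [map_smul, herm_smul_left]
        linear_combination conj z * hv
    have h2 := 𝒮.herm_spinGenerator (fun α ↦ e α x) hS v w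
    simp only [LinearMap.restrictScalars_apply, LinearMap.sub_apply, map_sub, sub_apply]
    linear_combination h1 - h2

theorem hasLocalForm_spinConnection [T2Space V] :
    𝒮.HasLocalForm 𝒱.canonicalD 𝒮.spinConnection := by
  intro x ι κ _ _ e s h A ξ
  rw [(𝒮.isSpinDerivationAt_spinConnection x ξ).apply_frame h A, spinGenerator_γEnd_apply]
  rfl

end localForm

section Dirac

theorem contract_eq_sum {n : ℕ} {U : Set V} {e : Fin n → ∀ x : V, TangentSpace I x}
    (h : IsOrthonormalFrameOn I E 𝒱.gForm e U) {x : V} (hx : x ∈ U)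
    (T : TangentSpace I x →L[ℝ] Sp x) :
    𝒮.contract x T = ∑ i, 𝒮.γ x (e i x) (T (e i x)) := by
  let b := Module.finBasis ℝ (TangentSpace I x)
  let b' := (𝒱.gForm x).dualBasis (𝒱.gForm_nondegenerate x) b
  have h1 : ∀ i, ∑ k, 𝒱.g.inner x (e i x) (b k) • b' k = e i x := by
    intro i
    refine 𝒱.eq_of_inner_eq fun η ↦ ?_
    suffices 𝒱.gForm x (∑ k, 𝒱.g.inner x (e i x) (b k) • b' k) = 𝒱.gForm x (e i x) from
      LinearMap.congr_fun this η
    refine b.ext fun j ↦ ?_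
    simp only [map_sum, map_smul, LinearMap.sum_apply, LinearMap.smul_apply, b',
      LinearMap.BilinForm.apply_dualBasis_left]
    simp
  calc 𝒮.contract x T = ∑ k, 𝒮.γ x (b' k) (T (b k)) := rfl
    _ = ∑ k, ∑ i, 𝒱.g.inner x (e i x) (b k) • 𝒮.γ x (b' k) (T (e i x)) := by
        refine Finset.sum_congr rfl fun k _ ↦ ?_
        conv_lhs => rw [← h.sum_eq x hx (b k)]
        simp
    _ = ∑ i, 𝒮.γ x (∑ k, 𝒱.g.inner x (e i x) (b k) • b' k) (T (e i x)) := by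
        rw [Finset.sum_comm]
        simp
    _ = _ := by simp only [h1]

theorem contract_add (x : V) (T T' : TangentSpace I x →L[ℝ] Sp x) :
    𝒮.contract x (T + T') = 𝒮.contract x T + 𝒮.contract x T' := by
  simp [contract, Finset.sum_add_distrib]

theorem smoothAt_contract {A : ∀ x, TangentSpace I x →L[ℝ] Sp x} {x : V}
    (hA : ∀ X, SmoothAt I E X x → SmoothAt I F (fun y ↦ A y (X y)) x) :
    SmoothAt I F (fun y ↦ -(Complex.I • 𝒮.contract y (A y))) x := by
  obtain ⟨U, e, hx, he⟩ := 𝒱.isSmoothMetric_gForm.exists_orthonormalFrame x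
  have h1 : SmoothAt I F (fun y ↦ ∑ i, 𝒮.γ y (e i y) (A y (e i y))) x :=
    ContMDiffAt.sum_section fun i _ ↦
      𝒮.smoothAt_γ (he.smooth x hx i) (hA _ (he.smooth x hx i))
  refine ContMDiffAt.neg_section (𝒮.smoothAt_I_smul (h1.congr_of_eventuallyEq ?_))
  filter_upwards [he.isOpen.mem_nhds hx] with y hy
  rw [𝒮.contract_eq_sum he hy]

end Dirac

/-- The canonical spin d-connection and Dirac d-operator exist and are unique. -/
theorem hasCanonicalDirac [T2Space V] : 𝒮.HasCanonicalDirac := by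
  refine ⟨𝒱.canonicalD, 𝒱.isCanonicalDConnection_canonicalD, fun D' hD' X hX ↦
    hD'.eq_canonicalD hX, 𝒱.cliffordD, 𝒱.isCliffordExtension_cliffordD, fun 𝒟' h𝒟' a ha ↦
    h𝒟'.eq_cliffordD ha, 𝒮.spinConnection, 𝒮.isSpinDConnection_spinConnection,
    fun nab' h ψ hψ ↦ h.eq_spinConnection hψ, hasLocalForm_spinConnection, fun ψ hψ ↦
    ⟨fun x ↦ ?_, fun x ↦ ?_, fun x ↦ ?_, ?_⟩⟩
  · exact 𝒮.smoothAt_contract fun X hX ↦ 𝒮.smoothAt_spinConnection (hψ x) hX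
  · exact 𝒮.smoothAt_contract fun X hX ↦ 𝒮.smoothAt_spinConnection (hψ x)
      (𝒱.isOrthogonalProjection_hProj.smoothAt hX)
  · exact 𝒮.smoothAt_contract fun X hX ↦ 𝒮.smoothAt_spinConnection (hψ x)
      (𝒱.isOrthogonalProjection_N.smoothAt hX)
  · ext x
    have h1 : 𝒮.spinConnection ψ x = (𝒮.spinConnection ψ x).comp (𝒱.hProj x) +
        (𝒮.spinConnection ψ x).comp (𝒱.N x) := by
      ext ξ
      simp [NAnholonomicManifold.hProj]
    rw [Pi.add_apply, dirac, hDirac, vDirac, h1, contract_add, ← h1, smul_add, neg_add]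

end SpinStructure

theorem t2Space_totalSpace {B F : Type*} [TopologicalSpace B] [TopologicalSpace F] [T2Space B]
    [T2Space F] (W : B → Type*) [TopologicalSpace (TotalSpace F W)]
    [∀ b, TopologicalSpace (W b)] [FiberBundle F W] : T2Space (TotalSpace F W) where
  t2 p q hpq := by
    by_cases h : p.proj = q.proj
    · let t := trivializationAt F W p.proj
      have hp : p ∈ t.source := t.mem_source.2 (FiberBundle.mem_baseSet_trivializationAt' _)
      have hq : q ∈ t.source :=
        t.mem_source.2 (h ▸ FiberBundle.mem_baseSet_trivializationAt' p.proj)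
      obtain ⟨u, v, hu, hv, hpu, hqv, huv⟩ :=
        t2_separation fun h' : t p = t q ↦ hpq (t.injOn hp hq h')
      exact ⟨t.source ∩ t ⁻¹' u, t.source ∩ t ⁻¹' v,
        t.continuousOn.isOpen_inter_preimage t.open_source hu,
        t.continuousOn.isOpen_inter_preimage t.open_source hv, ⟨hp, hpu⟩, ⟨hq, hqv⟩,
        (huv.preimage t).mono inter_subset_right inter_subset_right⟩
    · exact separated_by_continuous (FiberBundle.continuous_proj F W) h

end NSpin
end

theorem mainTheorem2
    {E : Type*} [NormedAddCommGroup E] [NormedSpace ℝ E] [FiniteDimensional ℝ E]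
    {H : Type*} [TopologicalSpace H] {I : ModelWithCorners ℝ E H} [I.Boundaryless]
    {V : Type*} [TopologicalSpace V] [ChartedSpace H V] [IsManifold I ∞ V]
    [T2Space V] [SecondCountableTopology V]
    {E' : Type*} [NormedAddCommGroup E'] [NormedSpace ℝ E'] [FiniteDimensional ℝ E']
    {H' : Type*} [TopologicalSpace H'] {I' : ModelWithCorners ℝ E' H'} [I'.Boundaryless]
    {M : Type*} [TopologicalSpace M] [ChartedSpace H' M] [IsManifold I' ∞ M]
    [T2Space M] [SecondCountableTopology M]
    {F : Type*} [NormedAddCommGroup F] [NormedSpace ℝ F] [FiniteDimensional ℝ F] :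
    (∀ (𝒱 : NSpin.NAnholonomicManifold I V I' M)
      (Sp : V → Type*) [TopologicalSpace (TotalSpace F Sp)]
      [∀ x, AddCommGroup (Sp x)] [∀ x, Module ℂ (Sp x)] [∀ x, TopologicalSpace (Sp x)]
      [∀ x, IsTopologicalAddGroup (Sp x)] [∀ x, ContinuousSMul ℝ (Sp x)]
      [FiberBundle F Sp] [VectorBundle ℝ F Sp] [ContMDiffVectorBundle ∞ F Sp I]
      (𝒮 : NSpin.SpinStructure 𝒱 F Sp), 𝒮.HasCanonicalDirac) ∧
    (∀ (L : TangentBundle I' M → ℝ)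
      (𝒱 : NSpin.NAnholonomicManifold I'.tangent (NSpin.slitTangent I' M) I' M),
      NSpin.IsLagrangeSpace L 𝒱 →
      ∀ (Sp : NSpin.slitTangent I' M → Type*) [TopologicalSpace (TotalSpace F Sp)]
      [∀ x, AddCommGroup (Sp x)] [∀ x, Module ℂ (Sp x)] [∀ x, TopologicalSpace (Sp x)]
      [∀ x, IsTopologicalAddGroup (Sp x)] [∀ x, ContinuousSMul ℝ (Sp x)]
      [FiberBundle F Sp] [VectorBundle ℝ F Sp] [ContMDiffVectorBundle ∞ F Sp I'.tangent]
      (𝒮 : NSpin.SpinStructure 𝒱 F Sp), 𝒮.HasCanonicalDirac) := by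
  refine ⟨fun _ _ _ _ _ _ _ _ _ _ _ 𝒮 ↦ 𝒮.hasCanonicalDirac, fun _ _ _ _ _ _ _ _ _ _ _ _ _ 𝒮 ↦ ?_⟩
  have : T2Space (TangentBundle I' M) := NSpin.t2Space_totalSpace _
  exact 𝒮.hasCanonicalDirac
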